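/- **Definitions.** A *$C^*$-precategory* with objects $\mathbb N=\{0,1,2,\dots\}$ consists of complex Banach spaces $\mathcal T(m,n)$ (arrows from $m$ to $n$), an associative bilinear composition $\mathcal T(m,n)\times\mathcal T(l,m)\to\mathcal T(l,n)$ with $\|ab\|\le\|a\|\|b\|$, and an antilinear, involutive, contravariant operation $a\mapsto a^*$, $\mathcal T(m,n)\to\mathcal T(n,m)$, with $\|a^*a\|=\|a\|^2$. It is *right tensor* if it carries linear maps $\mathcal T(m,n)\ni a\mapsto a\otimes 1\in\mathcal T(m+1,n+1)$ with $(ab)\otimes1=(a\otimes 1)(b\otimes 1)$ and $a^*\otimes 1=(a\otimes 1)^*$; $a\otimes 1^k$ is the $k$-th iterate. An *ideal* $\mathcal K$ is a family of closed subspaces $\mathcal K(m,n)\subset\mathcal T(m,n)$ stable under composition with arrows of $\mathcal T$ from both sides (it is then self-adjoint). Put $J(\mathcal K)(m,n)=\{a\in\mathcal K(m,n):a\otimes1\in\mathcal K(m+1,n+1)\}$. A *right tensor representation* of $\mathcal K$ in a $C^*$-algebra $B$ is a family of linear maps $\pi_{nm}:\mathcal K(m,n)\to B$ with $\pi_{nm}(a)^*=\pi_{mn}(a^*)$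 and $\pi_{nm}(a)\pi_{m+k,l}(b)=\pi_{n+k,l}((a\otimes 1^k)b)$ for $a\in\mathcal K(m,n)$, $b\in\mathcal K(l,m+k)$, $k\ge 0$. It is *coisometric* on an ideal $\mathcal J\subset J(\mathcal K)$ if $\pi_{nm}(a)=\pi_{n+1,m+1}(a\otimes 1)$ for all $a\in\mathcal J(m,n)$. Let $\mathcal M_{\mathcal T}(\mathcal K)$ be the space of matrices $\{a_{nm}\}_{n,m\in\mathbb N}$ with $a_{nm}\in\mathcal K(m,n)$ and finitely many nonzero entries, with $(a^*)_{nm}=(a_{mn})^*$ and $$a\star b=a\cdot\sum_{k\ge0}\Lambda^k(b)+\sum_{k\ge1}\Lambda^k(a)\cdot b,$$ where $\cdot$ is the matrix product and $\Lambda(a)_{n+1,m+1}=a_{nm}\otimes 1$, with row $0$ and column $0$ of $\Lambda(a)$ equal to zero. Let $i^{\mathcal M}_{(n,m)}(a)$ be the matrix with single entry $a\in\mathcal K(m,n)$ at $(n,m)$. For $r\ge 0$, $k\in\mathbb Z$, $r+k\ge0$, let $\mathcal M(r+k,r)$ be the space of $a\in\mathcal M_{\mathcal T}(\mathcal K)$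 such that $a_{ij}\ne0$ implies $j-i=k$ and $i\le r$. Let $q_{\mathcal J}:\mathcal T\to\mathcal T/\mathcal J$ be the quotient map and put $$\|a\|^{\mathcal J}_{r+k,r}=\max\Big\{\max_{0\le s<r}\Big\|q_{\mathcal J}\Big(\sum_{0\le i\le s,\ i+k\ge0}a_{i,i+k}\otimes1^{s-i}\Big)\Big\|,\ \Big\|\sum_{0\le i\le r,\ i+k\ge0}a_{i,i+k}\otimes1^{r-i}\Big\|\Big\},\qquad \|a\|_{\mathcal J}=\sum_{k\in\mathbb Z}\lim_{r\to\infty}\|a\|^{\mathcal J}_{r+k,r}.$$ **Theorem.** Let $\mathcal K$ be an ideal in a right tensor $C^*$-precategory $\mathcal T$ and let $\mathcal J\subset J(\mathcal K)$ be an ideal in $\mathcal T$. 1. $\mathcal M_{\mathcal T}(\mathcal K)$ with $\star$ and $*$ is an (associative) $*$-algebra, the maps $i^{\mathcal M}_{(n,m)}$ form a right tensor representation of $\mathcal K$ in it, the limits above exist, and $\|\cdot\|_{\mathcal J}$ is a submultiplicative $*$-seminorm on it. 2. $\|\cdot\|^{\mathcal J}_{m,n}$ is a seminorm on $\mathcal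 M(m,n)$, and the quotients $\mathcal K_{\mathcal J}(m,n)=\mathcal M(m,n)/\|\cdot\|^{\mathcal J}_{m,n}$ form a right tensor $C^*$-precategory with the operations induced from $\mathcal M_{\mathcal T}(\mathcal K)$ and the right tensoring $\otimes_{\mathcal J}1$ induced by the inclusions $\mathcal M(m,n)\subset\mathcal M(m+1,n+1)$. The maps $\otimes_{\mathcal J}1$ are all injective if and only if $\mathcal J\subset(\ker\otimes1)^\perp$, where $(\ker\otimes 1)^\perp(m,n)$ is the set of $a\in\mathcal T(m,n)$ with $a^*a\,b=0$ for all $b\in\mathcal T(m,m)$ with $b\otimes1=0$. 3. There exist a $C^*$-algebra $\mathcal O=\mathcal O_{\mathcal T}(\mathcal K,\mathcal J)$ and a right tensor representation $i=\{i_{(n,m)}\}$ of $\mathcal K$ in $\mathcal O$, coisometric on $\mathcal J$, such that $\mathcal O$ is generated as a $C^*$-algebra by $\bigcup_{n,m}i_{(n,m)}(\mathcal K(m,n))$, and for every right tensor representation $\pi$ of $\mathcal K$ in a $C^*$-algebra $B$ that is coisometric on $\mathcal J$ there is a (unique) $*$-homomorphism $\Psi_\pi:\mathcal O\to B$ with $\Psi_\pi(i_{(n,m)}(a))=\pi_{nm}(a)$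 for all $a\in\mathcal K(m,n)$, $n,m\in\mathbb N$. 4. The formula $\Phi(i^{\mathcal M}_{(n,m)}(a))=i_{(n,m)}(a)$ defines a $*$-homomorphism $\Phi:\mathcal M_{\mathcal T}(\mathcal K)\to\mathcal O$ with $\|\Phi(a)\|\le\|a\|_{\mathcal J}$, through which $\mathcal O$ is the enveloping $C^*$-algebra of the quotient $*$-algebra $\mathcal M_{\mathcal T}(\mathcal K)/\|\cdot\|_{\mathcal J}$, i.e. its completion in its largest $C^*$-seminorm. 5. Suppose moreover that $a^*a$ is a positive element of the $C^*$-algebra $\mathcal T(m,m)$ for every $a\in\mathcal T(m,n)$ (as in the usual definition of a $C^*$-category). Then $\mathcal K_{\mathcal J}$ has the same property, and $\mathcal O$ is also obtained from $\mathcal K_{\mathcal J}$ by the Doplicher–Roberts method: for each $k\in\mathbb Z$ the maps $\mathcal K_{\mathcal J}(r+k,r)\to\mathcal O$ induced by $\Phi$ identify the Banach space inductive limit $\mathcal O^{(k)}=\varinjlim_r\mathcal K_{\mathcal J}(r+k,r)$ (along $\otimes_{\mathcal J}1$) isometrically with a closed subspace of $\mathcal O$; the sum of the $\mathcal O^{(k)}$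 is direct, and it is a $\mathbb Z$-graded $*$-algebra with the operations induced from $\mathcal K_{\mathcal J}$; $\mathcal O$ is its completion in a $C^*$-norm for which the circle action given by $z\mapsto z^k$ on $\mathcal O^{(k)}$ is isometric; and this is the only such $C^*$-norm on $\bigoplus_k\mathcal O^{(k)}$. -/

import Mathlib

open Filter Topology

universe u v

noncomputable section

/-- A C*-precategory with objects `Ob`: `Hom σ ρ` is the complex Banach space of arrows from `σ` to
`ρ`, `comp a b` is the composition `ab`, `adj a` is the adjoint `a^*`. There need not be identity
arrows. -/
structure CStarPrecategory (Ob : Type v) where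
  Hom : Ob → Ob → Type u
  [normedAddCommGroup : ∀ σ ρ, NormedAddCommGroup (Hom σ ρ)]
  [normedSpace : ∀ σ ρ, NormedSpace ℂ (Hom σ ρ)]
  [completeSpace : ∀ σ ρ, CompleteSpace (Hom σ ρ)]
  comp : ∀ {σ ρ τ : Ob}, Hom σ ρ → Hom τ σ → Hom τ ρ
  add_comp : ∀ {σ ρ τ : Ob} (a a' : Hom σ ρ) (b : Hom τ σ),
    comp (a + a') b = comp a b + comp a' b
  comp_add : ∀ {σ ρ τ : Ob} (a : Hom σ ρ) (b b' : Hom τ σ),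
    comp a (b + b') = comp a b + comp a b'
  smul_comp : ∀ {σ ρ τ : Ob} (c : ℂ) (a : Hom σ ρ) (b : Hom τ σ),
    comp (c • a) b = c • comp a b
  comp_smul : ∀ {σ ρ τ : Ob} (c : ℂ) (a : Hom σ ρ) (b : Hom τ σ),
    comp a (c • b) = c • comp a b
  comp_assoc : ∀ {σ ρ τ υ : Ob} (a : Hom σ ρ) (b : Hom τ σ) (c : Hom υ τ),
    comp (comp a b) c = comp a (comp b c)
  norm_comp_le : ∀ {σ ρ τ : Ob} (a : Hom σ ρ) (b : Hom τ σ), ‖comp a b‖ ≤ ‖a‖ * ‖b‖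
  adj : ∀ {σ ρ : Ob}, Hom σ ρ → Hom ρ σ
  adj_add : ∀ {σ ρ : Ob} (a b : Hom σ ρ), adj (a + b) = adj a + adj b
  adj_smul : ∀ {σ ρ : Ob} (c : ℂ) (a : Hom σ ρ), adj (c • a) = (starRingEnd ℂ c) • adj a
  adj_adj : ∀ {σ ρ : Ob} (a : Hom σ ρ), adj (adj a) = a
  adj_comp : ∀ {σ ρ τ : Ob} (a : Hom σ ρ) (b : Hom τ σ), adj (comp a b) = comp (adj b) (adj a)
  norm_adj_comp_self : ∀ {σ ρ : Ob} (a : Hom σ ρ), ‖comp (adj a) a‖ = ‖a‖ ^ 2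

attribute [instance] CStarPrecategory.normedAddCommGroup CStarPrecategory.normedSpace
  CStarPrecategory.completeSpace

namespace CStarPrecategory

variable {Ob : Type v} (T : CStarPrecategory.{u, v} Ob)

/-- Every `a^* a` is a positive element of the C*-algebra of endomorphisms of the source of `a`
(in a C*-algebra, the positive elements are those of the form `b^* b`). -/
def IsPositive : Prop :=
  ∀ (σ ρ : Ob) (a : T.Hom σ ρ), ∃ b : T.Hom σ σ, T.comp (T.adj a) a = T.comp (T.adj b) b

lemma zero_comp {σ ρ τ : Ob} (b : T.Hom τ σ) : T.comp (0 : T.Hom σ ρ) b = 0 := by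
  have h := T.smul_comp 0 (0 : T.Hom σ ρ) b
  rwa [zero_smul, zero_smul] at h

lemma comp_zero {σ ρ τ : Ob} (a : T.Hom σ ρ) : T.comp a (0 : T.Hom τ σ) = 0 := by
  have h := T.comp_smul 0 a (0 : T.Hom τ σ)
  rwa [zero_smul, zero_smul] at h

lemma adj_zero {σ ρ : Ob} : T.adj (0 : T.Hom σ ρ) = 0 := by
  have h := T.adj_smul 0 (0 : T.Hom σ ρ)
  rwa [map_zero, zero_smul, zero_smul] at h

lemma adj_sub {σ ρ : Ob} (a b : T.Hom σ ρ) : T.adj (a - b) = T.adj a - T.adj b := by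
  have h := T.adj_add (a - b) b
  rw [sub_add_cancel] at h
  rw [h, add_sub_cancel_right]

lemma sub_comp {σ ρ τ : Ob} (a a' : T.Hom σ ρ) (b : T.Hom τ σ) :
    T.comp (a - a') b = T.comp a b - T.comp a' b := by
  have h := T.add_comp (a - a') a' b
  rw [sub_add_cancel] at h
  rw [h, add_sub_cancel_right]

lemma comp_sub {σ ρ τ : Ob} (a : T.Hom σ ρ) (b b' : T.Hom τ σ) :
    T.comp a (b - b') = T.comp a b - T.comp a b' := by
  have h := T.comp_add a (b - b') b'
  rw [sub_add_cancel] at h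
  rw [h, add_sub_cancel_right]

lemma norm_adj {σ ρ : Ob} (a : T.Hom σ ρ) : ‖T.adj a‖ = ‖a‖ := by
  have key : ∀ {σ ρ : Ob} (a : T.Hom σ ρ), ‖a‖ ≤ ‖T.adj a‖ := by
    intro σ ρ a
    rcases (norm_nonneg a).eq_or_lt with h | h
    · rw [← h]; exact norm_nonneg _
    · have h1 := T.norm_adj_comp_self a
      have h2 := T.norm_comp_le (T.adj a) a
      rw [h1, sq] at h2
      exact le_of_mul_le_mul_right h2 h
  refine le_antisymm ?_ (key a)
  have h := key (T.adj a)
  rwa [T.adj_adj] at h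

/-- The C*-algebra of endomorphisms of an object. -/
@[reducible] def endAlgebra (σ : Ob) : NonUnitalCStarAlgebra (T.Hom σ σ) :=
  { T.normedAddCommGroup σ σ, T.normedSpace σ σ with
    mul := fun a b => T.comp a b
    left_distrib := fun a b c => T.comp_add a b c
    right_distrib := fun a b c => T.add_comp a b c
    zero_mul := fun a => T.zero_comp a
    mul_zero := fun a => T.comp_zero a
    mul_assoc := fun a b c => T.comp_assoc a b c
    norm_mul_le := fun a b => T.norm_comp_le a b
    star := fun a => T.adj a
    star_involutive := fun a => T.adj_adj a
    star_mul := fun a b => T.adj_comp a b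
    star_add := fun a b => T.adj_add a b
    complete := (T.completeSpace σ σ).complete
    norm_mul_self_le := fun a => by
      have h := T.norm_adj_comp_self a
      rw [sq] at h
      exact h.ge
    smul_assoc := fun c a b => T.smul_comp c a b
    smul_comm := fun c a b => (T.comp_smul c a b).symm
    star_smul := fun c a => T.adj_smul c a }

/-- A closed two-sided ideal in a C*-precategory. -/
structure CStarIdeal where
  carrier : ∀ σ ρ : Ob, Submodule ℂ (T.Hom σ ρ)
  isClosed : ∀ σ ρ : Ob, IsClosed (carrier σ ρ : Set (T.Hom σ ρ))
  comp_mem_left : ∀ {σ ρ τ : Ob} (a : T.Hom σ ρ) (b : T.Hom τ σ),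
    b ∈ carrier τ σ → T.comp a b ∈ carrier τ ρ
  comp_mem_right : ∀ {σ ρ τ : Ob} (a : T.Hom σ ρ) (b : T.Hom τ σ),
    a ∈ carrier σ ρ → T.comp a b ∈ carrier τ ρ

instance : CoeFun T.CStarIdeal (fun _ => ∀ σ ρ : Ob, Submodule ℂ (T.Hom σ ρ)) :=
  ⟨CStarIdeal.carrier⟩

lemma exists_approx {A : Type u} [NonUnitalCStarAlgebra A] (c : A) (hc : IsSelfAdjoint c)
    (ε : ℝ) (hε : 0 < ε) :
    ∃ h : A, IsSelfAdjoint (c * h) ∧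
      ‖c - (c * h) * c - c * (c * h) + (c * h) * c * (c * h)‖ ≤ ε := by
  have hpos : ∀ t : ℝ, 0 < ε ^ 2 + t ^ 2 := fun t => by positivity
  have hcont : Continuous (fun t : ℝ => t / (ε ^ 2 + t ^ 2)) :=
    continuous_id.div (by fun_prop) (fun t => (hpos t).ne')
  let g : ℝ → ℝ := fun t => t * (t / (ε ^ 2 + t ^ 2))
  have hgc : Continuous g := continuous_id.mul hcont
  have hg0 : g 0 = 0 := by simp [g]
  have hg : c * cfcₙ (fun t : ℝ => t / (ε ^ 2 + t ^ 2)) c = cfcₙ g c := by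
    have h1 := cfcₙ_mul (fun t : ℝ => t) (fun t : ℝ => t / (ε ^ 2 + t ^ 2)) c
      continuous_id.continuousOn rfl hcont.continuousOn (by simp)
    rw [cfcₙ_id' ℝ c hc] at h1
    exact h1.symm
  refine ⟨cfcₙ (fun t : ℝ => t / (ε ^ 2 + t ^ 2)) c, ?_, ?_⟩
  · rw [hg]; exact cfcₙ_predicate g c
  · rw [hg]
    have e1 : cfcₙ g c * c = cfcₙ (fun t => g t * t) c := by
      rw [cfcₙ_mul g (fun t : ℝ => t) c hgc.continuousOn hg0 continuous_id.continuousOn rfl,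
        cfcₙ_id' ℝ c hc]
    have e2 : c * cfcₙ g c = cfcₙ (fun t => t * g t) c := by
      rw [cfcₙ_mul (fun t : ℝ => t) g c continuous_id.continuousOn rfl hgc.continuousOn hg0,
        cfcₙ_id' ℝ c hc]
    have e3 : cfcₙ g c * c * cfcₙ g c = cfcₙ (fun t => g t * t * g t) c := by
      rw [e1, ← cfcₙ_mul (fun t => g t * t) g c (by fun_prop) (by simp) hgc.continuousOn hg0]
    rw [e3, e1, e2]
    nth_rewrite 1 [← cfcₙ_id' ℝ c hc]
    rw [← cfcₙ_sub (fun t : ℝ => t) (fun t => g t * t) c continuous_id.continuousOn rfl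
        (by fun_prop) (by simp),
      ← cfcₙ_sub (fun t : ℝ => t - g t * t) (fun t => t * g t) c (by fun_prop) (by simp)
        (by fun_prop) (by simp),
      ← cfcₙ_add (fun t : ℝ => t - g t * t - t * g t) (fun t => g t * t * g t) c (by fun_prop)
        (by simp) (by fun_prop) (by simp)]
    refine norm_cfcₙ_le (fun t _ => ?_)
    have h1 : t - g t * t - t * g t + g t * t * g t = t * (ε ^ 2 / (ε ^ 2 + t ^ 2)) ^ 2 := by
      have := (hpos t).ne'
      simp only [g]
      field_simp
      ring
    rw [h1, norm_mul, norm_pow, Real.norm_eq_abs, Real.norm_eq_abs,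
      abs_of_pos (div_pos (by positivity) (hpos t))]
    have h2 : ε ^ 2 / (ε ^ 2 + t ^ 2) ≤ 1 := by
      rw [div_le_one (hpos t)]; nlinarith [sq_nonneg t]
    have h3 : 0 < ε ^ 2 / (ε ^ 2 + t ^ 2) := div_pos (by positivity) (hpos t)
    have h4 : |t| * (ε ^ 2 / (ε ^ 2 + t ^ 2)) ≤ ε := by
      rw [← mul_div_assoc, div_le_iff₀ (hpos t), ← sq_abs t]
      nlinarith [sq_nonneg (ε - |t|), abs_nonneg t,
        mul_nonneg hε.le (sq_nonneg (ε - |t|)), mul_nonneg hε.le (mul_nonneg hε.le (abs_nonneg t))]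
    calc |t| * (ε ^ 2 / (ε ^ 2 + t ^ 2)) ^ 2
        = (|t| * (ε ^ 2 / (ε ^ 2 + t ^ 2))) * (ε ^ 2 / (ε ^ 2 + t ^ 2)) := by ring
      _ ≤ ε * 1 := by gcongr
      _ = ε := mul_one ε

variable {T}

/-- Closed two-sided ideals are self-adjoint. -/
theorem CStarIdeal.adj_mem (K : T.CStarIdeal) {σ ρ : Ob} {a : T.Hom σ ρ} (ha : a ∈ K σ ρ) :
    T.adj a ∈ K ρ σ := by
  have hclosed := K.isClosed ρ σ
  have hmem : T.adj a ∈ closure (K ρ σ : Set (T.Hom ρ σ)) := by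
    rw [Metric.mem_closure_iff]
    intro ε hε
    let _ := T.endAlgebra σ
    obtain ⟨h, hh1, hh2⟩ := exists_approx (T.comp (T.adj a) a)
      (show T.adj (T.comp (T.adj a) a) = _ by rw [T.adj_comp, T.adj_adj])
      ((ε / 2) ^ 2) (by positivity)
    set g : T.Hom σ σ := T.comp (T.comp (T.adj a) a) h with hg
    have hga : T.adj g = g := hh1
    have hgK : g ∈ K σ σ := K.comp_mem_right _ _ (K.comp_mem_left _ _ ha)
    refine ⟨T.comp g (T.adj a), K.comp_mem_right _ _ hgK, ?_⟩
    rw [dist_eq_norm]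
    have e1 : T.adj a - T.comp g (T.adj a) = T.adj (a - T.comp a g) := by
      rw [T.adj_sub, T.adj_comp, hga]
    rw [e1, T.norm_adj]
    have e2 : T.comp (T.adj (a - T.comp a g)) (a - T.comp a g)
        = T.comp (T.adj a) a - T.comp g (T.comp (T.adj a) a) - T.comp (T.comp (T.adj a) a) g
          + T.comp (T.comp g (T.comp (T.adj a) a)) g := by
      rw [T.adj_sub, T.adj_comp, hga]
      simp only [T.sub_comp, T.comp_sub, T.comp_assoc]
      abel
    have e3 : ‖a - T.comp a g‖ ^ 2 ≤ (ε / 2) ^ 2 := by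
      rw [← T.norm_adj_comp_self, e2]
      exact hh2
    have e4 := abs_le_of_sq_le_sq e3 (by positivity)
    rw [abs_norm] at e4
    linarith
  rwa [hclosed.closure_eq] at hmem

end CStarPrecategory

/-- A right tensor C*-precategory: the objects are the natural numbers, and `a ↦ a ⊗ 1` is an
endomorphism taking the object `n` to `n + 1`. -/
structure RightTensorCStarPrecategory extends CStarPrecategory.{u, 0} ℕ where
  tensor : ∀ {m n : ℕ}, Hom m n →ₗ[ℂ] Hom (m + 1) (n + 1)
  tensor_comp : ∀ {l m n : ℕ} (a : Hom m n) (b : Hom l m),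
    tensor (comp a b) = comp (tensor a) (tensor b)
  tensor_adj : ∀ {m n : ℕ} (a : Hom m n), tensor (adj a) = adj (tensor a)

namespace RightTensorCStarPrecategory

open CStarPrecategory

variable (T : RightTensorCStarPrecategory.{u})

/-- `a ↦ a ⊗ 1^k`. -/
def tensorPow : ∀ (k : ℕ) {m n : ℕ}, T.Hom m n →ₗ[ℂ] T.Hom (m + k) (n + k)
  | 0, _, _ => LinearMap.id
  | k + 1, _, _ => T.tensor ∘ₗ tensorPow k

/-- The kernel of the right tensoring. -/
def kerTensor (m n : ℕ) : Submodule ℂ (T.Hom m n) := LinearMap.ker T.tensor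

variable {T}

/-- The ideal `J(K) = (⊗1)⁻¹(K) ∩ K`. -/
def tensorIdeal (K : T.CStarIdeal) (m n : ℕ) : Submodule ℂ (T.Hom m n) :=
  (K (m + 1) (n + 1)).comap T.tensor ⊓ K m n

/-- The annihilator of an ideal `I`: it consists of the arrows `a` such that `a^* a` lies in the
annihilator of the ideal `I(m, m)` of the C*-algebra `T(m, m)`. -/
def annihilator (I : ∀ m n : ℕ, Submodule ℂ (T.Hom m n)) (m n : ℕ) : Set (T.Hom m n) :=
  {a | ∀ b ∈ I m m, T.comp (T.comp (T.adj a) a) b = 0}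

/-! ### Right tensor representations -/

/-- A right tensor representation of the ideal `K` in the C*-algebra `B`; `π n m` is the map
`π_{nm} : K(m, n) → B`. Taking `k = 0` in `map_tensor` gives `π_{nm}(a) π_{ml}(b) = π_{nl}(ab)`. -/
structure RightTensorRep (K : T.CStarIdeal) (B : Type v) [NonUnitalCStarAlgebra B] where
  toFun : ∀ n m : ℕ, K m n →ₗ[ℂ] B
  map_adj : ∀ (n m : ℕ) (a : K m n), toFun m n ⟨T.adj a, K.adj_mem a.2⟩ = star (toFun n m a)
  map_tensor : ∀ (n m k l : ℕ) (a : K m n) (b : K l (m + k)),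
    toFun n m a * toFun (m + k) l b =
      toFun (n + k) l ⟨T.comp (T.tensorPow k (a : T.Hom m n)) b, K.comp_mem_left _ _ b.2⟩

instance (K : T.CStarIdeal) (B : Type v) [NonUnitalCStarAlgebra B] :
    CoeFun (RightTensorRep K B) (fun _ => ∀ n m : ℕ, K m n →ₗ[ℂ] B) :=
  ⟨RightTensorRep.toFun⟩

/-- `π` is coisometric on `J`: `π_{nm}(a) = π_{n+1,m+1}(a ⊗ 1)` for `a ∈ J(m, n)`
(used for `J ⊆ J(K)`). -/
def RightTensorRep.IsCoisometricOn {K : T.CStarIdeal} {B : Type v} [NonUnitalCStarAlgebra B]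
    (π : RightTensorRep K B) (J : T.CStarIdeal) : Prop :=
  ∀ (n m : ℕ) (a : T.Hom m n), a ∈ J m n → ∀ (ha : a ∈ K m n)
    (ha' : T.tensor a ∈ K (m + 1) (n + 1)), π n m ⟨a, ha⟩ = π (n + 1) (m + 1) ⟨T.tensor a, ha'⟩

/-! ### The matrix `*`-algebra -/

variable (T) in
/-- Infinite matrices `{a_{nm}}` with entries `a_{nm} ∈ T(m, n)`. -/
abbrev Mat : Type u := ∀ n m : ℕ, T.Hom m n

namespace Mat

/-- `Λ(a)_{n+1,m+1} = a_{nm} ⊗ 1`, and the entries in row `0` and in column `0` vanish. -/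
def shift (a : T.Mat) : T.Mat
  | n + 1, m + 1 => T.tensor (a n m)
  | 0, _ => 0
  | _ + 1, 0 => 0

/-- The sum `∑_{k ≥ k₀} Λ^k(a)`; the sum defining the entry `(n, m)` stops at `k = n` because
`Λ^k(a)_{nm} = 0` for `k > n` (see `iterate_shift_eq_zero`). -/
def shiftSum (k₀ : ℕ) (a : T.Mat) : T.Mat :=
  fun n m => ∑ k ∈ Finset.Icc k₀ n, (shift^[k] a) n m

/-- The usual matrix product. -/
def matMul (a b : T.Mat) : T.Mat :=
  fun n m => ∑ᶠ i : ℕ, T.comp (a n i) (b i m)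

/-- `a ⋆ b = a · ∑_{k ≥ 0} Λ^k(b) + ∑_{k ≥ 1} Λ^k(a) · b`. -/
def starMul (a b : T.Mat) : T.Mat := matMul a (shiftSum 0 b) + matMul (shiftSum 1 a) b

/-- `(a^*)_{nm} = (a_{mn})^*`. -/
def conj (a : T.Mat) : T.Mat := fun n m => T.adj (a m n)

lemma iterate_shift_eq_zero (a : T.Mat) :
    ∀ (k n m : ℕ), (n < k ∨ m < k) → (shift^[k] a) n m = 0
  | 0, _, _, h => by omega
  | k + 1, 0, _, _ => by rw [Function.iterate_succ_apply']; rfl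
  | k + 1, n + 1, 0, _ => by rw [Function.iterate_succ_apply']; rfl
  | k + 1, n + 1, m + 1, h => by
    rw [Function.iterate_succ_apply']
    change T.tensor ((shift^[k] a) n m) = 0
    rw [iterate_shift_eq_zero a k n m (by omega), map_zero]

/-- If `a` vanishes outside the square `[0, N) × [0, N)`, then `Λ^k(a)` vanishes outside
`[0, N + k) × [0, N + k)`. -/
lemma iterate_shift_eq_zero_of_le (a : T.Mat) (N : ℕ)
    (ha : ∀ n m, (N ≤ n ∨ N ≤ m) → a n m = 0) :
    ∀ (k n m : ℕ), (N + k ≤ n ∨ N + k ≤ m) → (shift^[k] a) n m = 0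
  | 0, n, m, h => ha n m (by omega)
  | k + 1, 0, _, _ => by rw [Function.iterate_succ_apply']; rfl
  | k + 1, n + 1, 0, _ => by rw [Function.iterate_succ_apply']; rfl
  | k + 1, n + 1, m + 1, h => by
    rw [Function.iterate_succ_apply']
    change T.tensor ((shift^[k] a) n m) = 0
    rw [iterate_shift_eq_zero_of_le a N ha k n m (by omega), map_zero]

end Mat

/-- The set `M_T(K)` of the matrices with entries `a_{nm} ∈ K(m, n)`, only finitely many of which
are non-zero. -/
def matrixSpace (K : T.CStarIdeal) : Submodule ℂ T.Mat where
  carrier := {a | (∀ n m, a n m ∈ K m n) ∧ {p : ℕ × ℕ | a p.1 p.2 ≠ 0}.Finite}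
  zero_mem' := ⟨fun _ _ => Submodule.zero_mem _, by simp⟩
  add_mem' := by
    rintro a b ⟨ha, ha'⟩ ⟨hb, hb'⟩
    refine ⟨fun n m => Submodule.add_mem _ (ha n m) (hb n m), (ha'.union hb').subset ?_⟩
    intro p hp
    by_contra h
    simp only [Set.mem_union, Set.mem_ofPred_eq, not_or, not_not] at h
    exact hp (by simp [h.1, h.2])
  smul_mem' := by
    rintro c a ⟨ha, ha'⟩
    refine ⟨fun n m => Submodule.smul_mem _ _ (ha n m), ha'.subset ?_⟩
    intro p hp h
    exact hp (by simp [h])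

namespace Mat

variable {K : T.CStarIdeal}

lemma exists_bound {a : T.Mat} (ha : a ∈ matrixSpace K) :
    ∃ N : ℕ, ∀ n m, (N ≤ n ∨ N ≤ m) → a n m = 0 := by
  obtain ⟨N, hN⟩ := (ha.2.image (fun p => p.1 + p.2)).bddAbove
  refine ⟨N + 1, fun n m h => ?_⟩
  by_contra hne
  have := hN ⟨(n, m), hne, rfl⟩
  simp only at this
  omega

lemma mem_of_bound {a : T.Mat} (h : ∀ n m, a n m ∈ K m n) (N : ℕ)
    (hN : ∀ n m, (N ≤ n ∨ N ≤ m) → a n m = 0) : a ∈ matrixSpace K := by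
  refine ⟨h, ((Set.finite_Iio N).prod (Set.finite_Iio N)).subset ?_⟩
  intro p hp
  by_contra hne
  simp only [Set.mem_prod, Set.mem_Iio, not_and_or, not_lt] at hne
  exact hp (hN _ _ hne)

lemma starMul_mem {a b : T.Mat} (ha : a ∈ matrixSpace K) (hb : b ∈ matrixSpace K) :
    starMul a b ∈ matrixSpace K := by
  obtain ⟨N, hN⟩ := exists_bound ha
  obtain ⟨N', hN'⟩ := exists_bound hb
  have z1 : ∀ n m, (N + N' ≤ n ∨ N + N' ≤ m) → matMul a (shiftSum 0 b) n m = 0 := by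
    intro n m h
    refine finsum_eq_zero_of_forall_eq_zero fun i => ?_
    by_cases hi : N ≤ n ∨ N ≤ i
    · rw [hN n i hi, T.zero_comp]
    · have : shiftSum 0 b i m = 0 := Finset.sum_eq_zero fun k hk => by
        rw [Finset.mem_Icc] at hk
        exact iterate_shift_eq_zero_of_le b N' hN' k i m (by omega)
      rw [this, T.comp_zero]
  have z2 : ∀ n m, (N + N' ≤ n ∨ N + N' ≤ m) → matMul (shiftSum 1 a) b n m = 0 := by
    intro n m h
    refine finsum_eq_zero_of_forall_eq_zero fun i => ?_
    by_cases hi : N' ≤ i ∨ N' ≤ m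
    · rw [hN' i m hi, T.comp_zero]
    · have : shiftSum 1 a n i = 0 := Finset.sum_eq_zero fun k hk => by
        by_cases hki : i < k
        · exact iterate_shift_eq_zero a k n i (by omega)
        · exact iterate_shift_eq_zero_of_le a N hN k n i (by omega)
      rw [this, T.zero_comp]
  refine mem_of_bound (fun n m => ?_) (N + N') (fun n m h => ?_)
  · refine Submodule.add_mem _ ?_ ?_
    · exact finsum_induction (· ∈ K m n) (Submodule.zero_mem _)
        (fun _ _ => Submodule.add_mem _) (fun i => K.comp_mem_right _ _ (ha.1 n i))
    · exact finsum_induction (· ∈ K m n) (Submodule.zero_mem _)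
        (fun _ _ => Submodule.add_mem _) (fun i => K.comp_mem_left _ _ (hb.1 i m))
  · change matMul a (shiftSum 0 b) n m + matMul (shiftSum 1 a) b n m = 0
    rw [z1 n m h, z2 n m h, add_zero]

lemma conj_mem {a : T.Mat} (ha : a ∈ matrixSpace K) : conj a ∈ matrixSpace K := by
  obtain ⟨N, hN⟩ := exists_bound ha
  refine mem_of_bound (fun n m => K.adj_mem (ha.1 m n)) N (fun n m h => ?_)
  change T.adj (a m n) = 0
  rw [hN m n h.symm, T.adj_zero]

end Mat

/-- The algebra `M_T(K)`, with the convolution product `⋆` and the involution `conj`. -/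
abbrev MatrixAlgebra (K : T.CStarIdeal) : Type u := matrixSpace K

instance (K : T.CStarIdeal) : Mul (MatrixAlgebra K) :=
  ⟨fun a b => ⟨Mat.starMul a b, Mat.starMul_mem a.2 b.2⟩⟩

instance (K : T.CStarIdeal) : Star (MatrixAlgebra K) :=
  ⟨fun a => ⟨Mat.conj a, Mat.conj_mem a.2⟩⟩

/-- The embedding `i^M_{(n,m)} : K(m, n) → M_T(K)`: a matrix with one entry. -/
def matrixEmb (K : T.CStarIdeal) (n m : ℕ) : K m n →ₗ[ℂ] MatrixAlgebra K where
  toFun a := ⟨Pi.single n (Pi.single m (a : T.Hom m n)), by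
    refine Mat.mem_of_bound (fun n' m' => ?_) (n + m + 1) (fun n' m' h => ?_)
    · rcases eq_or_ne n' n with rfl | hn
      · rcases eq_or_ne m' m with rfl | hm
        · simp
        · simp [hm]
      · simp [hn]
    · rcases eq_or_ne n' n with rfl | hn
      · rcases eq_or_ne m' m with rfl | hm
        · omega
        · simp [hm]
      · simp [hn]⟩
  map_add' a b := by
    ext1
    simp [Pi.single_add]
  map_smul' c a := by
    ext1
    simp [Pi.single_smul]

/-- The subspace `M(m, n)` of the matrices `a` such that `a_{ij} ≠ 0` only if `j - i = m - n` and
`i ≤ n`. -/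
def homogeneous (K : T.CStarIdeal) (m n : ℕ) : Submodule ℂ (MatrixAlgebra K) where
  carrier := {a | ∀ i j : ℕ, a.1 i j ≠ 0 → j + n = i + m ∧ i ≤ n}
  zero_mem' := fun i j h => absurd rfl h
  add_mem' := by
    intro a b ha hb i j h
    by_cases h1 : a.1 i j = 0
    · refine hb i j fun h2 => h ?_
      change a.1 i j + b.1 i j = 0
      rw [h1, h2, add_zero]
    · exact ha i j h1
  smul_mem' := by
    intro c a ha i j h
    refine ha i j fun h1 => h ?_
    change c • a.1 i j = 0
    rw [h1, smul_zero]

/-! ### The seminorms -/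

/-- For `k = m - n`, the number
`max {max_{0 ≤ s < n} ‖q_J(∑_{i ≤ s, i + k ≥ 0} a_{i,i+k} ⊗ 1^{s-i})‖,`
`‖∑_{i ≤ n, i + k ≥ 0} a_{i,i+k} ⊗ 1^{n-i}‖}`, where `q_J` is the quotient map `T → T / J`.
The sum `∑_{i ≤ s, i + k ≥ 0} a_{i,i+k} ⊗ 1^{s-i}` is the entry `(s, s + k)` of `∑_{j ≥ 0} Λ^j(a)`
if `s + k ≥ 0`, and it is empty otherwise; so `s` and `t = s + k` run below over the pairs
with `s < n`, `t < m` and `t - s = m - n`. -/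
def homNorm (J : T.CStarIdeal) (m n : ℕ) (a : T.Mat) : ℝ :=
  max
    ((((Finset.range n ×ˢ Finset.range m).filter (fun p => p.2 + n = p.1 + m)).sup
      fun p => ‖(J p.2 p.1).mkQ (Mat.shiftSum 0 a p.1 p.2)‖₊ : NNReal) : ℝ)
    ‖Mat.shiftSum 0 a n m‖

/-- The limit as `r → ∞` of the number above for `n = r`, `m = r + k`. -/
def degreeNorm (J : T.CStarIdeal) (k : ℤ) (a : T.Mat) : ℝ :=
  limUnder atTop (fun r : ℕ => homNorm J (r + k).toNat r a)

/-- `‖a‖_J`, the sum over all `k ∈ ℤ` of the limits above. -/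
def matNorm (J : T.CStarIdeal) (a : T.Mat) : ℝ := ∑ᶠ k : ℤ, degreeNorm J k a

/-! ### Enveloping C*-algebras -/

/-- A C*-seminorm on a complex vector space with a product and an involution. -/
structure IsCStarSeminorm {A : Type u} [AddCommGroup A] [Module ℂ A] [Mul A] [Star A]
    (p : Seminorm ℂ A) : Prop where
  mul_le : ∀ a b, p (a * b) ≤ p a * p b
  star_mul_self : ∀ a, p (star a * a) = p a ^ 2

/-- The C*-algebra `B` with the `*`-homomorphism `Φ : A → B` is the enveloping C*-algebra of the
quotient of the `*`-algebra `A` by the null space of `N`: it is the completion of this quotient in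
its largest C*-seminorm. -/
structure IsEnvelopingCStarAlgebra {A : Type u} [AddCommGroup A] [Module ℂ A] [Mul A] [Star A]
    (N : A → ℝ) {B : Type v} [NonUnitalCStarAlgebra B] (Φ : A →ₗ[ℂ] B) : Prop where
  map_mul : ∀ a b, Φ (a * b) = Φ a * Φ b
  map_star : ∀ a, Φ (star a) = star (Φ a)
  map_null : ∀ a, N a = 0 → Φ a = 0
  denseRange : DenseRange Φ
  maximal : ∀ p : Seminorm ℂ A, IsCStarSeminorm p → (∀ a, N a = 0 → p a = 0) →
    ∀ a, p a ≤ ‖Φ a‖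

/-! ### Inductive limits of Doplicher–Roberts type -/

section Limit

variable (S : RightTensorCStarPrecategory.{u}) {B : Type v} [NonUnitalCStarAlgebra B]
  (ι : ∀ m n : ℕ, S.Hom m n →ₗ[ℂ] B)

/-- The closed subspace spanned by the images of the spaces `S(m, n)` with `m - n = k`. -/
def limitSpace (k : ℤ) : Submodule ℂ B :=
  (⨆ p : {p : ℕ × ℕ // (p.1 : ℤ) - p.2 = k}, LinearMap.range (ι p.1.1 p.1.2)).topologicalClosure

/-- The sum of the spaces above. -/
def gradedSpace : Submodule ℂ B := ⨆ k : ℤ, limitSpace S ι k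

/-- `B` is the C*-algebra obtained from the right tensor C*-precategory `S` by the
Doplicher–Roberts method: for every `k`, the maps `ι m n` with `m - n = k` identify the Banach space
inductive limit of `S(r + k, r) → S(r + k + 1, r + 1) → ⋯` (along `⊗ 1`) with a
subspace `O^(k)` of `B`; the operations of the `*`-algebra `⨁ O^(k)` come from those of `S`; and
`B` is the completion of this `*`-algebra in its unique C*-norm for which the circle action defined
by the grading is isometric. -/
structure IsDoplicherRobertsLimit : Prop where
  map_tensor : ∀ (m n : ℕ) (x : S.Hom m n), ι (m + 1) (n + 1) (S.tensor x) = ι m n x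
  norm_map : ∀ (m n : ℕ) (x : S.Hom m n),
    Tendsto (fun k : ℕ => ‖S.tensorPow k x‖) atTop (𝓝 ‖ι m n x‖)
  map_comp : ∀ (l m n : ℕ) (x : S.Hom m n) (y : S.Hom l m),
    ι l n (S.comp x y) = ι m n x * ι l m y
  map_adj : ∀ (m n : ℕ) (x : S.Hom m n), ι n m (S.adj x) = star (ι m n x)
  independent : iSupIndep (limitSpace S ι)
  dense : (gradedSpace S ι).topologicalClosure = ⊤
  gauge : ∃ γ : Circle → (B ≃⋆ₐ[ℂ] B),
    (∀ (z : Circle) (k : ℤ), ∀ x ∈ limitSpace S ι k, γ z x = (z : ℂ) ^ k • x) ∧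
    ∀ p : Seminorm ℂ (gradedSpace S ι),
      (∀ x, p x = 0 → x = 0) →
      (∀ x y w : gradedSpace S ι, (w : B) = x * y → p w ≤ p x * p y) →
      (∀ x w : gradedSpace S ι, (w : B) = star (x : B) * x → p w = p x ^ 2) →
      (∀ (z : Circle) (x w : gradedSpace S ι), (w : B) = γ z x → p w = p x) →
      ∀ x, p x = ‖(x : B)‖

end Limit

/-! ### The algebra `M_T(K)` and the C*-precategory of its homogeneous parts -/

/-- `M_T(K)` is an (associative) algebra with involution, and the maps `i^M_{(n,m)}` form a right
tensor representation of `K` in it. -/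
structure IsStarAlgebraWithRep (K : T.CStarIdeal) : Prop where
  add_mul : ∀ a b c : MatrixAlgebra K, (a + b) * c = a * c + b * c
  mul_add : ∀ a b c : MatrixAlgebra K, a * (b + c) = a * b + a * c
  smul_mul : ∀ (t : ℂ) (a b : MatrixAlgebra K), (t • a) * b = t • (a * b)
  mul_smul : ∀ (t : ℂ) (a b : MatrixAlgebra K), a * (t • b) = t • (a * b)
  mul_assoc : ∀ a b c : MatrixAlgebra K, (a * b) * c = a * (b * c)
  star_star : ∀ a : MatrixAlgebra K, star (star a) = a
  star_add : ∀ a b : MatrixAlgebra K, star (a + b) = star a + star b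
  star_smul : ∀ (t : ℂ) (a : MatrixAlgebra K), star (t • a) = (starRingEnd ℂ t) • star a
  star_mul : ∀ a b : MatrixAlgebra K, star (a * b) = star b * star a
  emb_adj : ∀ (n m : ℕ) (a : K m n),
    matrixEmb K m n ⟨T.adj a, K.adj_mem a.2⟩ = star (matrixEmb K n m a)
  emb_tensor : ∀ (n m k l : ℕ) (a : K m n) (b : K l (m + k)),
    matrixEmb K n m a * matrixEmb K (m + k) l b =
      matrixEmb K (n + k) l ⟨T.comp (T.tensorPow k (a : T.Hom m n)) b, K.comp_mem_left _ _ b.2⟩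

/-- The right tensor C*-precategory `S` is `{M(m, n) / ‖·‖_{m,n}^J}`, with the operations of
`M_T(K)` and the right tensoring induced by the inclusions `M(m, n) ⊆ M(m + 1, n + 1)`; here
`Q m n` is the quotient map `M(m, n) → S(m, n)`. -/
structure IsHomogeneousQuotient (K J : T.CStarIdeal) (S : RightTensorCStarPrecategory.{u})
    (Q : ∀ m n : ℕ, homogeneous K m n →ₗ[ℂ] S.Hom m n) : Prop where
  surjective : ∀ m n, Function.Surjective (Q m n)
  norm_map : ∀ (m n : ℕ) (a : homogeneous K m n), ‖Q m n a‖ = homNorm J m n (a : MatrixAlgebra K)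
  mul_mem : ∀ (l m n : ℕ) (a : homogeneous K m n) (b : homogeneous K l m),
    (a * b : MatrixAlgebra K) ∈ homogeneous K l n
  map_mul : ∀ (l m n : ℕ) (a : homogeneous K m n) (b : homogeneous K l m)
    (c : homogeneous K l n), (c : MatrixAlgebra K) = a * b → Q l n c = S.comp (Q m n a) (Q l m b)
  star_mem : ∀ (m n : ℕ) (a : homogeneous K m n), star (a : MatrixAlgebra K) ∈ homogeneous K n m
  map_star : ∀ (m n : ℕ) (a : homogeneous K m n) (c : homogeneous K n m),
    (c : MatrixAlgebra K) = star (a : MatrixAlgebra K) → Q n m c = S.adj (Q m n a)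
  le_succ : ∀ m n : ℕ, homogeneous K m n ≤ homogeneous K (m + 1) (n + 1)
  map_tensor : ∀ (m n : ℕ) (a : homogeneous K m n) (c : homogeneous K (m + 1) (n + 1)),
    (c : MatrixAlgebra K) = a → Q (m + 1) (n + 1) c = S.tensor (Q m n a)

end RightTensorCStarPrecategory

end

open RightTensorCStarPrecategory

-- The linear map `shiftSum 0`, a ↦ Σ_{k ≥ 0} Λ^k(a), is injective, since a = x − Λ(x) is recovered
-- from its value x. It commutes with the involution and turns ⋆ into the ordinary matrix product
-- (`Mat.shiftSum_starMul`). Hence M_T(K) is a `*`-algebra of row- and column-finite matrices, and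
-- its laws are inherited from matrix multiplication. Under this map M(m, n) becomes a space of
-- matrices x carried by one diagonal, with x_{s+1,t+1} = x_{st} ⊗ 1 from row n on. Products of such
-- matrices are formed entry by entry, and the seminorm on M(m, n) is the largest norm of finitely
-- many entries, the last one in T and the earlier ones in T/J. Submultiplicativity and the
-- C*-identity therefore hold because they hold in T and in T/J
-- (`CStarIdeal.norm_mkQ_adj_comp_self`). The seminorms decrease along M(m, n) ⊆ M(m+1, n+1) because
-- ⊗1 is contractive, so the limits exist. The quotients are complete because they embed with closed
-- range in a finite product of Banach spaces; here J ⊆ J(K) is essential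
-- (`exists_homogeneous_of_approx`).
--
-- A `*`-homomorphism of M_T(K) into a C*-algebra that kills the null spaces of the homogeneous
-- seminorms factors through the C*-algebras K_J(m, m). It is contractive there, hence on every M(m,
-- n) by the C*-identity, and so it is bounded by ‖·‖_J (`norm_le_matNorm_of_null`). Consequently
-- the C*-seminorms vanishing on the null space of ‖·‖_J have a largest element, and O is the
-- completion in it. A right tensor representation of K is the same as a `*`-homomorphism of M_T(K).
-- Coisometry on J makes it kill the null spaces: entries whose sums lie in J can be pushed down the
-- diagonal (`RightTensorRep.toHom_eq`). Conversely a and a ⊗ 1, for a in J, differ by a null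
-- matrix. This gives the universal property.
--
-- For the Doplicher–Roberts description the point is that ‖·‖_J is not decreased on homogeneous
-- elements. Positivity of T passes to K_J through the inequality ‖y‖² ≤ ‖y*y + v*v‖, so the
-- degree-zero part is a positive expectation E onto the block diagonal matrices. Left
-- multiplication on the resulting Hilbert-module seminorm is a C*-seminorm whose value at a
-- homogeneous a, tested on a*, is at least ‖a‖_J (`exists_isCStarSeminorm_eq_matNorm`). The gauge
-- action exists by maximality of the norm. Two gauge invariant C*-norms agree on O^(0), hence on
-- each O^(k), and dominate homogeneous components by averaging; a spectral radius argument then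
-- shows that they agree everywhere (`IsCStarSeminorm.le_of_graded`).

universe w

noncomputable section

/-! ### Order and approximate units in C*-algebras. -/

section CStarAlgebraLemmas

open CStarAlgebra

variable {A : Type u} [NonUnitalCStarAlgebra A]

lemma norm_sq_le_norm_star_mul_add (x y : A) : ‖x‖ ^ 2 ≤ ‖star x * x + star y * y‖ := by
  let _ := CStarAlgebra.spectralOrder A
  have _ := CStarAlgebra.spectralOrderedRing A
  rw [sq, ← CStarRing.norm_star_mul_self]
  exact norm_le_norm_of_nonneg_of_le (star_mul_self_nonneg x)
    (le_add_of_nonneg_right (star_mul_self_nonneg y))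

/-- In the ideal generated by `j`, there are approximate right units for `j` that act as
contractions. -/
lemma exists_right_approx_unit (j : A) {ε : ℝ} (hε : 0 < ε) :
    ∃ h : A, star (star j * j * h) = star j * j * h ∧ ‖j - j * (star j * j * h)‖ ≤ ε ∧
      ∀ x : A, ‖x - (star j * j * h) * x‖ ≤ ‖x‖ := by
  let _ := CStarAlgebra.spectralOrder A
  have _ := CStarAlgebra.spectralOrderedRing A
  set c := star j * j with hcdef
  have hc : IsSelfAdjoint c := IsSelfAdjoint.star_mul_self j
  have hpos : ∀ t : ℝ, 0 < ε ^ 4 + t ^ 2 := fun t => by positivity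
  have hcont : Continuous (fun t : ℝ => t / (ε ^ 4 + t ^ 2)) :=
    continuous_id.div (by fun_prop) (fun t => (hpos t).ne')
  -- Here 0 ≤ g ≤ 1, and g(c) = c h with h in the algebra, so g(c) lies in the ideal generated by j.
  -- The constant ε⁴ makes |t| (1 − g(t)) at most ε², and (1 − g(c)) c (1 − g(c)) is the square of
  -- the error to be estimated.
  let g : ℝ → ℝ := fun t => t * (t / (ε ^ 4 + t ^ 2))
  have hgc : Continuous g := continuous_id.mul hcont
  have hg0 : g 0 = 0 := by simp [g]
  have hg : c * cfcₙ (fun t : ℝ => t / (ε ^ 4 + t ^ 2)) c = cfcₙ g c := by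
    have h1 := cfcₙ_mul (fun t : ℝ => t) (fun t : ℝ => t / (ε ^ 4 + t ^ 2)) c
      continuous_id.continuousOn rfl hcont.continuousOn (by simp)
    rw [cfcₙ_id' ℝ c hc] at h1
    exact h1.symm
  have hsa : IsSelfAdjoint (cfcₙ g c) := cfcₙ_predicate g c
  refine ⟨cfcₙ (fun t : ℝ => t / (ε ^ 4 + t ^ 2)) c, ?_, ?_, fun x => ?_⟩
  · rw [hg]; exact hsa
  · rw [hg]
    refine abs_le_of_sq_le_sq' ?_ hε.le |>.2
    rw [sq, ← CStarRing.norm_star_mul_self]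
    have e0 : star (j - j * cfcₙ g c) * (j - j * cfcₙ g c)
        = c - c * cfcₙ g c - cfcₙ g c * c + cfcₙ g c * c * cfcₙ g c := by
      rw [star_sub, star_mul, hsa.star_eq, hcdef]
      noncomm_ring
    have e1 : cfcₙ g c * c = cfcₙ (fun t => g t * t) c := by
      rw [cfcₙ_mul g (fun t : ℝ => t) c hgc.continuousOn hg0 continuous_id.continuousOn rfl,
        cfcₙ_id' ℝ c hc]
    have e2 : c * cfcₙ g c = cfcₙ (fun t => t * g t) c := by
      rw [cfcₙ_mul (fun t : ℝ => t) g c continuous_id.continuousOn rfl hgc.continuousOn hg0,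
        cfcₙ_id' ℝ c hc]
    have e3 : cfcₙ g c * c * cfcₙ g c = cfcₙ (fun t => g t * t * g t) c := by
      rw [e1, ← cfcₙ_mul (fun t => g t * t) g c (by fun_prop) (by simp) hgc.continuousOn hg0]
    rw [e0, e3, e1, e2]
    nth_rewrite 1 [← cfcₙ_id' ℝ c hc]
    rw [← cfcₙ_sub (fun t : ℝ => t) (fun t => t * g t) c continuous_id.continuousOn rfl
        (by fun_prop) (by simp),
      ← cfcₙ_sub (fun t : ℝ => t - t * g t) (fun t => g t * t) c (by fun_prop) (by simp)
        (by fun_prop) (by simp),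
      ← cfcₙ_add (fun t : ℝ => t - t * g t - g t * t) (fun t => g t * t * g t) c (by fun_prop)
        (by simp) (by fun_prop) (by simp)]
    refine norm_cfcₙ_le (fun t _ => ?_)
    have h1 : t - t * g t - g t * t + g t * t * g t = t * (ε ^ 4 / (ε ^ 4 + t ^ 2)) ^ 2 := by
      have := (hpos t).ne'
      simp only [g]
      field_simp
      ring
    rw [h1, norm_mul, norm_pow, Real.norm_eq_abs, Real.norm_eq_abs,
      abs_of_pos (div_pos (by positivity) (hpos t))]
    have h2 : ε ^ 4 / (ε ^ 4 + t ^ 2) ≤ 1 := by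
      rw [div_le_one (hpos t)]; nlinarith [sq_nonneg t]
    have h3 : 0 < ε ^ 4 / (ε ^ 4 + t ^ 2) := div_pos (by positivity) (hpos t)
    have h4 : |t| * (ε ^ 4 / (ε ^ 4 + t ^ 2)) ≤ ε ^ 2 := by
      rw [← mul_div_assoc, div_le_iff₀ (hpos t), ← sq_abs t]
      have hη : 0 < ε ^ 2 := by positivity
      have : ε ^ 4 = (ε ^ 2) ^ 2 := by ring
      rw [this]
      generalize ε ^ 2 = η at hη ⊢
      nlinarith [sq_nonneg (η - |t|), abs_nonneg t,
        mul_nonneg hη.le (sq_nonneg (η - |t|)), mul_nonneg hη.le (mul_nonneg hη.le (abs_nonneg t))]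
    calc |t| * (ε ^ 4 / (ε ^ 4 + t ^ 2)) ^ 2
        = (|t| * (ε ^ 4 / (ε ^ 4 + t ^ 2))) * (ε ^ 4 / (ε ^ 4 + t ^ 2)) := by ring
      _ ≤ ε ^ 2 * 1 := by gcongr
      _ = ε ^ 2 := mul_one _
  · rw [hg]
    have hgn : ∀ t, 0 ≤ g t := fun t => by
      have := hpos t
      simp only [g]
      rw [← mul_div_assoc]
      exact div_nonneg (mul_self_nonneg t) this.le
    refine norm_sub_mul_self_le_of_inr x le_rfl (cfcₙ_nonneg fun t _ => hgn t)
      (norm_cfcₙ_le fun t _ => ?_) (norm_nonneg x) ?_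
    · rw [Real.norm_eq_abs, abs_of_nonneg (hgn t)]
      simp only [g]
      rw [← mul_div_assoc, div_le_one (hpos t)]
      nlinarith [pow_pos hε 4]
    · rw [Unitization.inr_zero, sub_zero, mul_one, CStarRing.norm_star_mul_self,
        Unitization.norm_inr, sq]

end CStarAlgebraLemmas

/-! ### Norms in the quotients of a C*-precategory. -/

namespace CStarPrecategory

variable {Ob : Type v} {T : CStarPrecategory.{u, v} Ob}

lemma norm_mkQ_le {σ ρ : Ob} (S : Submodule ℂ (T.Hom σ ρ)) (x : T.Hom σ ρ) {j : T.Hom σ ρ}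
    (hj : j ∈ S) : ‖S.mkQ x‖ ≤ ‖x + j‖ := by
  have : S.mkQ x = S.mkQ (x + j) := by
    rw [map_add, show S.mkQ j = 0 from (Submodule.Quotient.mk_eq_zero S).2 hj, add_zero]
  rw [this]
  exact Submodule.Quotient.norm_mk_le S _

lemma le_norm_mkQ {σ ρ : Ob} (S : Submodule ℂ (T.Hom σ ρ)) (x : T.Hom σ ρ) {r : ℝ}
    (h : ∀ j ∈ S, r ≤ ‖x + j‖) : r ≤ ‖S.mkQ x‖ := by
  refine le_of_forall_pos_le_add fun ε hε => ?_
  obtain ⟨y, hy, hy'⟩ := Submodule.Quotient.norm_mk_lt (S.mkQ x) hε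
  have h1 : y - x ∈ S := (Submodule.Quotient.eq S).1 hy
  have := h _ h1
  rw [add_sub_cancel] at this
  exact this.trans hy'.le

namespace CStarIdeal

variable (J : T.CStarIdeal)

lemma norm_mkQ_eq_zero {σ ρ : Ob} {x : T.Hom σ ρ} : ‖(J σ ρ).mkQ x‖ = 0 ↔ x ∈ J σ ρ := by
  have := J.isClosed σ ρ
  let _ : NormedAddCommGroup (T.Hom σ ρ ⧸ J σ ρ) := Submodule.Quotient.normedAddCommGroup _
  exact norm_eq_zero.trans (Submodule.Quotient.mk_eq_zero _)

lemma norm_mkQ_adj {σ ρ : Ob} (x : T.Hom σ ρ) :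
    ‖(J ρ σ).mkQ (T.adj x)‖ = ‖(J σ ρ).mkQ x‖ := by
  have key : ∀ {σ ρ : Ob} (x : T.Hom σ ρ), ‖(J ρ σ).mkQ (T.adj x)‖ ≤ ‖(J σ ρ).mkQ x‖ := by
    intro σ ρ x
    refine le_norm_mkQ _ _ fun j hj => ?_
    rw [← T.norm_adj (x + j), T.adj_add]
    exact norm_mkQ_le _ _ (J.adj_mem hj)
  refine le_antisymm (key x) ?_
  have := key (T.adj x)
  rwa [T.adj_adj] at this

lemma norm_mkQ_comp_le {σ ρ τ : Ob} (x : T.Hom σ ρ) (y : T.Hom τ σ) :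
    ‖(J τ ρ).mkQ (T.comp x y)‖ ≤ ‖(J σ ρ).mkQ x‖ * ‖(J τ σ).mkQ y‖ := by
  have key : ∀ j ∈ J σ ρ, ‖(J τ ρ).mkQ (T.comp x y)‖ ≤ ‖x + j‖ * ‖(J τ σ).mkQ y‖ := by
    intro j hj
    have h1 : ∀ k ∈ J τ σ, ‖(J τ ρ).mkQ (T.comp x y)‖ ≤ ‖x + j‖ * ‖y + k‖ := by
      intro k hk
      refine le_trans ?_ (T.norm_comp_le (x + j) (y + k))
      have : T.comp (x + j) (y + k) = T.comp x y + (T.comp x k + T.comp j (y + k)) := by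
        rw [T.add_comp, T.comp_add x, add_assoc]
      rw [this]
      exact norm_mkQ_le _ _ (Submodule.add_mem _ (J.comp_mem_left _ _ hk)
        (J.comp_mem_right _ _ hj))
    rcases (norm_nonneg (x + j)).eq_or_lt with h | h
    · have := h1 0 (Submodule.zero_mem _)
      rwa [← h, zero_mul] at this ⊢
    · rw [← div_le_iff₀' h]
      refine le_norm_mkQ _ _ fun k hk => ?_
      rw [div_le_iff₀' h]
      exact h1 k hk
  rcases (norm_nonneg ((J τ σ).mkQ y)).eq_or_lt with h | h
  · have := key 0 (Submodule.zero_mem _)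
    rwa [← h, mul_zero] at this ⊢
  · rw [← div_le_iff₀ h]
    refine le_norm_mkQ _ _ fun k hk => ?_
    rw [div_le_iff₀ h]
    exact key k hk

/-- An inequality of C*-type passes from a C*-precategory to its quotients. -/
lemma norm_mkQ_sq_le {σ ρ : Ob} (y : T.Hom σ ρ) (v : T.Hom σ σ)
    (h : ∀ e : T.Hom σ σ, ‖y - T.comp y e‖ ^ 2 ≤
      ‖T.comp (T.adj (y - T.comp y e)) (y - T.comp y e) +
        T.comp (T.adj (v - T.comp v e)) (v - T.comp v e)‖) :
    ‖(J σ ρ).mkQ y‖ ^ 2 ≤ ‖(J σ σ).mkQ (T.comp (T.adj y) y + T.comp (T.adj v) v)‖ := by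
  refine le_norm_mkQ _ _ fun j hj => le_of_forall_pos_le_add fun ε hε => ?_
  let _ := T.endAlgebra σ
  obtain ⟨k, hk1, hk2, hk3⟩ := exists_right_approx_unit (A := T.Hom σ σ) j hε
  have he : ∃ e : T.Hom σ σ, e = star j * j * k := ⟨_, rfl⟩
  obtain ⟨e, hedef⟩ := he
  rw [← hedef] at hk1 hk2 hk3
  have hea : T.adj e = e := hk1
  have heJ : e ∈ J σ σ := by
    rw [hedef]
    exact J.comp_mem_right (T.comp (T.adj j) j) k (J.comp_mem_left _ _ hj)
  have contr : ∀ x : T.Hom σ σ, ‖x - T.comp e x‖ ≤ ‖x‖ := hk3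
  have contr' : ∀ x : T.Hom σ σ, ‖x - T.comp x e‖ ≤ ‖x‖ := fun x => by
    have := contr (T.adj x)
    rw [T.norm_adj, ← T.norm_adj, T.adj_sub, T.adj_comp, T.adj_adj, hea] at this
    exact this
  have approx : ‖j - T.comp j e‖ ≤ ε := hk2
  have h1 : ‖(J σ ρ).mkQ y‖ ≤ ‖y - T.comp y e‖ := by
    rw [sub_eq_add_neg]
    exact norm_mkQ_le _ _ (Submodule.neg_mem _ (J.comp_mem_left _ _ heJ))
  -- Compression by 1 − e on both sides does not increase the norm of w + j and makes j of norm at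
  -- most ε. The difference of the two compressions is that of w, to which the hypothesis `h`
  -- applies.
  set w := T.comp (T.adj y) y + T.comp (T.adj v) v with hw
  have h2 : T.comp (T.adj (y - T.comp y e)) (y - T.comp y e) +
        T.comp (T.adj (v - T.comp v e)) (v - T.comp v e)
      = ((w + j) - T.comp e (w + j)) - T.comp ((w + j) - T.comp e (w + j)) e
        - ((j - T.comp j e) - T.comp e (j - T.comp j e)) := by
    rw [hw]
    simp only [T.adj_sub, T.adj_comp, hea, T.sub_comp, T.comp_sub, T.comp_assoc, T.add_comp,
      T.comp_add]
    abel
  calc ‖(J σ ρ).mkQ y‖ ^ 2 ≤ ‖y - T.comp y e‖ ^ 2 := by gcongr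
    _ ≤ _ := h e
    _ ≤ ‖((w + j) - T.comp e (w + j)) - T.comp ((w + j) - T.comp e (w + j)) e‖
        + ‖(j - T.comp j e) - T.comp e (j - T.comp j e)‖ := by rw [h2]; exact norm_sub_le _ _
    _ ≤ ‖w + j‖ + ε := add_le_add ((contr' _).trans (contr _)) ((contr _).trans approx)

/-- The C*-identity in the quotients of a C*-precategory. -/
lemma norm_mkQ_adj_comp_self {σ ρ : Ob} (y : T.Hom σ ρ) :
    ‖(J σ σ).mkQ (T.comp (T.adj y) y)‖ = ‖(J σ ρ).mkQ y‖ ^ 2 := by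
  refine le_antisymm ?_ ?_
  · refine (J.norm_mkQ_comp_le _ _).trans_eq ?_
    rw [norm_mkQ_adj, sq]
  · have := J.norm_mkQ_sq_le y 0 fun e => by
      rw [T.zero_comp, sub_zero, T.comp_zero, add_zero, T.norm_adj_comp_self]
    rwa [T.comp_zero, add_zero] at this

end CStarIdeal

/-- Replacing y*y by b*b with b an endomorphism puts both summands in one C*-algebra, where the
order gives the estimate. Unlike positivity itself, this inequality visibly survives quotients and
maxima of norms; it is the form in which positivity reaches K_J. -/
lemma IsPositive.norm_sq_le (hT : T.IsPositive) {σ ρ : Ob} (y : T.Hom σ ρ) (v : T.Hom σ σ) :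
    ‖y‖ ^ 2 ≤ ‖T.comp (T.adj y) y + T.comp (T.adj v) v‖ := by
  obtain ⟨b, hb⟩ := hT σ ρ y
  rw [← T.norm_adj_comp_self, hb, T.norm_adj_comp_self]
  let _ := T.endAlgebra σ
  exact norm_sq_le_norm_star_mul_add (A := T.Hom σ σ) b v

lemma IsPositive.norm_mkQ_sq_le (hT : T.IsPositive) (J : T.CStarIdeal) {σ ρ : Ob}
    (y : T.Hom σ ρ) (v : T.Hom σ σ) :
    ‖(J σ ρ).mkQ y‖ ^ 2 ≤ ‖(J σ σ).mkQ (T.comp (T.adj y) y + T.comp (T.adj v) v)‖ :=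
  J.norm_mkQ_sq_le y v fun _ => hT.norm_sq_le _ _

end CStarPrecategory

/-! ### Contractivity of the right tensoring, and finite sums of arrows. -/

namespace RightTensorCStarPrecategory

variable {T : RightTensorCStarPrecategory.{u}}

/-- On endomorphisms ⊗1 is a `*`-homomorphism of C*-algebras, hence contractive; the C*-identity
carries this over to all arrows. -/
lemma norm_tensor_le {m n : ℕ} (a : T.Hom m n) : ‖T.tensor a‖ ≤ ‖a‖ := by
  refine abs_le_of_sq_le_sq' ?_ (norm_nonneg _) |>.2
  rw [← T.norm_adj_comp_self, ← T.norm_adj_comp_self, ← T.tensor_adj, ← T.tensor_comp]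
  let _ := T.endAlgebra m
  let _ := T.endAlgebra (m + 1)
  let φ : T.Hom m m →⋆ₙₐ[ℂ] T.Hom (m + 1) (m + 1) :=
    { T.tensor with
      map_zero' := map_zero T.tensor
      map_mul' := T.tensor_comp
      map_star' := T.tensor_adj }
  exact NonUnitalStarAlgHom.norm_apply_le φ _

end RightTensorCStarPrecategory

namespace CStarPrecategory

variable {Ob : Type v} (T : CStarPrecategory.{u, v} Ob)

lemma sum_comp {ι : Type*} (s : Finset ι) {σ ρ τ : Ob} (f : ι → T.Hom σ ρ) (b : T.Hom τ σ) :
    T.comp (∑ i ∈ s, f i) b = ∑ i ∈ s, T.comp (f i) b :=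
  map_sum (AddMonoidHom.mk' (fun a => T.comp a b) fun a a' => T.add_comp a a' b) f s

lemma comp_sum {ι : Type*} (s : Finset ι) {σ ρ τ : Ob} (a : T.Hom σ ρ) (f : ι → T.Hom τ σ) :
    T.comp a (∑ i ∈ s, f i) = ∑ i ∈ s, T.comp a (f i) :=
  map_sum (AddMonoidHom.mk' (fun b => T.comp a b) fun b b' => T.comp_add a b b') f s

lemma adj_sum {ι : Type*} (s : Finset ι) {σ ρ : Ob} (f : ι → T.Hom σ ρ) :
    T.adj (∑ i ∈ s, f i) = ∑ i ∈ s, T.adj (f i) :=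
  map_sum (AddMonoidHom.mk' (fun a => T.adj a) fun a b => T.adj_add a b) f s

end CStarPrecategory

namespace RightTensorCStarPrecategory

open CStarPrecategory

variable {T : RightTensorCStarPrecategory.{u}}

namespace Mat

/-! #### The shift and its powers -/

@[simp] lemma shift_succ_succ (a : T.Mat) (n m : ℕ) : shift a (n + 1) (m + 1) = T.tensor (a n m) :=
  rfl

@[simp] lemma shift_zero_left (a : T.Mat) (m : ℕ) : shift a 0 m = 0 := rfl

@[simp] lemma shift_zero_right (a : T.Mat) (n : ℕ) : shift a n 0 = 0 := by cases n <;> rfl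

lemma shift_add (a b : T.Mat) : shift (a + b) = shift a + shift b := by
  funext n m
  rcases n with _ | n <;> rcases m with _ | m <;> simp

lemma shift_smul (c : ℂ) (a : T.Mat) : shift (c • a) = c • shift a := by
  funext n m
  rcases n with _ | n <;> rcases m with _ | m <;> simp

lemma shift_conj (a : T.Mat) : shift (conj a) = conj (shift a) := by
  funext n m
  rcases n with _ | n <;> rcases m with _ | m <;> simp [conj, T.adj_zero, T.tensor_adj]

/-- The cut-off of the sum follows the row index and Λ raises the row by one, so the truncated sums
match exactly. The resulting equation x = a + Λ(x) for x = `shiftSum 0 a` is the only fact about the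
sum used in the algebraic arguments. -/
lemma shiftSum_one (a : T.Mat) : shiftSum 1 a = shift (shiftSum 0 a) := by
  have key : ∀ n m, shiftSum 1 a n m
      = ∑ k ∈ Finset.range n, shift (shift^[k] a) n m := by
    intro n m
    rw [shiftSum, ← Finset.Ico_add_one_right_eq_Icc, Finset.sum_Ico_eq_sum_range]
    refine Finset.sum_congr rfl fun k _ => ?_
    rw [add_comm 1 k, Function.iterate_succ_apply']
  funext n m
  rw [key]
  rcases n with _ | n
  · simp
  rcases m with _ | m
  · simp
  simp only [shift_succ_succ, shiftSum, map_sum]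
  rw [← Finset.Ico_add_one_right_eq_Icc, ← Finset.range_eq_Ico]

lemma shiftSum_zero (a : T.Mat) : shiftSum 0 a = a + shift (shiftSum 0 a) := by
  rw [← shiftSum_one]
  funext n m
  have h : Finset.Icc 0 n = insert 0 (Finset.Icc 1 n) := by
    ext; simp only [Finset.mem_Icc, Finset.mem_insert]; omega
  change ∑ k ∈ Finset.Icc 0 n, _ = a n m + ∑ k ∈ Finset.Icc 1 n, _
  rw [h, Finset.sum_insert (by simp)]
  rfl

lemma shiftSum_zero_succ_succ (a : T.Mat) (n m : ℕ) :
    shiftSum 0 a (n + 1) (m + 1) = a (n + 1) (m + 1) + T.tensor (shiftSum 0 a n m) := by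
  conv_lhs => rw [shiftSum_zero]
  rfl

lemma shiftSum_zero_row (a : T.Mat) (m : ℕ) : shiftSum 0 a 0 m = a 0 m := by
  rw [shiftSum_zero]
  simp

lemma shiftSum_zero_col (a : T.Mat) (n : ℕ) : shiftSum 0 a n 0 = a n 0 := by
  rw [shiftSum_zero]
  simp

/-- `∑_{k ≥ 0} Λ^k(a)` is the only solution of `x = a + Λ(x)`. -/
lemma eq_shiftSum {a x : T.Mat} (h : x = a + shift x) : x = shiftSum 0 a := by
  funext n
  -- Row n + 1 of Λ(x) depends only on row n of x, so the equation determines x row by row.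
  induction n with
  | zero => funext m; rw [h, shiftSum_zero]; simp
  | succ n ih =>
    funext m
    rcases m with _ | m
    · rw [h, shiftSum_zero]; simp
    · rw [h, shiftSum_zero_succ_succ]
      simp [ih]

lemma shiftSum_add (a b : T.Mat) : shiftSum 0 (a + b) = shiftSum 0 a + shiftSum 0 b := by
  refine (eq_shiftSum ?_).symm
  conv_lhs => rw [shiftSum_zero a, shiftSum_zero b]
  rw [shift_add]
  abel

lemma shiftSum_smul (c : ℂ) (a : T.Mat) : shiftSum 0 (c • a) = c • shiftSum 0 a := by
  refine (eq_shiftSum ?_).symm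
  conv_lhs => rw [shiftSum_zero a]
  rw [shift_smul, smul_add]

lemma conj_add (a b : T.Mat) : conj (a + b) = conj a + conj b := by
  funext n m
  exact T.adj_add _ _

lemma shiftSum_conj (a : T.Mat) : shiftSum 0 (conj a) = conj (shiftSum 0 a) := by
  refine (eq_shiftSum ?_).symm
  conv_lhs => rw [shiftSum_zero a]
  rw [shift_conj, conj_add]

lemma shiftSum_injective : Function.Injective (shiftSum (T := T) 0) := by
  intro a b h
  have h1 := shiftSum_zero a
  have h2 := shiftSum_zero b
  rw [← h] at h2
  exact add_right_cancel (h1.symm.trans h2)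

/-! #### Matrix products -/

/-- All rows of the matrix are finite. -/
def RowFinite (a : T.Mat) : Prop := ∀ n, ∃ R, ∀ i, R ≤ i → a n i = 0

/-- All columns of the matrix are finite. -/
def ColFinite (a : T.Mat) : Prop := ∀ m, ∃ R, ∀ i, R ≤ i → a i m = 0

lemma RowFinite.shift {a : T.Mat} (ha : RowFinite a) : RowFinite (shift a) := by
  intro n
  rcases n with _ | n
  · exact ⟨0, fun i _ => rfl⟩
  · obtain ⟨R, hR⟩ := ha n
    refine ⟨R + 1, fun i hi => ?_⟩
    obtain ⟨i, rfl⟩ : ∃ j, i = j + 1 := ⟨i - 1, by omega⟩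
    rw [shift_succ_succ, hR i (by omega), map_zero]

lemma matMul_apply {a b : T.Mat} {n m R : ℕ} (h : ∀ i, R ≤ i → a n i = 0 ∨ b i m = 0) :
    matMul a b n m = ∑ i ∈ Finset.range R, T.comp (a n i) (b i m) := by
  refine finsum_eq_sum_of_support_subset _ fun i hi => ?_
  by_contra hne
  simp only [Finset.coe_range, Set.mem_Iio, not_lt] at hne
  rcases h i hne with h | h
  · exact hi (by simp [h, T.zero_comp])
  · exact hi (by simp [h, T.comp_zero])

lemma matMul_eq_comp {a b : T.Mat} {n m : ℕ} (j : ℕ) (h : ∀ i, i ≠ j → a n i = 0 ∨ b i m = 0) :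
    matMul a b n m = T.comp (a n j) (b j m) := by
  refine finsum_eq_single _ j fun i hi => ?_
  rcases h i hi with h | h
  · rw [h, T.zero_comp]
  · rw [h, T.comp_zero]

lemma matMul_eq_zero {a b : T.Mat} {n m : ℕ} (h : ∀ i, a n i = 0 ∨ b i m = 0) :
    matMul a b n m = 0 := by
  refine finsum_eq_zero_of_forall_eq_zero fun i => ?_
  rcases h i with h | h
  · rw [h, T.zero_comp]
  · rw [h, T.comp_zero]

/-- Row-finiteness of the left factor and column-finiteness of the right one reduce both sides to
the same finite double sum; the middle factor is arbitrary. -/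
lemma matMul_assoc {a b c : T.Mat} (ha : RowFinite a) (hc : ColFinite c) :
    matMul (matMul a b) c = matMul a (matMul b c) := by
  funext n m
  obtain ⟨R, hR⟩ := ha n
  obtain ⟨R', hR'⟩ := hc m
  rw [matMul_apply (R := R') fun i hi => Or.inr (hR' i hi),
    matMul_apply (R := R) fun i hi => Or.inl (hR i hi)]
  have h1 : ∀ j, matMul a b n j = ∑ i ∈ Finset.range R, T.comp (a n i) (b i j) :=
    fun j => matMul_apply fun i hi => Or.inl (hR i hi)
  have h2 : ∀ i, matMul b c i m = ∑ j ∈ Finset.range R', T.comp (b i j) (c j m) :=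
    fun i => matMul_apply fun j hj => Or.inr (hR' j hj)
  simp only [h1, h2, sum_comp, comp_sum, T.comp_assoc]
  exact Finset.sum_comm

lemma matMul_add {a : T.Mat} (ha : RowFinite a) (b c : T.Mat) :
    matMul a (b + c) = matMul a b + matMul a c := by
  funext n m
  obtain ⟨R, hR⟩ := ha n
  have h : ∀ b, matMul a b n m = ∑ i ∈ Finset.range R, T.comp (a n i) (b i m) :=
    fun b => matMul_apply fun i hi => Or.inl (hR i hi)
  change _ = matMul a b n m + matMul a c n m
  rw [h, h, h, ← Finset.sum_add_distrib]
  exact Finset.sum_congr rfl fun i _ => T.comp_add _ _ _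

lemma add_matMul {a b : T.Mat} (ha : RowFinite a) (hb : RowFinite b) (c : T.Mat) :
    matMul (a + b) c = matMul a c + matMul b c := by
  funext n m
  obtain ⟨R, hR⟩ := ha n
  obtain ⟨R', hR'⟩ := hb n
  have h1 : matMul a c n m = ∑ i ∈ Finset.range (max R R'), T.comp (a n i) (c i m) :=
    matMul_apply fun i hi => Or.inl (hR i (le_of_max_le_left hi))
  have h2 : matMul b c n m = ∑ i ∈ Finset.range (max R R'), T.comp (b n i) (c i m) :=
    matMul_apply fun i hi => Or.inl (hR' i (le_of_max_le_right hi))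
  have h3 : matMul (a + b) c n m = ∑ i ∈ Finset.range (max R R'), T.comp ((a + b) n i) (c i m) :=
    matMul_apply fun i hi => Or.inl <| by
      change a n i + b n i = 0
      rw [hR i (le_of_max_le_left hi), hR' i (le_of_max_le_right hi), add_zero]
  change _ = matMul a c n m + matMul b c n m
  rw [h1, h2, h3, ← Finset.sum_add_distrib]
  exact Finset.sum_congr rfl fun i _ => T.add_comp _ _ _

lemma smul_matMul {a : T.Mat} (ha : RowFinite a) (c : ℂ) (b : T.Mat) :
    matMul (c • a) b = c • matMul a b := by
  funext n m
  obtain ⟨R, hR⟩ := ha n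
  change _ = c • matMul a b n m
  rw [matMul_apply (a := a) (R := R) fun i hi => Or.inl (hR i hi),
    matMul_apply (R := R) fun i hi => Or.inl (by change c • a n i = 0; rw [hR i hi, smul_zero]),
    Finset.smul_sum]
  exact Finset.sum_congr rfl fun i _ => T.smul_comp _ _ _

lemma matMul_smul {a : T.Mat} (ha : RowFinite a) (c : ℂ) (b : T.Mat) :
    matMul a (c • b) = c • matMul a b := by
  funext n m
  obtain ⟨R, hR⟩ := ha n
  change _ = c • matMul a b n m
  rw [matMul_apply (R := R) fun i hi => Or.inl (hR i hi),
    matMul_apply (R := R) fun i hi => Or.inl (hR i hi), Finset.smul_sum]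
  exact Finset.sum_congr rfl fun i _ => T.comp_smul _ _ _

lemma conj_matMul {a : T.Mat} (ha : RowFinite a) (b : T.Mat) :
    conj (matMul a b) = matMul (conj b) (conj a) := by
  funext n m
  obtain ⟨R, hR⟩ := ha m
  have h1 : matMul (conj b) (conj a) n m
      = ∑ i ∈ Finset.range R, T.comp (conj b n i) (conj a i m) :=
    matMul_apply fun i hi => Or.inr (by change T.adj (a m i) = 0; rw [hR i hi, T.adj_zero])
  rw [h1]
  change T.adj (matMul a b m n) = _
  rw [matMul_apply (R := R) fun i hi => Or.inl (hR i hi), adj_sum]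
  exact Finset.sum_congr rfl fun i _ => T.adj_comp _ _

lemma shift_matMul {a : T.Mat} (ha : RowFinite a) (b : T.Mat) :
    shift (matMul a b) = matMul (shift a) (shift b) := by
  funext n m
  rcases n with _ | n
  · exact (matMul_eq_zero fun i => Or.inl rfl).symm
  rcases m with _ | m
  · exact (matMul_eq_zero fun i => Or.inr (by simp)).symm
  obtain ⟨R, hR⟩ := ha n
  obtain h : matMul (shift a) (shift b) (n + 1) (m + 1)
      = ∑ i ∈ Finset.range (R + 1), T.comp (shift a (n + 1) i) (shift b i (m + 1)) :=
    matMul_apply fun i hi => Or.inl <| by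
      obtain ⟨i, rfl⟩ : ∃ j, i = j + 1 := ⟨i - 1, by omega⟩
      rw [shift_succ_succ, hR i (by omega), map_zero]
  rw [h, Finset.sum_range_succ', shift_succ_succ,
    matMul_apply (R := R) fun i hi => Or.inl (hR i hi), map_sum]
  simp [T.tensor_comp, T.zero_comp]

variable {K : T.CStarIdeal}

lemma rowFinite_of_mem {a : T.Mat} (ha : a ∈ matrixSpace K) : RowFinite a := by
  obtain ⟨N, hN⟩ := exists_bound ha
  exact fun n => ⟨N, fun i hi => hN n i (Or.inr hi)⟩

lemma rowFinite_shiftSum {a : T.Mat} (ha : a ∈ matrixSpace K) : RowFinite (shiftSum 0 a) := by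
  obtain ⟨N, hN⟩ := exists_bound ha
  refine fun n => ⟨N + n, fun i hi => Finset.sum_eq_zero fun k hk => ?_⟩
  rw [Finset.mem_Icc] at hk
  exact iterate_shift_eq_zero_of_le a N hN k n i (by omega)

lemma colFinite_shiftSum {a : T.Mat} (ha : a ∈ matrixSpace K) : ColFinite (shiftSum 0 a) := by
  obtain ⟨N, hN⟩ := exists_bound ha
  refine fun m => ⟨N + m, fun i hi => Finset.sum_eq_zero fun k hk => ?_⟩
  by_cases hk : m < k
  · exact iterate_shift_eq_zero a k i m (Or.inr hk)
  · exact iterate_shift_eq_zero_of_le a N hN k i m (by omega)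

/-- The map `a ↦ ∑_{k ≥ 0} Λ^k(a)` transforms the product `⋆` into the matrix product. -/
lemma shiftSum_starMul {a b : T.Mat} (ha : a ∈ matrixSpace K) (hb : b ∈ matrixSpace K) :
    shiftSum 0 (starMul a b) = matMul (shiftSum 0 a) (shiftSum 0 b) := by
  have hA := rowFinite_shiftSum ha
  have hB := rowFinite_shiftSum hb
  -- Write A, B for the two sums, so A = a + Λ(A) and B = b + Λ(B). Then AB = aB + Λ(A)b + Λ(A)Λ(B)
  -- = a ⋆ b + Λ(AB), which is the equation characterising the sum for a ⋆ b.
  refine (eq_shiftSum ?_).symm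
  rw [starMul, shiftSum_one, shift_matMul hA]
  conv_lhs => rw [shiftSum_zero a]
  rw [add_matMul (rowFinite_of_mem ha) hA.shift]
  conv_lhs => rw [shiftSum_zero b, matMul_add hA.shift]
  rw [← shiftSum_zero b, add_assoc]

/-! #### Matrices with one entry -/

lemma single_apply_same (n m : ℕ) (a : T.Hom m n) :
    (Pi.single n (Pi.single m a) : T.Mat) n m = a := by simp

lemma single_apply_of_ne {n m : ℕ} (a : T.Hom m n) {s t : ℕ} (h : s ≠ n ∨ t ≠ m) :
    (Pi.single n (Pi.single m a) : T.Mat) s t = 0 := by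
  rcases eq_or_ne s n with rfl | hs
  · simp [h.resolve_left (not_not.2 rfl)]
  · simp [hs]

lemma shiftSum_single_eq_zero {n m : ℕ} (a : T.Hom m n) :
    ∀ {s t : ℕ}, (∀ j, s = n + j → t ≠ m + j) →
      shiftSum 0 (Pi.single n (Pi.single m a) : T.Mat) s t = 0
  | 0, t, h => by
    rw [shiftSum_zero_row]
    refine single_apply_of_ne a ?_
    have := h 0
    omega
  | s + 1, 0, h => by
    rw [shiftSum_zero_col]
    refine single_apply_of_ne a ?_
    have := h 0
    omega
  | s + 1, t + 1, h => by
    rw [shiftSum_zero_succ_succ, shiftSum_single_eq_zero a (s := s) (t := t), map_zero, add_zero]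
    · refine single_apply_of_ne a ?_
      have := h 0
      omega
    · intro j hs ht
      exact h (j + 1) (by omega) (by omega)

lemma shift_shiftSum_single_eq_zero {n m : ℕ} (a : T.Hom m n) {s t : ℕ}
    (h : ∀ j, s = n + (j + 1) → t ≠ m + (j + 1)) :
    shift (shiftSum 0 (Pi.single n (Pi.single m a) : T.Mat)) s t = 0 := by
  rcases s with _ | s
  · rfl
  rcases t with _ | t
  · rfl
  rw [shift_succ_succ, shiftSum_single_eq_zero a, map_zero]
  intro j hs ht
  exact h j (by omega) (by omega)

lemma shiftSum_single_add {n m : ℕ} (a : T.Hom m n) : ∀ j : ℕ,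
    shiftSum 0 (Pi.single n (Pi.single m a) : T.Mat) (n + j) (m + j) = T.tensorPow j a
  | 0 => by
    rw [shiftSum_zero]
    change (Pi.single n (Pi.single m a) : T.Mat) n m
      + shift (shiftSum 0 (Pi.single n (Pi.single m a) : T.Mat)) n m = a
    rw [single_apply_same, shift_shiftSum_single_eq_zero a (by omega), add_zero]
  | j + 1 => by
    change shiftSum 0 (Pi.single n (Pi.single m a) : T.Mat) (n + j + 1) (m + j + 1)
      = T.tensor (T.tensorPow j a)
    rw [shiftSum_zero_succ_succ, shiftSum_single_add a j, single_apply_of_ne a (by omega),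
      zero_add]

/-- The sums of a one-entry matrix have the entries a ⊗ 1^j down its diagonal and nothing else. So
one term of ⋆ meets the other factor: a · b if k = 0, and Λ^k(a) · b if k > 0. -/
lemma starMul_single {n m k l : ℕ} (a : T.Hom m n) (b : T.Hom l (m + k)) :
    starMul (Pi.single n (Pi.single m a) : T.Mat) (Pi.single (m + k) (Pi.single l b))
      = (Pi.single (n + k) (Pi.single l (T.comp (T.tensorPow k a) b)) : T.Mat) := by
  funext s t
  change matMul _ _ s t + matMul _ _ s t = _
  rw [shiftSum_one,
    matMul_eq_comp m fun i hi => Or.inl (single_apply_of_ne a (Or.inr hi)),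
    matMul_eq_comp (m + k) fun i hi => Or.inr (single_apply_of_ne b (Or.inl hi))]
  rcases k with _ | k
  · rw [shift_shiftSum_single_eq_zero a (by omega), T.zero_comp, add_zero]
    by_cases h : s = n ∧ t = l
    · obtain ⟨rfl, rfl⟩ := h
      rw [single_apply_same]
      exact (congrArg (T.comp a) (shiftSum_single_add b 0)).trans
        (single_apply_same (T := T) s t (T.comp a b)).symm
    · rw [not_and_or] at h
      rw [single_apply_of_ne (n := n + 0) _ (s := s) h]
      rcases h with h | h
      · rw [single_apply_of_ne _ (Or.inl h), T.zero_comp]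
      · have := shiftSum_single_eq_zero b (s := m) (t := t) (by omega)
        rw [this, T.comp_zero]
  · rw [shiftSum_single_eq_zero b (s := m) (t := t) (by omega), T.comp_zero, zero_add]
    by_cases h : s = n + (k + 1) ∧ t = l
    · obtain ⟨rfl, rfl⟩ := h
      rw [single_apply_same, single_apply_same]
      change T.comp (T.tensor (shiftSum 0 _ (n + k) (m + k))) b = _
      rw [shiftSum_single_add]
      rfl
    · rw [not_and_or] at h
      rw [single_apply_of_ne _ (s := s) h]
      rcases h with h | h
      · rw [shift_shiftSum_single_eq_zero a (by omega), T.zero_comp]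
      · rw [single_apply_of_ne _ (Or.inr h), T.comp_zero]

end Mat

/-! ### The `*`-algebra structure of M_T(K). -/

namespace MatrixAlgebra

open Mat

variable {K : T.CStarIdeal}

lemma coe_star (a : MatrixAlgebra K) : ((star a : MatrixAlgebra K) : T.Mat) = conj a := rfl

lemma ext_shiftSum {a b : MatrixAlgebra K} (h : shiftSum 0 (a : T.Mat) = shiftSum 0 (b : T.Mat)) :
    a = b :=
  Subtype.ext (shiftSum_injective h)

lemma shiftSum_mul (a b : MatrixAlgebra K) :
    shiftSum 0 ((a * b : MatrixAlgebra K) : T.Mat)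
      = matMul (shiftSum 0 (a : T.Mat)) (shiftSum 0 (b : T.Mat)) :=
  shiftSum_starMul a.2 b.2

lemma shiftSum_coe_add (a b : MatrixAlgebra K) :
    shiftSum 0 ((a + b : MatrixAlgebra K) : T.Mat)
      = shiftSum 0 (a : T.Mat) + shiftSum 0 (b : T.Mat) :=
  shiftSum_add _ _

lemma shiftSum_coe_smul (c : ℂ) (a : MatrixAlgebra K) :
    shiftSum 0 ((c • a : MatrixAlgebra K) : T.Mat) = c • shiftSum 0 (a : T.Mat) :=
  shiftSum_smul _ _

lemma shiftSum_star (a : MatrixAlgebra K) :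
    shiftSum 0 ((star a : MatrixAlgebra K) : T.Mat) = conj (shiftSum 0 (a : T.Mat)) :=
  shiftSum_conj _

/-- Each law is checked after applying the injective map `shiftSum 0`, where it is a law of matrix
multiplication. -/
instance : NonUnitalSemiring (MatrixAlgebra K) :=
  { (inferInstance : AddCommGroup (MatrixAlgebra K)),
    (inferInstance : Mul (MatrixAlgebra K)) with
    left_distrib := fun a b c => ext_shiftSum <| by
      rw [shiftSum_coe_add, shiftSum_mul, shiftSum_mul, shiftSum_mul, shiftSum_coe_add,
        matMul_add (rowFinite_shiftSum a.2)]
    right_distrib := fun a b c => ext_shiftSum <| by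
      rw [shiftSum_coe_add, shiftSum_mul, shiftSum_mul, shiftSum_mul, shiftSum_coe_add,
        add_matMul (rowFinite_shiftSum a.2) (rowFinite_shiftSum b.2)]
    zero_mul := fun a => ext_shiftSum <| by
      rw [shiftSum_mul]
      have h : shiftSum 0 ((0 : MatrixAlgebra K) : T.Mat) = 0 := by
        simpa using shiftSum_coe_smul 0 (0 : MatrixAlgebra K)
      rw [h]
      funext n m
      exact matMul_eq_zero fun i => Or.inl rfl
    mul_zero := fun a => ext_shiftSum <| by
      rw [shiftSum_mul]
      have h : shiftSum 0 ((0 : MatrixAlgebra K) : T.Mat) = 0 := by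
        simpa using shiftSum_coe_smul 0 (0 : MatrixAlgebra K)
      rw [h]
      funext n m
      exact matMul_eq_zero fun i => Or.inr rfl
    mul_assoc := fun a b c => ext_shiftSum <| by
      rw [shiftSum_mul, shiftSum_mul, shiftSum_mul, shiftSum_mul,
        matMul_assoc (rowFinite_shiftSum a.2) (colFinite_shiftSum c.2)] }

instance : NonUnitalRing (MatrixAlgebra K) :=
  { (inferInstance : AddCommGroup (MatrixAlgebra K)),
    (inferInstance : NonUnitalSemiring (MatrixAlgebra K)) with }

instance : StarRing (MatrixAlgebra K) where
  star_involutive a := Subtype.ext <| by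
    funext n m
    exact T.adj_adj _
  star_add a b := Subtype.ext <| by
    funext n m
    exact T.adj_add _ _
  star_mul a b := ext_shiftSum <| by
    rw [shiftSum_star, shiftSum_mul, shiftSum_mul, shiftSum_star, shiftSum_star,
      conj_matMul (rowFinite_shiftSum a.2)]

instance : IsScalarTower ℂ (MatrixAlgebra K) (MatrixAlgebra K) where
  smul_assoc c a b := ext_shiftSum <| by
    rw [smul_eq_mul, smul_eq_mul, shiftSum_mul, shiftSum_coe_smul, shiftSum_coe_smul,
      smul_matMul (rowFinite_shiftSum a.2), shiftSum_mul]

instance : SMulCommClass ℂ (MatrixAlgebra K) (MatrixAlgebra K) where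
  smul_comm c a b := ext_shiftSum <| by
    rw [smul_eq_mul, smul_eq_mul, shiftSum_mul, shiftSum_coe_smul, shiftSum_coe_smul,
      matMul_smul (rowFinite_shiftSum a.2), shiftSum_mul]

instance : StarModule ℂ (MatrixAlgebra K) where
  star_smul c a := Subtype.ext <| by
    funext n m
    exact T.adj_smul _ _

end MatrixAlgebra

theorem isStarAlgebraWithRep (K : T.CStarIdeal) : IsStarAlgebraWithRep K where
  add_mul := add_mul
  mul_add := mul_add
  smul_mul := smul_mul_assoc
  mul_smul := mul_smul_comm
  mul_assoc := mul_assoc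
  star_star := star_star
  star_add := star_add
  star_smul := star_smul
  star_mul := star_mul
  emb_adj n m a := Subtype.ext <| by
    funext s t
    change (Pi.single m (Pi.single n (T.adj a)) : T.Mat) s t
      = T.adj ((Pi.single n (Pi.single m (a : T.Hom m n)) : T.Mat) t s)
    by_cases h : s = m ∧ t = n
    · obtain ⟨rfl, rfl⟩ := h
      rw [Mat.single_apply_same, Mat.single_apply_same]
    · rw [not_and_or] at h
      rw [Mat.single_apply_of_ne _ h, Mat.single_apply_of_ne _ h.symm, T.adj_zero]
  emb_tensor n m k l a b := Subtype.ext (Mat.starMul_single (a : T.Hom m n) (b : T.Hom l (m + k)))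

end RightTensorCStarPrecategory

namespace RightTensorCStarPrecategory

open CStarPrecategory Mat

variable {T : RightTensorCStarPrecategory.{u}}

/-! ### The seminorms on the matrices -/

section HomNorm

variable (J : T.CStarIdeal)

/-- The positions `(s, t)` below `(n, m)` on its diagonal. -/
def homIndex (m n : ℕ) : Finset (ℕ × ℕ) :=
  (Finset.range n ×ˢ Finset.range m).filter fun p => p.2 + n = p.1 + m

lemma mem_homIndex {m n : ℕ} {p : ℕ × ℕ} :
    p ∈ homIndex m n ↔ p.1 < n ∧ p.2 < m ∧ p.2 + n = p.1 + m := by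
  simp [homIndex, and_assoc]

/-- Replaces the maximum by entrywise conditions, the form in which all estimates of the seminorms
are carried out. -/
lemma homNorm_le_iff {m n : ℕ} {a : T.Mat} {C : ℝ} (hC : 0 ≤ C) :
    homNorm J m n a ≤ C ↔
      (∀ s t, s < n → t < m → t + n = s + m → ‖(J t s).mkQ (shiftSum 0 a s t)‖ ≤ C) ∧
        ‖shiftSum 0 a n m‖ ≤ C := by
  have h1 : homNorm J m n a = max ((((homIndex m n).sup
      fun p => ‖(J p.2 p.1).mkQ (shiftSum 0 a p.1 p.2)‖₊ : NNReal) : ℝ)) ‖shiftSum 0 a n m‖ := rfl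
  rw [h1, max_le_iff]
  refine and_congr_left fun _ => ?_
  lift C to NNReal using hC
  rw [NNReal.coe_le_coe, Finset.sup_le_iff]
  constructor
  · intro h s t hs ht hst
    exact h (s, t) (mem_homIndex.2 ⟨hs, ht, hst⟩)
  · rintro h ⟨s, t⟩ hp
    obtain ⟨hs, ht, hst⟩ := mem_homIndex.1 hp
    exact h s t hs ht hst

lemma norm_shiftSum_le_homNorm (m n : ℕ) (a : T.Mat) :
    ‖shiftSum 0 a n m‖ ≤ homNorm J m n a :=
  le_max_right _ _

lemma homNorm_nonneg (m n : ℕ) (a : T.Mat) : 0 ≤ homNorm J m n a :=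
  (norm_nonneg _).trans (norm_shiftSum_le_homNorm J m n a)

lemma norm_mkQ_shiftSum_le_homNorm {m n s t : ℕ} (a : T.Mat) (hs : s < n) (ht : t < m)
    (hst : t + n = s + m) : ‖(J t s).mkQ (shiftSum 0 a s t)‖ ≤ homNorm J m n a :=
  ((homNorm_le_iff J (homNorm_nonneg J m n a)).1 le_rfl).1 s t hs ht hst

lemma homNorm_add_le (m n : ℕ) (a b : T.Mat) :
    homNorm J m n (a + b) ≤ homNorm J m n a + homNorm J m n b := by
  rw [homNorm_le_iff J (add_nonneg (homNorm_nonneg J m n a) (homNorm_nonneg J m n b)),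
    shiftSum_add]
  refine ⟨fun s t hs ht hst => ?_, ?_⟩
  · change ‖(J t s).mkQ (shiftSum 0 a s t + shiftSum 0 b s t)‖ ≤ _
    rw [map_add]
    exact (norm_add_le _ _).trans (add_le_add (norm_mkQ_shiftSum_le_homNorm J a hs ht hst)
      (norm_mkQ_shiftSum_le_homNorm J b hs ht hst))
  · exact (norm_add_le _ _).trans (add_le_add (norm_shiftSum_le_homNorm J m n a)
      (norm_shiftSum_le_homNorm J m n b))

lemma homNorm_smul_le (m n : ℕ) (c : ℂ) (a : T.Mat) :
    homNorm J m n (c • a) ≤ ‖c‖ * homNorm J m n a := by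
  rw [homNorm_le_iff J (mul_nonneg (norm_nonneg c) (homNorm_nonneg J m n a)), shiftSum_smul]
  refine ⟨fun s t hs ht hst => ?_, ?_⟩
  · change ‖(J t s).mkQ (c • shiftSum 0 a s t)‖ ≤ _
    rw [map_smul, norm_smul]
    exact mul_le_mul_of_nonneg_left (norm_mkQ_shiftSum_le_homNorm J a hs ht hst) (norm_nonneg c)
  · change ‖c • shiftSum 0 a n m‖ ≤ _
    rw [norm_smul]
    exact mul_le_mul_of_nonneg_left (norm_shiftSum_le_homNorm J m n a) (norm_nonneg c)

/-- The seminorm `‖·‖_{m,n}^J` on the space of all matrices. -/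
def homSeminorm (m n : ℕ) : Seminorm ℂ T.Mat :=
  Seminorm.ofSMulLE (homNorm J m n)
    (le_antisymm (by simpa using homNorm_smul_le J m n 0 0) (homNorm_nonneg J m n 0))
    (homNorm_add_le J m n) (homNorm_smul_le J m n)

lemma homNorm_conj (m n : ℕ) (a : T.Mat) : homNorm J n m (conj a) = homNorm J m n a := by
  have key : ∀ (m n : ℕ) (a : T.Mat), homNorm J n m (conj a) ≤ homNorm J m n a := by
    intro m n a
    rw [homNorm_le_iff J (homNorm_nonneg J m n a), shiftSum_conj]
    refine ⟨fun s t hs ht hst => ?_, ?_⟩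
    · change ‖(J t s).mkQ (T.adj (shiftSum 0 a t s))‖ ≤ _
      rw [J.norm_mkQ_adj]
      exact norm_mkQ_shiftSum_le_homNorm J a ht hs hst.symm
    · change ‖T.adj (shiftSum 0 a n m)‖ ≤ _
      rw [T.norm_adj]
      exact norm_shiftSum_le_homNorm J m n a
  refine le_antisymm (key m n a) ?_
  have h : conj (conj a) = a := by
    funext s t
    exact T.adj_adj _
  simpa only [h] using key n m (conj a)

end HomNorm

/-! ### The homogeneous matrices -/

section Homogeneous

variable {K : T.CStarIdeal}

lemma shiftSum_eq_zero_of_mem {m n : ℕ} {a : MatrixAlgebra K} (ha : a ∈ homogeneous K m n) :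
    ∀ {s t : ℕ}, t + n ≠ s + m → shiftSum 0 (a : T.Mat) s t = 0
  | 0, t, h => by
    rw [shiftSum_zero_row]
    by_contra hne
    exact h (ha _ _ hne).1
  | s + 1, 0, h => by
    rw [shiftSum_zero_col]
    by_contra hne
    exact h (ha _ _ hne).1
  | s + 1, t + 1, h => by
    rw [shiftSum_zero_succ_succ, shiftSum_eq_zero_of_mem ha (s := s) (t := t) (by omega), map_zero,
      add_zero]
    by_contra hne
    exact h (ha _ _ hne).1

lemma shiftSum_succ_succ_of_mem {m n : ℕ} {a : MatrixAlgebra K} (ha : a ∈ homogeneous K m n)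
    {s : ℕ} (t : ℕ) (hs : n ≤ s) :
    shiftSum 0 (a : T.Mat) (s + 1) (t + 1) = T.tensor (shiftSum 0 (a : T.Mat) s t) := by
  rw [shiftSum_zero_succ_succ, add_eq_right]
  by_contra hne
  have := (ha _ _ hne).2
  omega

/-- Since a = x − Λ(x) for the sum x, an entry of a below row n vanishes exactly when the
corresponding entry of x is the preceding one tensored with 1. This converse to the two previous
lemmas allows homogeneity of products to be tested on the sums. -/
lemma mem_homogeneous_of_shiftSum {m n : ℕ} {a : MatrixAlgebra K}
    (h1 : ∀ s t, t + n ≠ s + m → shiftSum 0 (a : T.Mat) s t = 0)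
    (h2 : ∀ s t, n ≤ s → t + n = s + m →
      shiftSum 0 (a : T.Mat) (s + 1) (t + 1) = T.tensor (shiftSum 0 (a : T.Mat) s t)) :
    a ∈ homogeneous K m n := by
  intro i j hne
  have hij : j + n = i + m := by
    by_contra h
    refine hne ?_
    rcases i with _ | i
    · rw [← shiftSum_zero_row (a : T.Mat)]; exact h1 _ _ h
    rcases j with _ | j
    · rw [← shiftSum_zero_col (a : T.Mat)]; exact h1 _ _ h
    have := shiftSum_zero_succ_succ (a : T.Mat) i j
    rw [h1 _ _ h, h1 i j (by omega), map_zero, add_zero] at this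
    exact this.symm
  refine ⟨hij, ?_⟩
  by_contra hi
  obtain ⟨i, rfl⟩ : ∃ k, i = k + 1 := ⟨i - 1, by omega⟩
  obtain ⟨j, rfl⟩ : ∃ k, j = k + 1 := ⟨j - 1, by omega⟩
  have := shiftSum_zero_succ_succ (a : T.Mat) i j
  rw [h2 i j (by omega) (by omega), right_eq_add] at this
  exact hne this

/-- Row s of the sum of a has at most one non-zero entry, in the column u = s + (m − n), so the
matrix product is a single composition. -/
lemma shiftSum_mul_apply {m n : ℕ} {a : MatrixAlgebra K} (ha : a ∈ homogeneous K m n)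
    (b : MatrixAlgebra K) {s u : ℕ} (t : ℕ) (hu : u + n = s + m) :
    shiftSum 0 ((a * b : MatrixAlgebra K) : T.Mat) s t
      = T.comp (shiftSum 0 (a : T.Mat) s u) (shiftSum 0 (b : T.Mat) u t) := by
  rw [MatrixAlgebra.shiftSum_mul]
  exact matMul_eq_comp u fun i hi => Or.inl (shiftSum_eq_zero_of_mem ha (by omega))

lemma shiftSum_mul_apply_of_lt {m n : ℕ} {a : MatrixAlgebra K} (ha : a ∈ homogeneous K m n)
    (b : MatrixAlgebra K) {s : ℕ} (t : ℕ) (hs : s + m < n) :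
    shiftSum 0 ((a * b : MatrixAlgebra K) : T.Mat) s t = 0 := by
  rw [MatrixAlgebra.shiftSum_mul]
  exact matMul_eq_zero fun i => Or.inl (shiftSum_eq_zero_of_mem ha (by omega))

lemma mul_mem_homogeneous {l m n : ℕ} {a b : MatrixAlgebra K} (ha : a ∈ homogeneous K m n)
    (hb : b ∈ homogeneous K l m) : a * b ∈ homogeneous K l n := by
  refine mem_homogeneous_of_shiftSum (fun s t hst => ?_) fun s t hs hst => ?_
  · by_cases h : s + m < n
    · exact shiftSum_mul_apply_of_lt ha b t h
    · obtain ⟨u, hu⟩ : ∃ u, u + n = s + m := ⟨s + m - n, by omega⟩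
      rw [shiftSum_mul_apply ha b t hu, shiftSum_eq_zero_of_mem hb (s := u) (by omega),
        T.comp_zero]
  · obtain ⟨u, hu⟩ : ∃ u, u + n = s + m := ⟨s + m - n, by omega⟩
    rw [shiftSum_mul_apply ha b t hu,
      shiftSum_mul_apply ha b (u := u + 1) (t + 1) (by omega),
      shiftSum_succ_succ_of_mem ha u hs, shiftSum_succ_succ_of_mem hb t (by omega), T.tensor_comp]

lemma star_mem_homogeneous {m n : ℕ} {a : MatrixAlgebra K} (ha : a ∈ homogeneous K m n) :
    star a ∈ homogeneous K n m := by
  intro i j hne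
  have : (a : T.Mat) j i ≠ 0 := fun h => hne <| by
    change T.adj ((a : T.Mat) j i) = 0
    rw [h, T.adj_zero]
  have := ha j i this
  omega

lemma homogeneous_le_succ (K : T.CStarIdeal) (m n : ℕ) :
    homogeneous K m n ≤ homogeneous K (m + 1) (n + 1) := by
  intro a ha i j hne
  have := ha i j hne
  omega

lemma homogeneous_le_add (K : T.CStarIdeal) (m n r : ℕ) :
    homogeneous K m n ≤ homogeneous K (m + r) (n + r) := by
  induction r with
  | zero => exact le_rfl
  | succ r ih => exact ih.trans (homogeneous_le_succ K _ _)

lemma matrixEmb_mem_homogeneous (n m : ℕ) (a : K m n) : matrixEmb K n m a ∈ homogeneous K m n := by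
  intro i j hne
  by_contra h
  refine hne (single_apply_of_ne (a : T.Hom m n) ?_)
  omega

lemma shiftSum_matrixEmb (n m : ℕ) (a : K m n) :
    shiftSum 0 (matrixEmb K n m a : T.Mat) n m = a :=
  shiftSum_single_add (a : T.Hom m n) 0

lemma shiftSum_matrixEmb_of_lt (n m : ℕ) (a : K m n) {s : ℕ} (t : ℕ) (hs : s < n) :
    shiftSum 0 (matrixEmb K n m a : T.Mat) s t = 0 :=
  shiftSum_single_eq_zero (a : T.Hom m n) (by omega)

variable (J : T.CStarIdeal)

lemma homNorm_mul_le (l : ℕ) {m n : ℕ} {a : MatrixAlgebra K} (ha : a ∈ homogeneous K m n)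
    (b : MatrixAlgebra K) :
    homNorm J l n ((a * b : MatrixAlgebra K) : T.Mat)
      ≤ homNorm J m n (a : T.Mat) * homNorm J l m (b : T.Mat) := by
  have h0 := mul_nonneg (homNorm_nonneg J m n (a : T.Mat)) (homNorm_nonneg J l m (b : T.Mat))
  rw [homNorm_le_iff J h0]
  refine ⟨fun s t hs ht hst => ?_, ?_⟩
  · by_cases h : s + m < n
    · rw [shiftSum_mul_apply_of_lt ha b t h, map_zero, norm_zero]
      exact h0
    · obtain ⟨u, hu⟩ : ∃ u, u + n = s + m := ⟨s + m - n, by omega⟩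
      rw [shiftSum_mul_apply ha b t hu]
      exact (J.norm_mkQ_comp_le _ _).trans (mul_le_mul
        (norm_mkQ_shiftSum_le_homNorm J _ hs (by omega) hu)
        (norm_mkQ_shiftSum_le_homNorm J _ (by omega) ht (by omega)) (norm_nonneg _)
        (homNorm_nonneg J _ _ _))
  · rw [shiftSum_mul_apply ha b (u := m) l (by omega)]
    exact (T.norm_comp_le _ _).trans (mul_le_mul (norm_shiftSum_le_homNorm J _ _ _)
      (norm_shiftSum_le_homNorm J _ _ _) (norm_nonneg _) (homNorm_nonneg J _ _ _))

lemma shiftSum_star_mul_self {m n : ℕ} {a : MatrixAlgebra K} (ha : a ∈ homogeneous K m n) {s t : ℕ}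
    (hst : t + n = s + m) :
    shiftSum 0 ((star a * a : MatrixAlgebra K) : T.Mat) t t
      = T.comp (T.adj (shiftSum 0 (a : T.Mat) s t)) (shiftSum 0 (a : T.Mat) s t) := by
  rw [shiftSum_mul_apply (star_mem_homogeneous ha) a (u := s) t (by omega),
    MatrixAlgebra.shiftSum_star]
  rfl

/-- The diagonal entries of the sum of a* ⋆ a contain x*x for each entry x of the sum of a that
enters the seminorm, so the C*-identities of T and T/J give the lower bound. The upper bound is
submultiplicativity. -/
lemma homNorm_star_mul_self {m n : ℕ} {a : MatrixAlgebra K} (ha : a ∈ homogeneous K m n) :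
    homNorm J m m ((star a * a : MatrixAlgebra K) : T.Mat) = homNorm J m n (a : T.Mat) ^ 2 := by
  have hp := homNorm_nonneg J m m ((star a * a : MatrixAlgebra K) : T.Mat)
  refine le_antisymm ?_ ?_
  · refine (homNorm_mul_le J m (star_mem_homogeneous ha) a).trans_eq ?_
    rw [MatrixAlgebra.coe_star, homNorm_conj, sq]
  · refine (Real.le_sqrt (homNorm_nonneg J _ _ _) hp).1 ?_
    rw [homNorm_le_iff J (Real.sqrt_nonneg _)]
    refine ⟨fun s t hs ht hst => ?_, ?_⟩
    · refine Real.le_sqrt_of_sq_le ?_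
      rw [← J.norm_mkQ_adj_comp_self, ← shiftSum_star_mul_self ha hst]
      exact norm_mkQ_shiftSum_le_homNorm J _ ht ht rfl
    · refine Real.le_sqrt_of_sq_le ?_
      rw [← T.norm_adj_comp_self, ← shiftSum_star_mul_self ha (by omega)]
      exact norm_shiftSum_le_homNorm J _ _ _

/-- The inequality carrying positivity is applied to each entry, in T for the last one and in T/J
for the others. -/
lemma homNorm_sq_le_of_isPositive (hT : T.IsPositive) {m n : ℕ} {a b : MatrixAlgebra K}
    (ha : a ∈ homogeneous K m n) (hb : b ∈ homogeneous K m m) :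
    homNorm J m n (a : T.Mat) ^ 2
      ≤ homNorm J m m ((star a * a + star b * b : MatrixAlgebra K) : T.Mat) := by
  have hp := homNorm_nonneg J m m ((star a * a + star b * b : MatrixAlgebra K) : T.Mat)
  have key : ∀ {s t : ℕ}, t + n = s + m →
      shiftSum 0 ((star a * a + star b * b : MatrixAlgebra K) : T.Mat) t t
        = T.comp (T.adj (shiftSum 0 (a : T.Mat) s t)) (shiftSum 0 (a : T.Mat) s t)
          + T.comp (T.adj (shiftSum 0 (b : T.Mat) t t)) (shiftSum 0 (b : T.Mat) t t) := by
    intro s t hst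
    rw [MatrixAlgebra.shiftSum_coe_add, ← shiftSum_star_mul_self ha hst,
      ← shiftSum_star_mul_self hb rfl]
    rfl
  refine (Real.le_sqrt (homNorm_nonneg J _ _ _) hp).1 ?_
  rw [homNorm_le_iff J (Real.sqrt_nonneg _)]
  refine ⟨fun s t hs ht hst => Real.le_sqrt_of_sq_le ?_, Real.le_sqrt_of_sq_le ?_⟩
  · refine (hT.norm_mkQ_sq_le J _ (shiftSum 0 (b : T.Mat) t t)).trans ?_
    rw [← key hst]
    exact norm_mkQ_shiftSum_le_homNorm J _ ht ht rfl
  · refine (hT.norm_sq_le _ (shiftSum 0 (b : T.Mat) m m)).trans ?_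
    rw [← key (by omega)]
    exact norm_shiftSum_le_homNorm J _ _ _

/-- Passing to M(m+1, n+1) replaces the norm of the last entry x by the quotient norm of x and the
norm of x ⊗ 1, neither of which is larger. -/
lemma homNorm_succ_le {m n : ℕ} {a : MatrixAlgebra K} (ha : a ∈ homogeneous K m n) :
    homNorm J (m + 1) (n + 1) (a : T.Mat) ≤ homNorm J m n (a : T.Mat) := by
  rw [homNorm_le_iff J (homNorm_nonneg J _ _ _)]
  refine ⟨fun s t hs ht hst => ?_, ?_⟩
  · rcases (Nat.lt_succ_iff.1 hs).eq_or_lt with rfl | hs'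
    · obtain rfl : t = m := by omega
      exact (Submodule.Quotient.norm_mk_le _ _).trans (norm_shiftSum_le_homNorm J _ _ _)
    · exact norm_mkQ_shiftSum_le_homNorm J _ hs' (by omega) (by omega)
  · rw [shiftSum_succ_succ_of_mem ha m le_rfl]
    exact (norm_tensor_le _).trans (norm_shiftSum_le_homNorm J _ _ _)

end Homogeneous

/-! ### Completeness of the homogeneous quotients -/

section Completeness

variable {K : T.CStarIdeal}

/-- If the entries of `B` on and above the position `(n, m)` of a diagonal are limits modulo `J` of
sums `∑_{k ≥ 0} Λ^k(a)` with `a` homogeneous, then they form such a sum. -/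
lemma exists_homogeneous_of_approx {J : T.CStarIdeal} (hJ : ∀ m n : ℕ, J m n ≤ tensorIdeal K m n)
    {m n : ℕ} (B : T.Mat)
    (hB : ∀ s t, t + n ≠ s + m → B s t = 0)
    (h : ∀ ε > 0, ∃ a ∈ homogeneous K m n, ∀ s t, s ≤ n → t + n = s + m →
      ∃ c ∈ J t s, ‖B s t - (shiftSum 0 (a : T.Mat) s t + c)‖ < ε) :
    ∃ a ∈ homogeneous K m n, ∀ s t, s ≤ n → shiftSum 0 (a : T.Mat) s t = B s t := by
  -- The matrix sought must be B − Λ(B) on rows up to n. Its entries are limits of a_{s+1,t+1} + c −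
  -- d ⊗ 1 with c, d in J, and both c and d ⊗ 1 lie in K precisely because J ⊆ J(K).
  have mem : ∀ s t, s ≤ n → t + n = s + m → B s t - shift B s t ∈ K t s := by
    have closed : ∀ {s t : ℕ} (x : T.Hom t s), (∀ ε > 0, ∃ k ∈ K t s, ‖x - k‖ < ε) →
        x ∈ K t s := by
      intro s t x hx
      rw [← SetLike.mem_coe, ← (K.isClosed t s).closure_eq, Metric.mem_closure_iff]
      intro ε hε
      obtain ⟨k, hk, hk'⟩ := hx ε hε
      exact ⟨k, hk, by rwa [dist_eq_norm]⟩
    -- Case of the first row or column, where Λ(B) vanishes and no term d ⊗ 1 occurs.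
    have edge : ∀ s t, s ≤ n → t + n = s + m →
        (∀ a : MatrixAlgebra K, shiftSum 0 (a : T.Mat) s t = (a : T.Mat) s t) → B s t ∈ K t s := by
      intro s t hs hst hsum
      refine closed _ fun ε hε => ?_
      obtain ⟨a, -, ha'⟩ := h ε hε
      obtain ⟨c, hc, hc'⟩ := ha' s t hs hst
      refine ⟨_, Submodule.add_mem _ ?_ (hJ _ _ hc).2, hc'⟩
      rw [hsum]
      exact a.2.1 s t
    intro s t hs hst
    rcases s with _ | s
    · rw [shift_zero_left, sub_zero]
      exact edge 0 t hs hst fun a => shiftSum_zero_row _ _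
    rcases t with _ | t
    · rw [shift_zero_right, sub_zero]
      exact edge (s + 1) 0 hs hst fun a => shiftSum_zero_col _ _
    refine closed _ fun ε hε => ?_
    obtain ⟨a, ha, ha'⟩ := h (ε / 2) (half_pos hε)
    obtain ⟨c, hc, hc'⟩ := ha' (s + 1) (t + 1) hs hst
    obtain ⟨d, hd, hd'⟩ := ha' s t (by omega) (by omega)
    refine ⟨(a : T.Mat) (s + 1) (t + 1) + c - T.tensor d, Submodule.sub_mem _
      (Submodule.add_mem _ (a.2.1 _ _) (hJ _ _ hc).2) (hJ _ _ hd).1, ?_⟩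
    have e : B (s + 1) (t + 1) - shift B (s + 1) (t + 1)
        - ((a : T.Mat) (s + 1) (t + 1) + c - T.tensor d)
        = (B (s + 1) (t + 1) - (shiftSum 0 (a : T.Mat) (s + 1) (t + 1) + c))
          - T.tensor (B s t - (shiftSum 0 (a : T.Mat) s t + d)) := by
      rw [shiftSum_zero_succ_succ, shift_succ_succ, map_sub, map_add]
      abel
    rw [e]
    calc _ ≤ _ := norm_sub_le _ _
      _ < ε / 2 + ε / 2 := add_lt_add_of_lt_of_le hc' ((norm_tensor_le _).trans hd'.le)
      _ = ε := add_halves ε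
  let A : T.Mat := fun s t => if s ≤ n ∧ t + n = s + m then B s t - shift B s t else 0
  have hA : A ∈ matrixSpace K := by
    refine mem_of_bound (fun s t => ?_) (n + m + 1) fun s t hst => if_neg (by omega)
    by_cases hc : s ≤ n ∧ t + n = s + m
    · simp only [A, if_pos hc]
      exact mem s t hc.1 hc.2
    · simp only [A, if_neg hc]
      exact Submodule.zero_mem _
  refine ⟨⟨A, hA⟩, fun i j hne => ?_, ?_⟩
  · by_contra hc
    exact hne (if_neg fun h => hc ⟨h.2, h.1⟩)
  · intro s
    induction s with
    | zero =>
      intro t hs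
      rw [shiftSum_zero_row]
      by_cases hst : t + n = 0 + m
      · exact (if_pos ⟨hs, hst⟩).trans (by rw [shift_zero_left, sub_zero])
      · exact (if_neg fun h => hst h.2).trans (hB 0 t hst).symm
    | succ s ih =>
      intro t hs
      rcases t with _ | t
      · rw [shiftSum_zero_col]
        by_cases hst : 0 + n = s + 1 + m
        · exact (if_pos ⟨hs, hst⟩).trans (by rw [shift_zero_right, sub_zero])
        · exact (if_neg fun h => hst h.2).trans (hB _ _ hst).symm
      · rw [shiftSum_zero_succ_succ]
        have ih' := ih t (by omega)
        by_cases hst : t + 1 + n = s + 1 + m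
        · have hAv : A (s + 1) (t + 1) = B (s + 1) (t + 1) - shift B (s + 1) (t + 1) :=
            if_pos ⟨hs, hst⟩
          change A (s + 1) (t + 1) + T.tensor (shiftSum 0 A s t) = _
          rw [hAv, ih', shift_succ_succ, sub_add_cancel]
        · have hAv : A (s + 1) (t + 1) = 0 := if_neg fun h => hst h.2
          change A (s + 1) (t + 1) + T.tensor (shiftSum 0 A s t) = _
          rw [hAv, ih', hB s t (by omega), hB _ _ hst, map_zero, add_zero]

/-- As an instance, this gives the quotients by J a norm rather than a seminorm. -/
instance (J : T.CStarIdeal) (σ ρ : ℕ) : IsClosed (J.carrier σ ρ : Set (T.Hom σ ρ)) :=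
  J.isClosed σ ρ

/-- The Banach space in which the quotient of `M(m, n)` by `‖·‖_{m,n}^J` embeds. -/
abbrev HomSpace (J : T.CStarIdeal) (m n : ℕ) : Type u :=
  T.Hom m n × (∀ p : homIndex m n, T.Hom p.1.2 p.1.1 ⧸ J p.1.2 p.1.1)

/-- The map of `M(m, n)` into a Banach space that induces the seminorm `‖·‖_{m,n}^J`. -/
def homMap (K J : T.CStarIdeal) (m n : ℕ) : homogeneous K m n →ₗ[ℂ] HomSpace J m n where
  toFun a := (shiftSum 0 ((a : MatrixAlgebra K) : T.Mat) n m,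
    fun p => (J p.1.2 p.1.1).mkQ (shiftSum 0 ((a : MatrixAlgebra K) : T.Mat) p.1.1 p.1.2))
  map_add' a b := by
    have h := MatrixAlgebra.shiftSum_coe_add (a : MatrixAlgebra K) (b : MatrixAlgebra K)
    refine Prod.ext ?_ (funext fun p => ?_)
    · exact congrFun (congrFun h n) m
    · exact (congrArg (J p.1.2 p.1.1).mkQ (congrFun (congrFun h _) _)).trans (map_add _ _ _)
  map_smul' c a := by
    have h := MatrixAlgebra.shiftSum_coe_smul c (a : MatrixAlgebra K)
    refine Prod.ext ?_ (funext fun p => ?_)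
    · exact congrFun (congrFun h n) m
    · exact (congrArg (J p.1.2 p.1.1).mkQ (congrFun (congrFun h _) _)).trans (map_smul _ _ _)

lemma norm_homMap (J : T.CStarIdeal) {m n : ℕ} (a : homogeneous K m n) :
    ‖homMap K J m n a‖ = homNorm J m n ((a : MatrixAlgebra K) : T.Mat) := by
  refine eq_of_forall_ge_iff fun C => ?_
  by_cases hC : 0 ≤ C
  · rw [homNorm_le_iff J hC, Prod.norm_def, max_le_iff, pi_norm_le_iff_of_nonneg hC, and_comm]
    refine and_congr_left fun _ => ⟨fun h s t hs ht hst => ?_, fun h p => ?_⟩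
    · exact h ⟨(s, t), mem_homIndex.2 ⟨hs, ht, hst⟩⟩
    · obtain ⟨⟨s, t⟩, hp⟩ := p
      obtain ⟨hs, ht, hst⟩ := mem_homIndex.1 hp
      exact h s t hs ht hst
  · exact ⟨fun h => absurd ((norm_nonneg _).trans h) hC,
      fun h => absurd ((homNorm_nonneg J _ _ _).trans h) hC⟩

/-- Classes modulo J are lifted to a matrix B. Approximation in the product norm is approximation of
B modulo J at each position, which is the hypothesis of `exists_homogeneous_of_approx`. -/
lemma isClosed_range_homMap {J : T.CStarIdeal} (hJ : ∀ m n : ℕ, J m n ≤ tensorIdeal K m n)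
    (m n : ℕ) : IsClosed (LinearMap.range (homMap K J m n) : Set (HomSpace J m n)) := by
  refine isClosed_of_closure_subset ?_
  rintro ⟨y, x⟩ hyx
  rw [Metric.mem_closure_iff] at hyx
  have hsurj : ∀ p : homIndex m n, ∃ b : T.Hom p.1.2 p.1.1, (J p.1.2 p.1.1).mkQ b = x p :=
    fun p => Submodule.mkQ_surjective _ _
  choose b hb using hsurj
  let B' : T.Mat := fun s t => if h : (s, t) ∈ homIndex m n then b ⟨(s, t), h⟩ else 0
  let B : T.Mat := fun s t => (Pi.single n (Pi.single m y) : T.Mat) s t + B' s t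
  have hBtop : B n m = y := by
    have : B' n m = 0 := dif_neg fun h => absurd (mem_homIndex.1 h).1 (lt_irrefl n)
    simp only [B, this, add_zero]
    exact single_apply_same n m y
  have hBp : ∀ p : homIndex m n, B p.1.1 p.1.2 = b p := by
    intro p
    have h1 : B' p.1.1 p.1.2 = b p := dif_pos p.2
    have h2 := (mem_homIndex.1 p.2).1
    simp only [B, h1]
    rw [single_apply_of_ne y (Or.inl h2.ne), zero_add]
  have hdiag : ∀ s t, t + n ≠ s + m → B s t = 0 := by
    intro s t hst
    have h1 : B' s t = 0 := dif_neg fun h => hst (mem_homIndex.1 h).2.2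
    simp only [B, h1]
    rw [single_apply_of_ne y (by omega), add_zero]
  obtain ⟨a, ha, ha'⟩ := exists_homogeneous_of_approx hJ B hdiag <| by
    intro ε hε
    obtain ⟨_, ⟨a, rfl⟩, ha⟩ := hyx ε hε
    rw [dist_eq_norm, Prod.norm_def, max_lt_iff] at ha
    refine ⟨a, a.2, fun s t hs hst => ?_⟩
    rcases hs.eq_or_lt with rfl | hs'
    · obtain rfl : t = m := by omega
      refine ⟨0, Submodule.zero_mem _, ?_⟩
      rw [add_zero, hBtop]
      exact ha.1
    · have hp : (s, t) ∈ homIndex m n := mem_homIndex.2 ⟨hs', by omega, hst⟩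
      have h1 := (norm_le_pi_norm _ (⟨(s, t), hp⟩ : homIndex m n)).trans_lt ha.2
      have h2 : ‖(J t s).mkQ (B s t - shiftSum 0 ((a : MatrixAlgebra K) : T.Mat) s t)‖ < ε := by
        rw [map_sub, hBp ⟨(s, t), hp⟩, hb ⟨(s, t), hp⟩]
        exact h1
      obtain ⟨z, hz, hz'⟩ := QuotientAddGroup.norm_lt_iff.1 h2
      have hz2 := (Submodule.Quotient.eq (J t s)).1 hz.symm
      refine ⟨_, hz2, ?_⟩
      -- The element of J is the difference between B − Σ Λ^k(a) and a representative z of its class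
      -- of norm below ε, so the remaining error is z.
      have e : ∀ p q r : T.Hom t s, p - (q + (p - q - r)) = r := fun p q r => by abel
      rw [e]
      exact hz'
  refine ⟨⟨a, ha⟩, Prod.ext ?_ (funext fun p => ?_)⟩
  · exact (ha' n m le_rfl).trans hBtop
  · change (J p.1.2 p.1.1).mkQ (shiftSum 0 (a : T.Mat) p.1.1 p.1.2) = x p
    rw [ha' _ _ (mem_homIndex.1 p.2).1.le, hBp, hb]

end Completeness

end RightTensorCStarPrecategory

namespace RightTensorCStarPrecategory

open CStarPrecategory Mat

variable {T : RightTensorCStarPrecategory.{u}}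

/-! ### The right tensor C*-precategory of homogeneous parts -/

section Quotient

variable (K J : T.CStarIdeal)

/-- The arrows of the right tensor C*-precategory `K_J`. -/
def QuotHom (m n : ℕ) : Type u := LinearMap.range (homMap K J m n)

instance (m n : ℕ) : NormedAddCommGroup (QuotHom K J m n) :=
  inferInstanceAs (NormedAddCommGroup (LinearMap.range (homMap K J m n)))

instance (m n : ℕ) : NormedSpace ℂ (QuotHom K J m n) :=
  inferInstanceAs (NormedSpace ℂ (LinearMap.range (homMap K J m n)))

/-- The quotient map `M(m, n) → K_J(m, n)`. -/
def quotMap (m n : ℕ) : homogeneous K m n →ₗ[ℂ] QuotHom K J m n := (homMap K J m n).rangeRestrict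

lemma quotMap_surjective (m n : ℕ) : Function.Surjective (quotMap K J m n) :=
  LinearMap.surjective_rangeRestrict _

variable {K}

lemma norm_quotMap {m n : ℕ} (a : homogeneous K m n) :
    ‖quotMap K J m n a‖ = homNorm J m n ((a : MatrixAlgebra K) : T.Mat) :=
  norm_homMap J a

/-- The product of homogeneous matrices. -/
def homMul {l m n : ℕ} (a : homogeneous K m n) (b : homogeneous K l m) : homogeneous K l n :=
  ⟨(a : MatrixAlgebra K) * b, mul_mem_homogeneous a.2 b.2⟩

/-- The adjoint of a homogeneous matrix. -/
def homStar {m n : ℕ} (a : homogeneous K m n) : homogeneous K n m :=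
  ⟨star (a : MatrixAlgebra K), star_mem_homogeneous a.2⟩

lemma norm_quotMap_homMul_le {l m n : ℕ} (a : homogeneous K m n) (b : homogeneous K l m) :
    ‖quotMap K J l n (homMul a b)‖ ≤ ‖quotMap K J m n a‖ * ‖quotMap K J l m b‖ := by
  simp only [norm_quotMap]
  exact homNorm_mul_le J l a.2 b

lemma norm_quotMap_homStar {m n : ℕ} (a : homogeneous K m n) :
    ‖quotMap K J n m (homStar a)‖ = ‖quotMap K J m n a‖ := by
  simp only [norm_quotMap]
  exact homNorm_conj J m n _

variable {J}

lemma completeSpace_quotHom (hJ : ∀ m n : ℕ, J m n ≤ tensorIdeal K m n) (m n : ℕ) :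
    CompleteSpace (QuotHom K J m n) :=
  (isClosed_range_homMap hJ m n).completeSpace_coe

/-- Submultiplicativity of the seminorms makes products well defined on the quotients; it is what
makes the choice of lifts in `quotComp` immaterial. -/
lemma quotMap_homMul_congr {l m n : ℕ} {a a' : homogeneous K m n} {b b' : homogeneous K l m}
    (ha : quotMap K J m n a = quotMap K J m n a') (hb : quotMap K J l m b = quotMap K J l m b') :
    quotMap K J l n (homMul a b) = quotMap K J l n (homMul a' b') := by
  rw [← sub_eq_zero, ← map_sub] at ha hb ⊢
  have e : homMul a b - homMul a' b' = homMul (a - a') b + homMul a' (b - b') :=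
    Subtype.ext <| by
      change (a : MatrixAlgebra K) * b - a' * b'
        = ((a : MatrixAlgebra K) - a') * b + a' * ((b : MatrixAlgebra K) - b')
      noncomm_ring
  rw [e, map_add]
  have h1 := norm_quotMap_homMul_le J (a - a') b
  have h2 := norm_quotMap_homMul_le J a' (b - b')
  rw [ha, norm_zero, zero_mul, norm_le_zero_iff] at h1
  rw [hb, norm_zero, mul_zero, norm_le_zero_iff] at h2
  rw [h1, h2, add_zero]

lemma quotMap_homStar_congr {m n : ℕ} {a a' : homogeneous K m n}
    (ha : quotMap K J m n a = quotMap K J m n a') :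
    quotMap K J n m (homStar a) = quotMap K J n m (homStar a') := by
  rw [← sub_eq_zero, ← map_sub] at ha ⊢
  have e : homStar a - homStar a' = homStar (a - a') :=
    Subtype.ext (star_sub (a : MatrixAlgebra K) a').symm
  rw [e, ← norm_eq_zero, norm_quotMap_homStar, ha, norm_zero]

lemma quotMap_inclusion_congr {m n : ℕ} {a a' : homogeneous K m n}
    (ha : quotMap K J m n a = quotMap K J m n a') :
    quotMap K J (m + 1) (n + 1) (Submodule.inclusion (homogeneous_le_succ K m n) a)
      = quotMap K J (m + 1) (n + 1) (Submodule.inclusion (homogeneous_le_succ K m n) a') := by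
  rw [← sub_eq_zero, ← map_sub] at ha
  rw [← sub_eq_zero, ← map_sub, ← map_sub, ← norm_le_zero_iff, norm_quotMap]
  rw [← norm_eq_zero, norm_quotMap] at ha
  exact (homNorm_succ_le J (a - a').2).trans_eq ha

/-- The composition in `K_J`. -/
def quotComp {l m n : ℕ} (x : QuotHom K J m n) (y : QuotHom K J l m) : QuotHom K J l n :=
  quotMap K J l n (homMul (Function.surjInv (quotMap_surjective K J m n) x)
    (Function.surjInv (quotMap_surjective K J l m) y))

lemma quotComp_quotMap {l m n : ℕ} (a : homogeneous K m n) (b : homogeneous K l m) :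
    quotComp (quotMap K J m n a) (quotMap K J l m b) = quotMap K J l n (homMul a b) :=
  quotMap_homMul_congr (Function.surjInv_eq _ _) (Function.surjInv_eq _ _)

/-- The involution of `K_J`. -/
def quotAdj {m n : ℕ} (x : QuotHom K J m n) : QuotHom K J n m :=
  quotMap K J n m (homStar (Function.surjInv (quotMap_surjective K J m n) x))

lemma quotAdj_quotMap {m n : ℕ} (a : homogeneous K m n) :
    quotAdj (quotMap K J m n a) = quotMap K J n m (homStar a) :=
  quotMap_homStar_congr (Function.surjInv_eq _ _)

/-- The right tensoring of `K_J`. -/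
def quotTensor (m n : ℕ) : QuotHom K J m n →ₗ[ℂ] QuotHom K J (m + 1) (n + 1) where
  toFun x := quotMap K J (m + 1) (n + 1) (Submodule.inclusion (homogeneous_le_succ K m n)
    (Function.surjInv (quotMap_surjective K J m n) x))
  map_add' x y := by
    rw [← map_add, ← map_add]
    refine quotMap_inclusion_congr ?_
    rw [map_add, Function.surjInv_eq (quotMap_surjective K J m n),
      Function.surjInv_eq (quotMap_surjective K J m n),
      Function.surjInv_eq (quotMap_surjective K J m n)]
  map_smul' c x := by
    rw [RingHom.id_apply, ← map_smul, ← map_smul]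
    refine quotMap_inclusion_congr ?_
    rw [map_smul, Function.surjInv_eq (quotMap_surjective K J m n),
      Function.surjInv_eq (quotMap_surjective K J m n)]

lemma quotTensor_quotMap {m n : ℕ} (a : homogeneous K m n) :
    quotTensor m n (quotMap K J m n a)
      = quotMap K J (m + 1) (n + 1) (Submodule.inclusion (homogeneous_le_succ K m n) a) :=
  quotMap_inclusion_congr (Function.surjInv_eq _ _)

variable (K) in
/-- The right tensor C*-precategory `K_J` of the quotients of the spaces `M(m, n)`. -/
def quotCategory (hJ : ∀ m n : ℕ, J m n ≤ tensorIdeal K m n) : RightTensorCStarPrecategory.{u} where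
  Hom m n := QuotHom K J m n
  completeSpace m n := completeSpace_quotHom hJ m n
  comp := quotComp
  add_comp {m n l} x x' y := by
    obtain ⟨a, rfl⟩ := quotMap_surjective K J _ _ x
    obtain ⟨a', rfl⟩ := quotMap_surjective K J _ _ x'
    obtain ⟨b, rfl⟩ := quotMap_surjective K J _ _ y
    rw [← map_add, quotComp_quotMap, quotComp_quotMap, quotComp_quotMap, ← map_add]
    exact congrArg _ (Subtype.ext (add_mul (a : MatrixAlgebra K) a' b))
  comp_add {m n l} x y y' := by
    obtain ⟨a, rfl⟩ := quotMap_surjective K J _ _ x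
    obtain ⟨b, rfl⟩ := quotMap_surjective K J _ _ y
    obtain ⟨b', rfl⟩ := quotMap_surjective K J _ _ y'
    rw [← map_add, quotComp_quotMap, quotComp_quotMap, quotComp_quotMap, ← map_add]
    exact congrArg _ (Subtype.ext (mul_add (a : MatrixAlgebra K) b b'))
  smul_comp {m n l} c x y := by
    obtain ⟨a, rfl⟩ := quotMap_surjective K J _ _ x
    obtain ⟨b, rfl⟩ := quotMap_surjective K J _ _ y
    rw [← map_smul, quotComp_quotMap, quotComp_quotMap, ← map_smul]
    exact congrArg _ (Subtype.ext (smul_mul_assoc c (a : MatrixAlgebra K) b))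
  comp_smul {m n l} c x y := by
    obtain ⟨a, rfl⟩ := quotMap_surjective K J _ _ x
    obtain ⟨b, rfl⟩ := quotMap_surjective K J _ _ y
    rw [← map_smul, quotComp_quotMap, quotComp_quotMap, ← map_smul]
    exact congrArg _ (Subtype.ext (mul_smul_comm c (a : MatrixAlgebra K) b))
  comp_assoc {m n l k} x y z := by
    obtain ⟨a, rfl⟩ := quotMap_surjective K J _ _ x
    obtain ⟨b, rfl⟩ := quotMap_surjective K J _ _ y
    obtain ⟨c, rfl⟩ := quotMap_surjective K J _ _ z
    rw [quotComp_quotMap, quotComp_quotMap, quotComp_quotMap, quotComp_quotMap]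
    exact congrArg _ (Subtype.ext (mul_assoc (a : MatrixAlgebra K) b c))
  norm_comp_le {m n l} x y := by
    obtain ⟨a, rfl⟩ := quotMap_surjective K J _ _ x
    obtain ⟨b, rfl⟩ := quotMap_surjective K J _ _ y
    rw [quotComp_quotMap]
    exact norm_quotMap_homMul_le J a b
  adj := quotAdj
  adj_add {m n} x y := by
    obtain ⟨a, rfl⟩ := quotMap_surjective K J _ _ x
    obtain ⟨b, rfl⟩ := quotMap_surjective K J _ _ y
    rw [← map_add, quotAdj_quotMap, quotAdj_quotMap, quotAdj_quotMap, ← map_add]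
    exact congrArg _ (Subtype.ext (star_add (a : MatrixAlgebra K) b))
  adj_smul {m n} c x := by
    obtain ⟨a, rfl⟩ := quotMap_surjective K J _ _ x
    rw [← map_smul, quotAdj_quotMap, quotAdj_quotMap, ← map_smul]
    exact congrArg _ (Subtype.ext (star_smul c (a : MatrixAlgebra K)))
  adj_adj {m n} x := by
    obtain ⟨a, rfl⟩ := quotMap_surjective K J _ _ x
    rw [quotAdj_quotMap, quotAdj_quotMap]
    exact congrArg _ (Subtype.ext (star_star (a : MatrixAlgebra K)))
  adj_comp {m n l} x y := by
    obtain ⟨a, rfl⟩ := quotMap_surjective K J _ _ x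
    obtain ⟨b, rfl⟩ := quotMap_surjective K J _ _ y
    rw [quotComp_quotMap, quotAdj_quotMap, quotAdj_quotMap, quotAdj_quotMap, quotComp_quotMap]
    exact congrArg _ (Subtype.ext (star_mul (a : MatrixAlgebra K) b))
  norm_adj_comp_self {m n} x := by
    obtain ⟨a, rfl⟩ := quotMap_surjective K J _ _ x
    rw [quotAdj_quotMap, quotComp_quotMap, norm_quotMap, norm_quotMap]
    exact homNorm_star_mul_self J a.2
  tensor {m n} := quotTensor m n
  tensor_comp {l m n} x y := by
    obtain ⟨a, rfl⟩ := quotMap_surjective K J _ _ x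
    obtain ⟨b, rfl⟩ := quotMap_surjective K J _ _ y
    rw [quotComp_quotMap, quotTensor_quotMap, quotTensor_quotMap, quotTensor_quotMap,
      quotComp_quotMap]
    rfl
  tensor_adj {m n} x := by
    obtain ⟨a, rfl⟩ := quotMap_surjective K J _ _ x
    rw [quotAdj_quotMap, quotTensor_quotMap, quotTensor_quotMap, quotAdj_quotMap]
    rfl

theorem isHomogeneousQuotient (hJ : ∀ m n : ℕ, J m n ≤ tensorIdeal K m n) :
    IsHomogeneousQuotient K J (quotCategory K hJ) (quotMap K J) where
  surjective := quotMap_surjective K J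
  norm_map _ _ a := norm_quotMap J a
  mul_mem _ _ _ a b := mul_mem_homogeneous a.2 b.2
  map_mul l m n a b c hc := by
    obtain rfl : c = homMul a b := Subtype.ext hc
    exact (quotComp_quotMap a b).symm
  star_mem _ _ a := star_mem_homogeneous a.2
  map_star m n a c hc := by
    obtain rfl : c = homStar a := Subtype.ext hc
    exact (quotAdj_quotMap a).symm
  le_succ := homogeneous_le_succ K
  map_tensor m n a c hc := by
    obtain rfl : c = Submodule.inclusion (homogeneous_le_succ K m n) a := Subtype.ext hc
    exact (quotTensor_quotMap a).symm

end Quotient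

/-! ### Injectivity of the right tensoring -/

section Injectivity

variable {K J : T.CStarIdeal} {S : RightTensorCStarPrecategory.{u}}
  {Q : ∀ m n : ℕ, homogeneous K m n →ₗ[ℂ] S.Hom m n}

/-- A matrix in M(m, n) has norm zero in M(m+1, n+1) when its earlier sums lie in J and its last sum
lies in J and is killed by ⊗1. So the kernels of ⊗_J 1 come exactly from J ∩ ker ⊗1. -/
lemma IsHomogeneousQuotient.tensor_injective_iff (hQ : IsHomogeneousQuotient K J S Q)
    (hJ : ∀ m n : ℕ, J m n ≤ tensorIdeal K m n) :
    (∀ m n : ℕ, Function.Injective (S.tensor (m := m) (n := n))) ↔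
      ∀ m n : ℕ, ∀ a ∈ J m n, T.tensor a = 0 → a = 0 := by
  have tensorQ : ∀ (m n : ℕ) (a : homogeneous K m n),
      ‖S.tensor (Q m n a)‖ = homNorm J (m + 1) (n + 1) ((a : MatrixAlgebra K) : T.Mat) :=
    fun m n a => by
      rw [← hQ.map_tensor m n a ⟨a, homogeneous_le_succ K m n a.2⟩ rfl, hQ.norm_map]
  constructor
  · intro h m n a ha ha0
    -- The one-entry matrix of an arrow in J ∩ ker ⊗1 is killed by ⊗_J 1, while its norm in M(m, n)
    -- is at least ‖a‖.
    set e : homogeneous K m n := ⟨matrixEmb K n m ⟨a, (hJ m n ha).2⟩,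
      matrixEmb_mem_homogeneous n m _⟩ with he
    have hval : shiftSum 0 ((e : MatrixAlgebra K) : T.Mat) n m = a := shiftSum_matrixEmb n m _
    have h0 : S.tensor (Q m n e) = 0 := by
      rw [← norm_le_zero_iff, tensorQ, homNorm_le_iff J le_rfl]
      refine ⟨fun s t hs ht hst => ?_, ?_⟩
      · rcases (Nat.lt_succ_iff.1 hs).eq_or_lt with rfl | hs'
        · obtain rfl : t = m := by omega
          rw [hval]
          exact ((J.norm_mkQ_eq_zero).2 ha).le
        · rw [he, shiftSum_matrixEmb_of_lt n m _ t hs', map_zero, norm_zero]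
      · rw [shiftSum_succ_succ_of_mem e.2 m le_rfl, hval, ha0, norm_zero]
    have h1 : Q m n e = 0 := h m n (h0.trans (map_zero _).symm)
    have h2 := hQ.norm_map m n e
    rw [h1, norm_zero] at h2
    have h3 := norm_shiftSum_le_homNorm J m n ((e : MatrixAlgebra K) : T.Mat)
    rwa [← h2, hval, norm_le_zero_iff] at h3
  · intro h m n
    rw [injective_iff_map_eq_zero]
    intro x hx
    obtain ⟨a, rfl⟩ := hQ.surjective m n x
    have h0 := tensorQ m n a
    rw [hx, norm_zero] at h0
    rw [← norm_le_zero_iff, hQ.norm_map, homNorm_le_iff J le_rfl]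
    refine ⟨fun s t hs ht hst => ?_, ?_⟩
    · exact (norm_mkQ_shiftSum_le_homNorm J _ (by omega) (by omega) (by omega)).trans h0.ge
    · rw [norm_le_zero_iff]
      refine h m n _ ?_ ?_
      · rw [← J.norm_mkQ_eq_zero]
        exact le_antisymm ((norm_mkQ_shiftSum_le_homNorm J _ (Nat.lt_succ_self n)
          (Nat.lt_succ_self m) (by omega)).trans h0.ge) (norm_nonneg _)
      · rw [← shiftSum_succ_succ_of_mem a.2 m le_rfl, ← norm_le_zero_iff]
        exact (norm_shiftSum_le_homNorm J _ _ _).trans h0.ge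

/-- If a is in J and a ⊗ 1 = 0, then a*a is in ker ⊗1, so (a*a)² = 0 and a = 0 by the C*-identity.
Conversely a*a b lies in J ∩ ker ⊗1 for b in ker ⊗1. -/
lemma subset_annihilator_iff (J : T.CStarIdeal) :
    (∀ m n : ℕ, (J m n : Set (T.Hom m n)) ⊆ annihilator T.kerTensor m n) ↔
      ∀ m n : ℕ, ∀ a ∈ J m n, T.tensor a = 0 → a = 0 := by
  constructor
  · intro h m n a ha ha0
    have h1 : T.comp (T.adj a) a ∈ T.kerTensor m m := by
      rw [kerTensor, LinearMap.mem_ker, T.tensor_comp, ha0, T.comp_zero]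
    have h2 : T.comp (T.comp (T.adj a) a) (T.comp (T.adj a) a) = 0 := h m n ha _ h1
    have h3 := T.norm_adj_comp_self (T.comp (T.adj a) a)
    rw [T.adj_comp, T.adj_adj, h2, norm_zero, T.norm_adj_comp_self] at h3
    rw [← norm_eq_zero]
    exact pow_eq_zero_iff (two_ne_zero) |>.1 (pow_eq_zero_iff (two_ne_zero) |>.1 h3.symm)
  · intro h m n a ha b hb
    refine h m m _ (J.comp_mem_right _ _ (J.comp_mem_left _ _ ha)) ?_
    have hb0 : T.tensor b = 0 := hb
    rw [T.tensor_comp, hb0, T.comp_zero]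

end Injectivity

end RightTensorCStarPrecategory

namespace RightTensorCStarPrecategory

open CStarPrecategory Mat

variable {T : RightTensorCStarPrecategory.{u}}

/-! ### Diagonals -/

section Diagonals

variable {K : T.CStarIdeal}

lemma Mat.shiftSum_congr_diagonal {a b : T.Mat} {m n : ℕ}
    (h : ∀ i j, j + n = i + m → a i j = b i j) :
    ∀ {s t : ℕ}, t + n = s + m → shiftSum 0 a s t = shiftSum 0 b s t
  | 0, t, hst => by rw [shiftSum_zero_row, shiftSum_zero_row, h 0 t hst]
  | s + 1, 0, hst => by rw [shiftSum_zero_col, shiftSum_zero_col, h (s + 1) 0 hst]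
  | s + 1, t + 1, hst => by
    rw [shiftSum_zero_succ_succ, shiftSum_zero_succ_succ, h _ _ hst,
      Mat.shiftSum_congr_diagonal h (s := s) (t := t) (by omega)]

lemma homNorm_congr (J : T.CStarIdeal) {a b : T.Mat} {m n : ℕ}
    (h : ∀ i j, j + n = i + m → a i j = b i j) : homNorm J m n a = homNorm J m n b := by
  have key : ∀ {a b : T.Mat}, (∀ i j, j + n = i + m → a i j = b i j) →
      homNorm J m n a ≤ homNorm J m n b := by
    intro a b h
    rw [homNorm_le_iff J (homNorm_nonneg J m n b)]
    refine ⟨fun s t hs ht hst => ?_, ?_⟩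
    · rw [shiftSum_congr_diagonal h hst]
      exact norm_mkQ_shiftSum_le_homNorm J b hs ht hst
    · rw [shiftSum_congr_diagonal h (by omega)]
      exact norm_shiftSum_le_homNorm J m n b
  exact le_antisymm (key h) (key fun i j hij => (h i j hij).symm)

variable (K) in
/-- The diagonal `j - i = k` of a matrix. -/
def degPart (k : ℤ) : MatrixAlgebra K →ₗ[ℂ] MatrixAlgebra K where
  toFun a := ⟨fun i j => if (j : ℤ) - i = k then (a : T.Mat) i j else 0, by
    refine ⟨fun i j => ?_, a.2.2.subset fun p hp h => hp ?_⟩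
    · dsimp only
      split_ifs
      · exact a.2.1 i j
      · exact Submodule.zero_mem _
    · simp only [h, ite_self]⟩
  map_add' a b := by
    ext i j
    change (if _ then (a : T.Mat) i j + (b : T.Mat) i j else 0) = 
      (if _ then _ else _) + if _ then _ else _
    split_ifs <;> simp
  map_smul' c a := by
    ext i j
    change (if _ then c • (a : T.Mat) i j else 0) = c • if _ then _ else _
    split_ifs <;> simp

lemma degPart_apply (k : ℤ) (a : MatrixAlgebra K) (i j : ℕ) :
    (degPart K k a : T.Mat) i j = if (j : ℤ) - i = k then (a : T.Mat) i j else 0 := rfl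

lemma degPart_of_mem {m n : ℕ} {a : MatrixAlgebra K} (ha : a ∈ homogeneous K m n) {k : ℤ}
    (hk : (m : ℤ) - n = k) : degPart K k a = a := by
  ext i j
  rw [degPart_apply]
  split_ifs with h
  · rfl
  · by_contra hne
    have := (ha i j (Ne.symm hne)).1
    omega

lemma degPart_of_mem_of_ne {m n : ℕ} {a : MatrixAlgebra K} (ha : a ∈ homogeneous K m n) {k : ℤ}
    (hk : (m : ℤ) - n ≠ k) : degPart K k a = 0 := by
  ext i j
  rw [degPart_apply]
  split_ifs with h
  · by_contra hne
    have := (ha i j hne).1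
    omega
  · rfl

lemma exists_degPart_mem (a : MatrixAlgebra K) :
    ∃ R : ℕ, ∀ m n : ℕ, R ≤ n → degPart K ((m : ℤ) - n) a ∈ homogeneous K m n := by
  obtain ⟨N, hN⟩ := exists_bound a.2
  refine ⟨N, fun m n hn i j hne => ?_⟩
  rw [degPart_apply] at hne
  split_ifs at hne with h
  · have : i < N := by
      by_contra hi
      exact hne (hN i j (Or.inl (by omega)))
    omega
  · exact absurd rfl hne

lemma exists_degPart_eq_zero (a : MatrixAlgebra K) :
    ∃ F : Finset ℤ, ∀ k ∉ F, degPart K k a = 0 := by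
  obtain ⟨N, hN⟩ := exists_bound a.2
  refine ⟨Finset.Icc (-(N : ℤ)) N, fun k hk => ?_⟩
  ext i j
  rw [degPart_apply]
  split_ifs with h
  · refine hN i j ?_
    rw [Finset.mem_Icc] at hk
    omega
  · rfl

lemma sum_degPart {a : MatrixAlgebra K} {F : Finset ℤ} (hF : ∀ k ∉ F, degPart K k a = 0) :
    ∑ k ∈ F, degPart K k a = a := by
  ext i j
  have h1 : ((∑ k ∈ F, degPart K k a : MatrixAlgebra K) : T.Mat) i j
      = ∑ k ∈ F, (degPart K k a : T.Mat) i j := by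
    rw [AddSubmonoidClass.coe_finsetSum, Finset.sum_apply, Finset.sum_apply]
  rw [h1]
  simp only [degPart_apply]
  rw [Finset.sum_ite_eq]
  split_ifs with h
  · rfl
  · have := congrArg (fun b : MatrixAlgebra K => (b : T.Mat) i j) (hF _ h)
    simp only [degPart_apply, if_true] at this
    exact this.symm

lemma exists_mem_degPart (a : MatrixAlgebra K) (k : ℤ) :
    ∃ m n : ℕ, (m : ℤ) - n = k ∧ degPart K k a ∈ homogeneous K m n := by
  obtain ⟨R, hR⟩ := exists_degPart_mem a
  have h : (((R + k.natAbs + k).toNat : ℕ) : ℤ) - ((R + k.natAbs : ℕ) : ℤ) = k := by omega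
  refine ⟨(R + k.natAbs + k).toNat, R + k.natAbs, h, ?_⟩
  have := hR (R + k.natAbs + k).toNat (R + k.natAbs) (by omega)
  rwa [h] at this

end Diagonals

/-! ### The limits of the seminorms -/

section Limits

variable {K : T.CStarIdeal} (J : T.CStarIdeal)

lemma homNorm_degPart {m n : ℕ} {k : ℤ} (hk : (m : ℤ) - n = k) (a : MatrixAlgebra K) :
    homNorm J m n (degPart K k a : T.Mat) = homNorm J m n (a : T.Mat) :=
  homNorm_congr J fun i j hij => by
    rw [degPart_apply, if_pos (by omega)]

theorem tendsto_homNorm_degreeNorm (a : MatrixAlgebra K) (k : ℤ) :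
    Tendsto (fun r : ℕ => homNorm J (r + k).toNat r (a : T.Mat)) atTop
      (𝓝 (degreeNorm J k (a : T.Mat))) := by
  obtain ⟨R, hR⟩ := exists_degPart_mem a
  -- From row R on the k-th diagonal lies in M(r + k, r), where the seminorms decrease. The further
  -- shift by |k| makes r + k non-negative, so that `toNat` does not truncate.
  have anti : Antitone fun r : ℕ =>
      homNorm J (((r + (R + k.natAbs) : ℕ) : ℤ) + k).toNat (r + (R + k.natAbs)) (a : T.Mat) := by
    refine antitone_nat_of_succ_le fun r => ?_
    have e : ((((r + 1) + (R + k.natAbs) : ℕ) : ℤ) + k).toNat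
        = (((r + (R + k.natAbs) : ℕ) : ℤ) + k).toNat + 1 := by omega
    have e' : r + 1 + (R + k.natAbs) = (r + (R + k.natAbs)) + 1 := by omega
    generalize hm : (((r + (R + k.natAbs) : ℕ) : ℤ) + k).toNat = m at e
    have hk : ((m : ℕ) : ℤ) - ((r + (R + k.natAbs) : ℕ) : ℤ) = k := by omega
    rw [e, e', ← homNorm_degPart J (k := k) (by omega) a, ← homNorm_degPart J hk a]
    refine homNorm_succ_le J ?_
    have := hR m (r + (R + k.natAbs)) (by omega)
    rwa [hk] at this
  have h1 := tendsto_atTop_ciInf anti ⟨0, by rintro _ ⟨r, rfl⟩; exact homNorm_nonneg J _ _ _⟩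
  have h2 := (tendsto_add_atTop_iff_nat (f := fun r : ℕ =>
    homNorm J (r + k).toNat r (a : T.Mat)) (R + k.natAbs)).1 h1
  exact tendsto_nhds_limUnder ⟨_, h2⟩

lemma tendsto_homNorm {ι : Type*} {l : Filter ι} (a : MatrixAlgebra K) {k : ℤ} {m n : ι → ℕ}
    (h : ∀ᶠ i in l, (m i : ℤ) - n i = k) (hn : Tendsto n l atTop) :
    Tendsto (fun i => homNorm J (m i) (n i) (a : T.Mat)) l (𝓝 (degreeNorm J k (a : T.Mat))) := by
  refine ((tendsto_homNorm_degreeNorm J a k).comp hn).congr' ?_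
  filter_upwards [h] with i hi
  have : ((n i : ℤ) + k).toNat = m i := by omega
  rw [Function.comp_apply, this]

lemma tendsto_homNorm_add (a : MatrixAlgebra K) {m n : ℕ} {k : ℤ} (hk : (m : ℤ) - n = k) :
    Tendsto (fun r => homNorm J (m + r) (n + r) (a : T.Mat)) atTop
      (𝓝 (degreeNorm J k (a : T.Mat))) :=
  tendsto_homNorm J a (Eventually.of_forall fun r => by omega)
    (tendsto_atTop_mono (fun r => Nat.le_add_left r n) tendsto_id)

lemma exists_tendsto_homNorm (k : ℤ) : ∃ m n : ℕ, ∀ a : MatrixAlgebra K,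
    Tendsto (fun r => homNorm J (m + r) (n + r) (a : T.Mat)) atTop
      (𝓝 (degreeNorm J k (a : T.Mat))) :=
  ⟨k.toNat, (-k).toNat, fun a => tendsto_homNorm_add J a (by omega)⟩

lemma degreeNorm_nonneg (k : ℤ) (a : MatrixAlgebra K) : 0 ≤ degreeNorm J k (a : T.Mat) :=
  ge_of_tendsto' (tendsto_homNorm_degreeNorm J a k) fun _ => homNorm_nonneg J _ _ _

lemma degreeNorm_le_homNorm {m n : ℕ} {a : MatrixAlgebra K} (ha : a ∈ homogeneous K m n) {k : ℤ}
    (hk : (m : ℤ) - n = k) : degreeNorm J k (a : T.Mat) ≤ homNorm J m n (a : T.Mat) := by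
  have anti : Antitone fun r => homNorm J (m + r) (n + r) (a : T.Mat) :=
    antitone_nat_of_succ_le fun r => homNorm_succ_le J (homogeneous_le_add K m n r ha)
  exact anti.le_of_tendsto (tendsto_homNorm_add J a hk) 0

lemma degreeNorm_degPart (k : ℤ) (a : MatrixAlgebra K) :
    degreeNorm J k (degPart K k a : T.Mat) = degreeNorm J k (a : T.Mat) := by
  have h : (((k.toNat : ℕ) : ℤ) - ((-k).toNat : ℕ)) = k := by omega
  refine tendsto_nhds_unique (tendsto_homNorm_add J (degPart K k a) h) ?_
  refine (tendsto_homNorm_add J a h).congr fun r => ?_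
  rw [homNorm_degPart J (by omega)]

lemma degreeNorm_zero (k : ℤ) : degreeNorm J k ((0 : MatrixAlgebra K) : T.Mat) = 0 := by
  obtain ⟨m, n, h⟩ := exists_tendsto_homNorm (K := K) J k
  refine tendsto_nhds_unique (h 0) (tendsto_const_nhds.congr fun r => ?_)
  exact (map_zero (homSeminorm J (m + r) (n + r))).symm

lemma degreeNorm_eq_zero_of_degPart {k : ℤ} {a : MatrixAlgebra K} (h : degPart K k a = 0) :
    degreeNorm J k (a : T.Mat) = 0 := by
  rw [← degreeNorm_degPart, h, degreeNorm_zero]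

lemma degreeNorm_add_le (k : ℤ) (a b : MatrixAlgebra K) :
    degreeNorm J k ((a + b : MatrixAlgebra K) : T.Mat)
      ≤ degreeNorm J k (a : T.Mat) + degreeNorm J k (b : T.Mat) :=
  le_of_tendsto_of_tendsto' (tendsto_homNorm_degreeNorm J (a + b) k)
    ((tendsto_homNorm_degreeNorm J a k).add (tendsto_homNorm_degreeNorm J b k))
    fun _ => homNorm_add_le J _ _ _ _

lemma degreeNorm_smul_le (k : ℤ) (c : ℂ) (a : MatrixAlgebra K) :
    degreeNorm J k ((c • a : MatrixAlgebra K) : T.Mat) ≤ ‖c‖ * degreeNorm J k (a : T.Mat) :=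
  le_of_tendsto_of_tendsto' (tendsto_homNorm_degreeNorm J (c • a) k)
    ((tendsto_homNorm_degreeNorm J a k).const_mul _) fun _ => homNorm_smul_le J _ _ _ _

lemma degreeNorm_star (k : ℤ) (a : MatrixAlgebra K) :
    degreeNorm J k ((star a : MatrixAlgebra K) : T.Mat) = degreeNorm J (-k) (a : T.Mat) := by
  have h : (((k.toNat : ℕ) : ℤ) - ((-k).toNat : ℕ)) = k := by omega
  refine tendsto_nhds_unique (tendsto_homNorm_add J (star a) h) ?_
  refine (tendsto_homNorm_add J (k := -k) (m := (-k).toNat) (n := k.toNat) a (by omega)).congr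
    fun r => ?_
  rw [MatrixAlgebra.coe_star, homNorm_conj]

lemma degreeNorm_mul_le {l m n : ℕ} {a : MatrixAlgebra K} (ha : a ∈ homogeneous K m n)
    (b : MatrixAlgebra K) {i j : ℤ} (hi : (m : ℤ) - n = i) (hj : (l : ℤ) - m = j) :
    degreeNorm J (i + j) ((a * b : MatrixAlgebra K) : T.Mat)
      ≤ degreeNorm J i (a : T.Mat) * degreeNorm J j (b : T.Mat) :=
  le_of_tendsto_of_tendsto' (tendsto_homNorm_add J (m := l) (n := n) (a * b) (by omega))
    ((tendsto_homNorm_add J a hi).mul (tendsto_homNorm_add J b hj))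
    fun r => homNorm_mul_le J (l + r) (homogeneous_le_add K m n r ha) b

lemma degreeNorm_star_mul_self {m n : ℕ} {a : MatrixAlgebra K} (ha : a ∈ homogeneous K m n) {k : ℤ}
    (hk : (m : ℤ) - n = k) :
    degreeNorm J 0 ((star a * a : MatrixAlgebra K) : T.Mat) = degreeNorm J k (a : T.Mat) ^ 2 := by
  refine tendsto_nhds_unique (tendsto_homNorm_add J (m := m) (n := m) (star a * a) (by omega)) ?_
  refine ((tendsto_homNorm_add J a hk).pow 2).congr fun r => ?_
  rw [homNorm_star_mul_self J (homogeneous_le_add K m n r ha)]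

/-! ### The norm `‖·‖_J` -/

lemma matNorm_eq_sum {a : MatrixAlgebra K} {F : Finset ℤ}
    (hF : ∀ k ∉ F, degreeNorm J k (a : T.Mat) = 0) :
    matNorm J (a : T.Mat) = ∑ k ∈ F, degreeNorm J k (a : T.Mat) :=
  finsum_eq_sum_of_support_subset _ fun k hk => by
    by_contra h
    exact hk (hF k h)

lemma exists_matNorm_eq_sum (a : MatrixAlgebra K) : ∃ F : Finset ℤ, ∀ G, F ⊆ G →
    matNorm J (a : T.Mat) = ∑ k ∈ G, degreeNorm J k (a : T.Mat) := by
  obtain ⟨F, hF⟩ := exists_degPart_eq_zero a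
  exact ⟨F, fun G hG => matNorm_eq_sum J fun k hk =>
    degreeNorm_eq_zero_of_degPart J (hF k fun h => hk (hG h))⟩

lemma degreeNorm_le_matNorm (a : MatrixAlgebra K) (k : ℤ) :
    degreeNorm J k (a : T.Mat) ≤ matNorm J (a : T.Mat) := by
  classical
  obtain ⟨F, hF⟩ := exists_matNorm_eq_sum J a
  rw [hF (insert k F) (Finset.subset_insert k F)]
  exact Finset.single_le_sum (f := fun k => degreeNorm J k (a : T.Mat))
    (fun k _ => degreeNorm_nonneg J k a) (Finset.mem_insert_self k F)

lemma matNorm_of_mem {m n : ℕ} {a : MatrixAlgebra K} (ha : a ∈ homogeneous K m n) {k : ℤ}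
    (hk : (m : ℤ) - n = k) : matNorm J (a : T.Mat) = degreeNorm J k (a : T.Mat) := by
  rw [matNorm_eq_sum J (F := {k}), Finset.sum_singleton]
  intro j hj
  refine degreeNorm_eq_zero_of_degPart J (degPart_of_mem_of_ne ha fun h => hj ?_)
  rw [Finset.mem_singleton, ← h, hk]

lemma matNorm_le_homNorm {m n : ℕ} {a : MatrixAlgebra K} (ha : a ∈ homogeneous K m n) :
    matNorm J (a : T.Mat) ≤ homNorm J m n (a : T.Mat) :=
  (matNorm_of_mem J ha rfl).trans_le (degreeNorm_le_homNorm J ha rfl)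

/-- The seminorm `‖·‖_J` on `M_T(K)`. -/
def matSeminorm (K J : T.CStarIdeal) : Seminorm ℂ (MatrixAlgebra K) :=
  Seminorm.ofSMulLE (fun a => matNorm J (a : T.Mat))
    (by
      rw [matNorm_eq_sum J (F := ∅) fun k _ => degreeNorm_zero J k, Finset.sum_empty])
    (fun a b => by
      classical
      obtain ⟨F, hF⟩ := exists_matNorm_eq_sum J a
      obtain ⟨G, hG⟩ := exists_matNorm_eq_sum J b
      obtain ⟨H, hH⟩ := exists_matNorm_eq_sum J (a + b)
      have h1 : F ⊆ F ∪ G ∪ H := fun x hx => by simp [hx]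
      have h2 : G ⊆ F ∪ G ∪ H := fun x hx => by simp [hx]
      have h3 : H ⊆ F ∪ G ∪ H := fun x hx => by simp [hx]
      rw [hF _ h1, hG _ h2, hH _ h3, ← Finset.sum_add_distrib]
      exact Finset.sum_le_sum fun k _ => degreeNorm_add_le J k a b)
    (fun c a => by
      classical
      obtain ⟨F, hF⟩ := exists_matNorm_eq_sum J a
      obtain ⟨H, hH⟩ := exists_matNorm_eq_sum J (c • a)
      rw [hF _ Finset.subset_union_left, hH _ Finset.subset_union_right, Finset.mul_sum]
      exact Finset.sum_le_sum fun k _ => degreeNorm_smul_le J k c a)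

lemma matSeminorm_apply (a : MatrixAlgebra K) : matSeminorm K J a = matNorm J (a : T.Mat) := rfl

lemma matSeminorm_star (a : MatrixAlgebra K) : matSeminorm K J (star a) = matSeminorm K J a := by
  change ∑ᶠ k : ℤ, degreeNorm J k ((star a : MatrixAlgebra K) : T.Mat)
    = ∑ᶠ k : ℤ, degreeNorm J k (a : T.Mat)
  simp only [degreeNorm_star]
  exact finsum_comp_equiv (Equiv.neg ℤ) (f := fun k => degreeNorm J k (a : T.Mat))

/-- A seminorm that is dominated by the norms of the diagonals is dominated by `‖·‖_J`. -/
lemma le_matNorm_of_le_degreeNorm (p : Seminorm ℂ (MatrixAlgebra K))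
    (h : ∀ a k, p (degPart K k a) ≤ degreeNorm J k (a : T.Mat)) (a : MatrixAlgebra K) :
    p a ≤ matNorm J (a : T.Mat) := by
  obtain ⟨F, hF⟩ := exists_degPart_eq_zero a
  rw [matNorm_eq_sum J fun k hk => degreeNorm_eq_zero_of_degPart J (hF k hk)]
  conv_lhs => rw [← sum_degPart hF]
  exact (Finset.le_sum_of_subadditive p (map_zero p).le (map_add_le_add p) _ _).trans
    (Finset.sum_le_sum fun k _ => h a k)

/-- Both factors are split into diagonals. The product of those of degrees i and j is homogeneous of
degree i + j, so its norm is a single limit and the homogeneous estimate applies. -/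
lemma matSeminorm_mul_le (a b : MatrixAlgebra K) :
    matSeminorm K J (a * b) ≤ matSeminorm K J a * matSeminorm K J b := by
  obtain ⟨F, hF⟩ := exists_degPart_eq_zero a
  obtain ⟨G, hG⟩ := exists_degPart_eq_zero b
  have key : ∀ i j : ℤ, matSeminorm K J (degPart K i a * degPart K j b)
      ≤ degreeNorm J i (a : T.Mat) * degreeNorm J j (b : T.Mat) := by
    intro i j
    obtain ⟨R, hR⟩ := exists_degPart_mem a
    obtain ⟨R', hR'⟩ := exists_degPart_mem b
    -- Large enough for n ≥ R and m = n + i ≥ R', and for l = n + i + j to be a natural number.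
    set n := R + R' + i.natAbs + (i + j).natAbs with hn
    obtain ⟨m, hm⟩ : ∃ m : ℕ, (m : ℤ) - n = i := ⟨(n + i).toNat, by omega⟩
    obtain ⟨l, hl⟩ : ∃ l : ℕ, (l : ℤ) - m = j := ⟨(m + j).toNat, by omega⟩
    have ha := hR m n (by omega)
    have hb := hR' l m (by omega)
    rw [hm] at ha
    rw [hl] at hb
    rw [matSeminorm_apply, matNorm_of_mem J (mul_mem_homogeneous ha hb) (k := i + j) (by omega)]
    refine (degreeNorm_mul_le J ha _ hm hl).trans_eq ?_
    rw [degreeNorm_degPart, degreeNorm_degPart]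
  have ea : matSeminorm K J a = ∑ k ∈ F, degreeNorm J k (a : T.Mat) :=
    matNorm_eq_sum J fun k hk => degreeNorm_eq_zero_of_degPart J (hF k hk)
  have eb : matSeminorm K J b = ∑ k ∈ G, degreeNorm J k (b : T.Mat) :=
    matNorm_eq_sum J fun k hk => degreeNorm_eq_zero_of_degPart J (hG k hk)
  rw [ea, eb, Finset.sum_mul_sum]
  conv_lhs => rw [← sum_degPart hF, ← sum_degPart hG, Finset.sum_mul_sum]
  have sub : ∀ (F : Finset ℤ) (f : ℤ → MatrixAlgebra K),
      matSeminorm K J (∑ k ∈ F, f k) ≤ ∑ k ∈ F, matSeminorm K J (f k) := fun F f =>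
    Finset.le_sum_of_subadditive _ (map_zero _).le (map_add_le_add _) _ _
  exact (sub _ _).trans (Finset.sum_le_sum fun i _ =>
    (sub _ _).trans (Finset.sum_le_sum fun j _ => key i j))

end Limits

end RightTensorCStarPrecategory

namespace RightTensorCStarPrecategory

/-! ### C*-seminorms and completions -/

section Completion

variable {A : Type u} [NonUnitalRing A] [Module ℂ A]

/-- The seminorm `a ↦ ‖Ψ a‖` induced by a linear map. -/
def mapSeminorm {B : Type w} [NormedAddCommGroup B] [NormedSpace ℂ B] (Ψ : A →ₗ[ℂ] B) :
    Seminorm ℂ A :=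
  (normSeminorm ℂ B).comp Ψ

lemma mapSeminorm_apply {B : Type w} [NormedAddCommGroup B] [NormedSpace ℂ B] (Ψ : A →ₗ[ℂ] B)
    (a : A) : mapSeminorm Ψ a = ‖Ψ a‖ := rfl

lemma exists_banach_completion (p : Seminorm ℂ A) :
    ∃ (X : Type u) (_ : NormedAddCommGroup X) (_ : NormedSpace ℂ X) (_ : CompleteSpace X)
      (e : A →ₗ[ℂ] X), DenseRange e ∧ ∀ a, ‖e a‖ = p a := by
  let _ : SeminormedAddCommGroup A := p.toAddGroupSeminorm.toSeminormedAddCommGroup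
  let _ : NormedSpace ℂ A := { norm_smul_le := fun c a => (map_smul_eq_mul p c a).le }
  refine ⟨UniformSpace.Completion A, inferInstance, inferInstance, inferInstance,
    (UniformSpace.Completion.toComplₗᵢ (𝕜 := ℂ) (E := A)).toLinearMap, ?_, fun a => ?_⟩
  · exact UniformSpace.Completion.denseRange_coe
  · exact UniformSpace.Completion.norm_coe a

variable [StarRing A]

lemma IsCStarSeminorm.map_star {p : Seminorm ℂ A} (hp : IsCStarSeminorm p) (a : A) :
    p (star a) = p a := by
  have key : ∀ a, p a ≤ p (star a) := by
    intro a
    rcases (apply_nonneg p a).eq_or_lt with h | h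
    · rw [← h]; exact apply_nonneg p _
    · have h1 := hp.mul_le (star a) a
      rw [hp.star_mul_self, sq] at h1
      exact le_of_mul_le_mul_right h1 h
  refine le_antisymm ?_ (key a)
  have := key (star a)
  rwa [star_star] at this

lemma isCStarSeminorm_mapSeminorm {B : Type w} [NonUnitalCStarAlgebra B] (Ψ : A →ₗ[ℂ] B)
    (hmul : ∀ a b, Ψ (a * b) = Ψ a * Ψ b) (hstar : ∀ a, Ψ (star a) = star (Ψ a)) :
    IsCStarSeminorm (mapSeminorm Ψ) where
  mul_le a b := by
    rw [mapSeminorm_apply, hmul]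
    exact norm_mul_le _ _
  star_mul_self a := by
    rw [mapSeminorm_apply, hmul, hstar, CStarRing.norm_star_mul_self, mapSeminorm_apply, sq]

variable [IsScalarTower ℂ A A] [SMulCommClass ℂ A A]

/-- The product is extended by continuity twice: each left multiplication to an operator on X, then
the map from arrows of A to operators. Submultiplicativity of p bounds both. -/
lemma exists_mul_extension {p : Seminorm ℂ A} (hp : IsCStarSeminorm p) {X : Type u}
    [NormedAddCommGroup X] [NormedSpace ℂ X] [CompleteSpace X] {e : A →ₗ[ℂ] X}
    (hd : DenseRange e) (hn : ∀ a, ‖e a‖ = p a) :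
    ∃ M : X →L[ℂ] X →L[ℂ] X, ∀ a b, M (e a) (e b) = e (a * b) := by
  have h1 : ∀ a, ∀ b, ‖(e ∘ₗ LinearMap.mulLeft ℂ a) b‖ ≤ p a * ‖e b‖ := fun a b => by
    rw [hn b]
    exact (hn _).trans_le (hp.mul_le a b)
  let L : A → X →L[ℂ] X := fun a => (e ∘ₗ LinearMap.mulLeft ℂ a).extendOfNorm e
  have hL : ∀ a b, L a (e b) = e (a * b) := fun a b =>
    LinearMap.extendOfNorm_eq hd ⟨_, h1 a⟩ b
  have ext : ∀ f g : X →L[ℂ] X, (∀ b, f (e b) = g (e b)) → f = g := fun f g h =>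
    ContinuousLinearMap.coeFn_injective (hd.equalizer f.continuous g.continuous (funext h))
  let L' : A →ₗ[ℂ] X →L[ℂ] X :=
    { toFun := L
      map_add' := fun a a' => ext _ _ fun b => by
        rw [_root_.add_apply, hL, hL, hL, add_mul, map_add]
      map_smul' := fun c a => ext _ _ fun b => by
        rw [RingHom.id_apply, _root_.smul_apply, hL, hL, smul_mul_assoc, map_smul] }
  have h2 : ∀ a, ‖L' a‖ ≤ 1 * ‖e a‖ := fun a => by
    rw [one_mul, hn]
    exact ContinuousLinearMap.opNorm_le_bound _ (apply_nonneg p a)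
      (LinearMap.norm_extendOfNorm_apply_le hd _ (h1 a))
  refine ⟨L'.extendOfNorm e, fun a b => ?_⟩
  rw [LinearMap.extendOfNorm_eq hd ⟨_, h2⟩ a]
  exact hL a b

variable [StarModule ℂ A]

/-- The completion of a `*`-algebra in a C*-seminorm. -/
theorem exists_cstar_completion {p : Seminorm ℂ A} (hp : IsCStarSeminorm p) :
    ∃ (B : Type u) (_ : NonUnitalCStarAlgebra B) (Φ : A →ₗ[ℂ] B),
      (∀ a b, Φ (a * b) = Φ a * Φ b) ∧ (∀ a, Φ (star a) = star (Φ a)) ∧ DenseRange Φ ∧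
        ∀ a, ‖Φ a‖ = p a := by
  obtain ⟨X, _, _, _, e, hd, hn⟩ := exists_banach_completion p
  obtain ⟨M, hM⟩ := exists_mul_extension hp hd hn
  let f : A →ₛₗ[starRingEnd ℂ] X :=
    { toFun := fun a => e (star a)
      map_add' := fun a b => by rw [star_add, map_add]
      map_smul' := fun c a => by rw [star_smul, map_smul]; rfl }
  have hf : ∀ a, ‖f a‖ ≤ 1 * ‖e a‖ := fun a => by
    rw [one_mul, hn]
    exact ((hn _).trans (hp.map_star a)).le
  obtain ⟨s, hs⟩ : ∃ s : X →SL[starRingEnd ℂ] X, ∀ a, s (e a) = e (star a) :=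
    ⟨f.extendOfNorm e, LinearMap.extendOfNorm_eq hd ⟨1, hf⟩⟩
  -- This bound and the following C*-algebra laws are closed conditions, so they need checking only
  -- on the dense image of A.
  have normM : ∀ x y, ‖M x y‖ ≤ ‖x‖ * ‖y‖ := by
    intro x y
    refine hd.induction_on₂ (p := fun x y => ‖M x y‖ ≤ ‖x‖ * ‖y‖) ?_ (fun a b => ?_) x y
    · exact isClosed_le (by fun_prop) (by fun_prop)
    · rw [hM, hn, hn, hn]
      exact hp.mul_le a b
  have assocM : ∀ x y z, M (M x y) z = M x (M y z) := by
    intro x y z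
    refine hd.induction_on₃ (p := fun x y z => M (M x y) z = M x (M y z)) ?_ (fun a b c => ?_) x y z
    · exact isClosed_eq (by fun_prop) (by fun_prop)
    · rw [hM, hM, hM, hM, mul_assoc]
  have starM : ∀ x y, s (M x y) = M (s y) (s x) := by
    intro x y
    refine hd.induction_on₂ (p := fun x y => s (M x y) = M (s y) (s x)) ?_ (fun a b => ?_) x y
    · exact isClosed_eq (by fun_prop) (by fun_prop)
    · rw [hM, hs, hs, hs, hM, star_mul]
  have invs : ∀ x, s (s x) = x := by
    intro x
    refine hd.induction_on (p := fun x => s (s x) = x) x ?_ (fun a => ?_)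
    · exact isClosed_eq (by fun_prop) (by fun_prop)
    · rw [hs, hs, star_star]
  have cstar : ∀ x, ‖x‖ * ‖x‖ ≤ ‖M (s x) x‖ := by
    intro x
    refine hd.induction_on (p := fun x => ‖x‖ * ‖x‖ ≤ ‖M (s x) x‖) x ?_ (fun a => ?_)
    · exact isClosed_le (by fun_prop) (by fun_prop)
    · rw [hs, hM, hn, hn, hp.star_mul_self, sq]
  let _ : NonUnitalNormedRing X :=
    { (inferInstance : NormedAddCommGroup X) with
      mul := fun x y => M x y
      left_distrib := fun x y z => map_add (M x) y z
      right_distrib := fun x y z => by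
        change M (x + y) z = M x z + M y z
        rw [map_add, _root_.add_apply]
      zero_mul := fun x => by
        change M 0 x = 0
        rw [map_zero, _root_.zero_apply]
      mul_zero := fun x => map_zero (M x)
      mul_assoc := assocM
      norm_mul_le := normM }
  let _ : StarRing X :=
    { star := s
      star_involutive := invs
      star_mul := starM
      star_add := map_add s }
  let C : NonUnitalCStarAlgebra X :=
    { (inferInstance : NonUnitalNormedRing X), (inferInstance : StarRing X),
      (inferInstance : CompleteSpace X), (inferInstance : NormedSpace ℂ X) with
      norm_mul_self_le := cstar
      smul_assoc := fun c x y => by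
        change M (c • x) y = c • M x y
        rw [map_smul, _root_.smul_apply]
      smul_comm := fun c x y => (map_smul (M x) c y).symm
      star_smul := fun c x => map_smulₛₗ s c x }
  exact ⟨X, C, e, fun a b => (hM a b).symm, fun a => (hs a).symm, hd, hn⟩

end Completion

/-! ### Extension of homomorphisms to completions -/

section Extension

lemma starAlgHom_eq_of_denseRange {A : Type u} {O : Type v} [NonUnitalCStarAlgebra O] {Φ : A → O}
    (hd : DenseRange Φ) {B : Type w} [NonUnitalCStarAlgebra B] {ψ ψ' : O →⋆ₙₐ[ℂ] B}
    (h : ∀ a, ψ (Φ a) = ψ' (Φ a)) : ψ = ψ' := by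
  have hc : ∀ ψ : O →⋆ₙₐ[ℂ] B, Continuous ψ := fun ψ =>
    AddMonoidHomClass.continuous_of_bound ψ 1 fun x => by
      rw [one_mul]; exact NonUnitalStarAlgHom.norm_apply_le ψ x
  exact DFunLike.coe_injective (hd.equalizer (hc ψ) (hc ψ') (funext h))

variable {A : Type u} [NonUnitalRing A] [StarRing A] [Module ℂ A]

theorem exists_starAlgHom_extension {O : Type v} [NonUnitalCStarAlgebra O] {Φ : A →ₗ[ℂ] O}
    (hmul : ∀ a b, Φ (a * b) = Φ a * Φ b) (hstar : ∀ a, Φ (star a) = star (Φ a))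
    (hd : DenseRange Φ) {B : Type w} [NonUnitalCStarAlgebra B] {Ψ : A →ₗ[ℂ] B}
    (hmul' : ∀ a b, Ψ (a * b) = Ψ a * Ψ b) (hstar' : ∀ a, Ψ (star a) = star (Ψ a))
    (h : ∀ a, ‖Ψ a‖ ≤ ‖Φ a‖) :
    ∃ ψ : O →⋆ₙₐ[ℂ] B, ∀ a, ψ (Φ a) = Ψ a := by
  obtain ⟨ψ, hψ⟩ : ∃ ψ : O →L[ℂ] B, ∀ a, ψ (Φ a) = Ψ a :=
    ⟨Ψ.extendOfNorm Φ, LinearMap.extendOfNorm_eq hd ⟨1, fun a => by rw [one_mul]; exact h a⟩⟩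
  refine ⟨{ ψ with
    map_zero' := map_zero ψ
    map_mul' := fun x y => ?_
    map_star' := fun x => ?_ }, hψ⟩
  · refine hd.induction_on₂ (p := fun x y => ψ (x * y) = ψ x * ψ y) ?_ (fun a b => ?_) x y
    · exact isClosed_eq (by fun_prop) (by fun_prop)
    · rw [← hmul, hψ, hψ, hψ, hmul']
  · refine hd.induction_on (p := fun x => ψ (star x) = star (ψ x)) x ?_ (fun a => ?_)
    · exact isClosed_eq (by fun_prop) (by fun_prop)
    · rw [← hstar, hψ, hψ, hstar']

end Extension

/-! ### The largest C*-seminorm -/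

section Envelope

variable {A : Type u} [NonUnitalRing A] [StarRing A] [Module ℂ A]

/-- The `*`-seminorms satisfying the C*-identity and killing the null space of `N` have a largest
element as soon as they are all dominated by `N`. -/
theorem exists_largest_isCStarSeminorm (N : A → ℝ)
    (h : ∀ p : Seminorm ℂ A, IsCStarSeminorm p → (∀ a, N a = 0 → p a = 0) → ∀ a, p a ≤ N a) :
    ∃ p : Seminorm ℂ A, IsCStarSeminorm p ∧ (∀ a, p a ≤ N a) ∧
      ∀ q : Seminorm ℂ A, IsCStarSeminorm q → (∀ a, N a = 0 → q a = 0) → ∀ a, q a ≤ p a := by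
  let I := {p : Seminorm ℂ A // IsCStarSeminorm p ∧ ∀ a, N a = 0 → p a = 0}
  have hzero : IsCStarSeminorm (0 : Seminorm ℂ A) :=
    ⟨fun a b => by simp, fun a => by simp⟩
  have : Nonempty I := ⟨⟨0, hzero, fun a _ => rfl⟩⟩
  have hb : ∀ a, BddAbove (Set.range fun p : I => p.1 a) := fun a =>
    ⟨N a, by rintro _ ⟨p, rfl⟩; exact h p.1 p.2.1 p.2.2 a⟩
  have le_sup : ∀ (p : I) a, p.1 a ≤ ⨆ p : I, p.1 a := fun p a => le_ciSup (hb a) p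
  have nonneg : ∀ a, 0 ≤ ⨆ p : I, p.1 a := fun a => (apply_nonneg _ a).trans (le_sup
    (Classical.arbitrary I) a)
  let P : Seminorm ℂ A := Seminorm.ofSMulLE (fun a => ⨆ p : I, p.1 a)
    (by simp)
    (fun a b => ciSup_le fun p => (map_add_le_add p.1 a b).trans
      (add_le_add (le_sup p a) (le_sup p b)))
    (fun c a => ciSup_le fun p => (map_smul_eq_mul p.1 c a).trans_le
      (mul_le_mul_of_nonneg_left (le_sup p a) (norm_nonneg c)))
  refine ⟨P, ⟨fun a b => ?_, fun a => ?_⟩, fun a => ciSup_le fun p => h p.1 p.2.1 p.2.2 a,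
    fun q hq hq0 a => le_sup ⟨q, hq, hq0⟩ a⟩
  · exact ciSup_le fun p => (p.2.1.mul_le a b).trans
      (mul_le_mul (le_sup p a) (le_sup p b) (apply_nonneg _ b) (nonneg a))
  · refine le_antisymm (ciSup_le fun p => ?_) ?_
    · rw [p.2.1.star_mul_self]
      exact pow_le_pow_left₀ (apply_nonneg _ a) (le_sup p a) 2
    -- The C*-identity survives suprema: every p in the family satisfies p(a) = √p(a*a), and the
    -- square root is monotone.
    · refine (Real.le_sqrt (nonneg a) (nonneg _)).1 (ciSup_le fun p => Real.le_sqrt_of_sq_le ?_)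
      rw [← p.2.1.star_mul_self]
      exact le_sup p _

end Envelope

end RightTensorCStarPrecategory

namespace RightTensorCStarPrecategory

open CStarPrecategory Mat

variable {T : RightTensorCStarPrecategory.{u}} {K J : T.CStarIdeal}

/-! ### Homomorphisms of `M_T(K)` into C*-algebras -/

section Factorization

lemma exists_linearMap_factor {V W U : Type*} [AddCommGroup V] [AddCommGroup W] [AddCommGroup U]
    [Module ℂ V] [Module ℂ W] [Module ℂ U] (q : V →ₗ[ℂ] W) (hq : Function.Surjective q)
    (f : V →ₗ[ℂ] U) (h : ∀ v, q v = 0 → f v = 0) : ∃ g : W →ₗ[ℂ] U, ∀ v, g (q v) = f v := by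
  refine ⟨(LinearMap.ker q).liftQ f h ∘ₗ (q.quotKerEquivOfSurjective hq).symm.toLinearMap,
    fun v => ?_⟩
  have : (q.quotKerEquivOfSurjective hq).symm (q v) = (LinearMap.ker q).mkQ v := by
    rw [LinearEquiv.symm_apply_eq]
    rfl
  change (LinearMap.ker q).liftQ f h ((q.quotKerEquivOfSurjective hq).symm (q v)) = f v
  rw [this]
  rfl

variable {S : RightTensorCStarPrecategory.{u}}
  {Q : ∀ m n : ℕ, homogeneous K m n →ₗ[ℂ] S.Hom m n}
  {B : Type w} [NonUnitalCStarAlgebra B] {Ψ : MatrixAlgebra K →ₗ[ℂ] B}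

lemma IsHomogeneousQuotient.exists_factor (hQ : IsHomogeneousQuotient K J S Q)
    (hnull : ∀ (m n : ℕ), ∀ a ∈ homogeneous K m n, homNorm J m n (a : T.Mat) = 0 → Ψ a = 0) :
    ∃ ι : ∀ m n : ℕ, S.Hom m n →ₗ[ℂ] B,
      ∀ (m n : ℕ) (a : homogeneous K m n), ι m n (Q m n a) = Ψ a := by
  have h : ∀ m n : ℕ, ∃ ι : S.Hom m n →ₗ[ℂ] B, ∀ a : homogeneous K m n, ι (Q m n a) = Ψ a :=
    fun m n => exists_linearMap_factor (Q m n) (hQ.surjective m n)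
      (Ψ ∘ₗ (homogeneous K m n).subtype) fun a ha => hnull m n a a.2 <| by
        rw [← hQ.norm_map, ha, norm_zero]
  choose ι hι using h
  exact ⟨ι, hι⟩

lemma IsHomogeneousQuotient.factor_comp (hQ : IsHomogeneousQuotient K J S Q)
    (hmul : ∀ a b, Ψ (a * b) = Ψ a * Ψ b) {ι : ∀ m n : ℕ, S.Hom m n →ₗ[ℂ] B}
    (hι : ∀ (m n : ℕ) (a : homogeneous K m n), ι m n (Q m n a) = Ψ a) (l m n : ℕ)
    (x : S.Hom m n) (y : S.Hom l m) : ι l n (S.comp x y) = ι m n x * ι l m y := by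
  obtain ⟨a, rfl⟩ := hQ.surjective m n x
  obtain ⟨b, rfl⟩ := hQ.surjective l m y
  rw [← hQ.map_mul l m n a b ⟨_, hQ.mul_mem l m n a b⟩ rfl, hι, hι, hι, hmul]

lemma IsHomogeneousQuotient.factor_adj (hQ : IsHomogeneousQuotient K J S Q)
    (hstar : ∀ a, Ψ (star a) = star (Ψ a)) {ι : ∀ m n : ℕ, S.Hom m n →ₗ[ℂ] B}
    (hι : ∀ (m n : ℕ) (a : homogeneous K m n), ι m n (Q m n a) = Ψ a) (m n : ℕ)
    (x : S.Hom m n) : ι n m (S.adj x) = star (ι m n x) := by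
  obtain ⟨a, rfl⟩ := hQ.surjective m n x
  rw [← hQ.map_star m n a ⟨_, hQ.star_mem m n a⟩ rfl, hι, hι, hstar]

lemma IsHomogeneousQuotient.factor_tensor (hQ : IsHomogeneousQuotient K J S Q)
    {ι : ∀ m n : ℕ, S.Hom m n →ₗ[ℂ] B}
    (hι : ∀ (m n : ℕ) (a : homogeneous K m n), ι m n (Q m n a) = Ψ a) (m n : ℕ)
    (x : S.Hom m n) : ι (m + 1) (n + 1) (S.tensor x) = ι m n x := by
  obtain ⟨a, rfl⟩ := hQ.surjective m n x
  rw [← hQ.map_tensor m n a ⟨_, hQ.le_succ m n a.2⟩ rfl, hι, hι]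

/-- The homomorphism factors through the C*-algebra K_J(m, m), on which it is automatically
contractive; the C*-identity extends the bound to M(m, n). -/
lemma IsHomogeneousQuotient.norm_le_homNorm (hQ : IsHomogeneousQuotient K J S Q)
    (hmul : ∀ a b, Ψ (a * b) = Ψ a * Ψ b) (hstar : ∀ a, Ψ (star a) = star (Ψ a))
    (hnull : ∀ (m n : ℕ), ∀ a ∈ homogeneous K m n, homNorm J m n (a : T.Mat) = 0 → Ψ a = 0)
    {m n : ℕ} {a : MatrixAlgebra K} (ha : a ∈ homogeneous K m n) :
    ‖Ψ a‖ ≤ homNorm J m n (a : T.Mat) := by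
  obtain ⟨ι, hι⟩ := hQ.exists_factor hnull
  refine abs_le_of_sq_le_sq' ?_ (homNorm_nonneg J m n (a : T.Mat)) |>.2
  rw [← homNorm_star_mul_self J ha, sq, ← CStarRing.norm_star_mul_self, ← hstar, ← hmul]
  let _ := S.endAlgebra m
  let φ : S.Hom m m →⋆ₙₐ[ℂ] B :=
    { ι m m with
      map_zero' := map_zero (ι m m)
      map_mul' := hQ.factor_comp hmul hι m m m
      map_star' := hQ.factor_adj hstar hι m m }
  have h := NonUnitalStarAlgHom.norm_apply_le φ
    (Q m m ⟨star a * a, mul_mem_homogeneous (star_mem_homogeneous ha) ha⟩)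
  have h1 := hι m m ⟨star a * a, mul_mem_homogeneous (star_mem_homogeneous ha) ha⟩
  rw [← h1]
  exact h.trans_eq (hQ.norm_map m m _)

/-- The norm `‖·‖_J` dominates every homomorphism into a C*-algebra that kills the null spaces of
the seminorms of the homogeneous parts. -/
lemma norm_le_matNorm_of_null (hJ : ∀ m n : ℕ, J m n ≤ tensorIdeal K m n)
    (hmul : ∀ a b, Ψ (a * b) = Ψ a * Ψ b) (hstar : ∀ a, Ψ (star a) = star (Ψ a))
    (hnull : ∀ (m n : ℕ), ∀ a ∈ homogeneous K m n, homNorm J m n (a : T.Mat) = 0 → Ψ a = 0)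
    (a : MatrixAlgebra K) : ‖Ψ a‖ ≤ matNorm J (a : T.Mat) := by
  refine le_matNorm_of_le_degreeNorm J (mapSeminorm Ψ) (fun a k => ?_) a
  obtain ⟨m, n, hk, ha⟩ := exists_mem_degPart a k
  rw [← degreeNorm_degPart]
  exact ge_of_tendsto' (tendsto_homNorm_add J _ hk) fun r =>
    (isHomogeneousQuotient hJ).norm_le_homNorm hmul hstar hnull (homogeneous_le_add K m n r ha)

/-- A C*-seminorm is the norm of a homomorphism into its completion, so the automatic bound for
homomorphisms applies. This domination is what makes the supremum defining the norm of O finite. -/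
lemma isCStarSeminorm_le_matNorm (hJ : ∀ m n : ℕ, J m n ≤ tensorIdeal K m n)
    (p : Seminorm ℂ (MatrixAlgebra K)) (hp : IsCStarSeminorm p)
    (hp0 : ∀ a : MatrixAlgebra K, matNorm J (a : T.Mat) = 0 → p a = 0) (a : MatrixAlgebra K) :
    p a ≤ matNorm J (a : T.Mat) := by
  obtain ⟨B, _, Ψ, hmul, hstar, -, hn⟩ := exists_cstar_completion hp
  rw [← hn]
  refine norm_le_matNorm_of_null hJ hmul hstar (fun m n a ha h => ?_) a
  rw [← norm_eq_zero, hn]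
  refine hp0 a (le_antisymm ?_ (apply_nonneg (matSeminorm K J) a))
  exact (matNorm_le_homNorm J ha).trans h.le

variable (K J) in
/-- The enveloping C*-algebra of `M_T(K) / ‖·‖_J`. -/
theorem exists_envelope (hJ : ∀ m n : ℕ, J m n ≤ tensorIdeal K m n) :
    ∃ (O : Type u) (_ : NonUnitalCStarAlgebra O) (Φ : MatrixAlgebra K →ₗ[ℂ] O),
      (∀ a, ‖Φ a‖ ≤ matNorm J (a : T.Mat)) ∧
      IsEnvelopingCStarAlgebra (fun a : MatrixAlgebra K => matNorm J (a : T.Mat)) Φ := by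
  obtain ⟨p, hp, hle, hmax⟩ := exists_largest_isCStarSeminorm
    (fun a : MatrixAlgebra K => matNorm J (a : T.Mat)) (isCStarSeminorm_le_matNorm hJ)
  obtain ⟨O, hO, Φ, hmul, hstar, hd, hn⟩ := exists_cstar_completion hp
  refine ⟨O, hO, Φ, fun a => (hn a).trans_le (hle a), hmul, hstar, fun a ha => ?_, hd,
    fun q hq hq0 a => (hmax q hq hq0 a).trans_eq (hn a).symm⟩
  rw [← norm_le_zero_iff, hn]
  exact (hle a).trans_eq ha

end Factorization

/-! ### Right tensor representations and homomorphisms of `M_T(K)` -/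

section Representations

/-- The right tensor representation induced by a homomorphism of `M_T(K)`. -/
def RightTensorRep.ofHom {B : Type w} [NonUnitalCStarAlgebra B] (Ψ : MatrixAlgebra K →ₗ[ℂ] B)
    (hmul : ∀ a b, Ψ (a * b) = Ψ a * Ψ b) (hstar : ∀ a, Ψ (star a) = star (Ψ a)) :
    RightTensorRep K B where
  toFun n m := Ψ ∘ₗ matrixEmb K n m
  map_adj n m a := by
    change Ψ (matrixEmb K m n _) = star (Ψ (matrixEmb K n m a))
    rw [(isStarAlgebraWithRep K).emb_adj, hstar]
  map_tensor n m k l a b := by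
    change Ψ (matrixEmb K n m a) * Ψ (matrixEmb K (m + k) l b) = Ψ (matrixEmb K (n + k) l _)
    rw [← hmul, (isStarAlgebraWithRep K).emb_tensor]

/-- The difference of the one-entry matrices of a and a ⊗ 1 has last sum zero in M(m+1, n+1). Its
only other sum that may be non-zero is a, which vanishes modulo J, so ‖·‖_J kills the difference. -/
lemma RightTensorRep.ofHom_isCoisometricOn {B : Type w} [NonUnitalCStarAlgebra B]
    (Ψ : MatrixAlgebra K →ₗ[ℂ] B)
    (hmul : ∀ a b, Ψ (a * b) = Ψ a * Ψ b) (hstar : ∀ a, Ψ (star a) = star (Ψ a))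
    (hle : ∀ a, ‖Ψ a‖ ≤ matNorm J (a : T.Mat)) :
    (RightTensorRep.ofHom Ψ hmul hstar).IsCoisometricOn J := by
  intro n m a haJ ha ha'
  change Ψ (matrixEmb K n m ⟨a, ha⟩) = Ψ (matrixEmb K (n + 1) (m + 1) ⟨T.tensor a, ha'⟩)
  set x := matrixEmb K n m ⟨a, ha⟩ with hx
  set y := matrixEmb K (n + 1) (m + 1) ⟨T.tensor a, ha'⟩ with hy
  have hxmem : x ∈ homogeneous K m n := matrixEmb_mem_homogeneous n m _
  have hmem : x - y ∈ homogeneous K (m + 1) (n + 1) :=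
    Submodule.sub_mem _ (homogeneous_le_succ K m n hxmem) (matrixEmb_mem_homogeneous _ _ _)
  have hsub : ∀ s t, shiftSum 0 ((x - y : MatrixAlgebra K) : T.Mat) s t
      = shiftSum 0 (x : T.Mat) s t - shiftSum 0 (y : T.Mat) s t := by
    intro s t
    have h := MatrixAlgebra.shiftSum_coe_add (x - y) y
    rw [sub_add_cancel] at h
    rw [h]
    exact (add_sub_cancel_right _ _).symm
  rw [← sub_eq_zero, ← map_sub, ← norm_le_zero_iff]
  refine (hle _).trans ((matNorm_le_homNorm J hmem).trans ?_)
  rw [homNorm_le_iff J le_rfl]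
  refine ⟨fun s t hs ht hst => ?_, ?_⟩
  · rw [hsub, hy, shiftSum_matrixEmb_of_lt (n + 1) (m + 1) _ t hs, sub_zero]
    rcases (Nat.lt_succ_iff.1 hs).eq_or_lt with rfl | hs'
    · obtain rfl : t = m := by omega
      rw [hx, shiftSum_matrixEmb]
      exact (J.norm_mkQ_eq_zero.2 haJ).le
    · rw [hx, shiftSum_matrixEmb_of_lt n m _ t hs', map_zero, norm_zero]
  · rw [hsub, hy, shiftSum_matrixEmb, shiftSum_succ_succ_of_mem hxmem m le_rfl, hx,
      shiftSum_matrixEmb, sub_self, norm_zero]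

lemma exists_eq_sum_matrixEmb (a : MatrixAlgebra K) : ∃ F : Finset (ℕ × ℕ),
    a = ∑ p ∈ F, matrixEmb K p.1 p.2 ⟨(a : T.Mat) p.1 p.2, a.2.1 p.1 p.2⟩ := by
  refine ⟨a.2.2.toFinset, ?_⟩
  ext s t
  rw [AddSubmonoidClass.coe_finsetSum, Finset.sum_apply, Finset.sum_apply]
  by_cases h : (s, t) ∈ a.2.2.toFinset
  · rw [Finset.sum_eq_single_of_mem (s, t) h]
    · exact (single_apply_same s t _).symm
    · rintro ⟨s', t'⟩ - hne
      refine single_apply_of_ne _ ?_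
      by_contra hc
      rw [not_or, not_not, not_not] at hc
      exact hne (Prod.ext hc.1.symm hc.2.symm)
  · have h0 : (a : T.Mat) s t = 0 := by
      by_contra hne
      exact h (a.2.2.mem_toFinset.2 hne)
    rw [h0]
    refine (Finset.sum_eq_zero ?_).symm
    rintro ⟨s', t'⟩ hp
    refine single_apply_of_ne _ ?_
    by_contra hc
    rw [not_or, not_not, not_not] at hc
    exact h (by rw [hc.1, hc.2]; exact hp)

lemma matrixAlgebra_induction {P : MatrixAlgebra K → Prop} (h0 : P 0)
    (hadd : ∀ a b, P a → P b → P (a + b)) (hemb : ∀ n m (a : K m n), P (matrixEmb K n m a))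
    (a : MatrixAlgebra K) : P a := by
  obtain ⟨F, hF⟩ := exists_eq_sum_matrixEmb a
  rw [hF]
  exact Finset.sum_induction _ P hadd h0 fun p _ => hemb _ _ _

variable {B : Type w} [NonUnitalCStarAlgebra B]

/-- The homomorphism of `M_T(K)` induced by a right tensor representation of `K`. -/
def RightTensorRep.toHom (π : RightTensorRep K B) : MatrixAlgebra K →ₗ[ℂ] B where
  toFun a := ∑ᶠ p : ℕ × ℕ, π p.1 p.2 ⟨(a : T.Mat) p.1 p.2, a.2.1 p.1 p.2⟩
  map_add' a b := by
    have fin : ∀ a : MatrixAlgebra K, (Function.support fun p : ℕ × ℕ =>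
        π p.1 p.2 ⟨(a : T.Mat) p.1 p.2, a.2.1 p.1 p.2⟩).Finite := fun a =>
      a.2.2.subset fun p hp h => hp <| by
        have : (⟨(a : T.Mat) p.1 p.2, a.2.1 p.1 p.2⟩ : K p.2 p.1) = 0 := Subtype.ext h
        simp only [this, map_zero]
    rw [← finsum_add_distrib (fin a) (fin b)]
    refine finsum_congr fun p => ?_
    rw [← map_add]
    rfl
  map_smul' c a := by
    rw [RingHom.id_apply, smul_finsum]
    refine finsum_congr fun p => ?_
    rw [← map_smul]
    rfl

lemma RightTensorRep.toHom_matrixEmb (π : RightTensorRep K B) (n m : ℕ) (a : K m n) :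
    π.toHom (matrixEmb K n m a) = π n m a := by
  refine (finsum_eq_single _ (n, m) fun p hp => ?_).trans ?_
  · have : (⟨(matrixEmb K n m a : T.Mat) p.1 p.2, (matrixEmb K n m a).2.1 p.1 p.2⟩ : K p.2 p.1)
        = 0 := Subtype.ext <| single_apply_of_ne (a : T.Hom m n) <| by
      by_contra hc
      rw [not_or, not_not, not_not] at hc
      exact hp (Prod.ext hc.1 hc.2)
    rw [this, map_zero]
  · have : (⟨(matrixEmb K n m a : T.Mat) n m, (matrixEmb K n m a).2.1 n m⟩ : K m n) = a :=
      Subtype.ext (single_apply_same n m (a : T.Hom m n))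
    rw [this]

lemma RightTensorRep.toHom_star (π : RightTensorRep K B) (a : MatrixAlgebra K) :
    π.toHom (star a) = star (π.toHom a) := by
  induction a using matrixAlgebra_induction with
  | h0 => rw [star_zero, map_zero, star_zero]
  | hadd a b ha hb => rw [star_add, map_add, map_add, star_add, ha, hb]
  | hemb n m a =>
    rw [← (isStarAlgebraWithRep K).emb_adj, toHom_matrixEmb, toHom_matrixEmb, π.map_adj]

/-- By bilinearity only one-entry matrices matter. The defining relation covers the case where the
second row index is at least the first column index, and taking adjoints gives the other case. -/
lemma RightTensorRep.toHom_mul (π : RightTensorRep K B) (a b : MatrixAlgebra K) :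
    π.toHom (a * b) = π.toHom a * π.toHom b := by
  have key : ∀ (n m k l : ℕ) (a : K m n) (b : K l (m + k)),
      π.toHom (matrixEmb K n m a * matrixEmb K (m + k) l b)
        = π.toHom (matrixEmb K n m a) * π.toHom (matrixEmb K (m + k) l b) := by
    intro n m k l a b
    rw [(isStarAlgebraWithRep K).emb_tensor, toHom_matrixEmb, toHom_matrixEmb, toHom_matrixEmb,
      π.map_tensor]
  induction a using matrixAlgebra_induction with
  | h0 => rw [zero_mul, map_zero, zero_mul]
  | hadd a a' ha ha' => rw [add_mul, map_add, map_add, add_mul, ha, ha']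
  | hemb n m a =>
    induction b using matrixAlgebra_induction with
    | h0 => rw [mul_zero, map_zero, mul_zero]
    | hadd b b' hb hb' => rw [mul_add, map_add, map_add, mul_add, hb, hb']
    | hemb m' l b =>
      rcases le_total m m' with h | h
      · obtain ⟨k, rfl⟩ := Nat.exists_eq_add_of_le h
        exact key n m k l a b
      · obtain ⟨k, rfl⟩ := Nat.exists_eq_add_of_le h
        rw [← star_star (matrixEmb K n (m' + k) a * matrixEmb K m' l b), star_mul,
          ← (isStarAlgebraWithRep K).emb_adj, ← (isStarAlgebraWithRep K).emb_adj,
          π.toHom_star, key, star_mul, ← π.toHom_star, ← π.toHom_star,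
          (isStarAlgebraWithRep K).emb_adj, (isStarAlgebraWithRep K).emb_adj, star_star, star_star]

/-- If all sums `∑_{k ≥ 0} Λ^k(a)_{s,t}` with `s < n` belong to `J`, then a representation that is
coisometric on `J` sees only the sum at `(n, m)`. -/
lemma RightTensorRep.toHom_eq (hJ : ∀ m n : ℕ, J m n ≤ tensorIdeal K m n) {π : RightTensorRep K B}
    (hπ : π.IsCoisometricOn J) : ∀ {m n : ℕ} {a : MatrixAlgebra K}, a ∈ homogeneous K m n →
      (∀ s t, s < n → t + n = s + m → shiftSum 0 (a : T.Mat) s t ∈ J t s) →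
      ∃ h : shiftSum 0 (a : T.Mat) n m ∈ K m n, π.toHom a = π n m ⟨_, h⟩ := by
  -- When m or n is zero the truncated diagonal consists of the single position (n, m).
  have edge : ∀ {m n : ℕ} {a : MatrixAlgebra K}, a ∈ homogeneous K m n → m = 0 ∨ n = 0 →
      shiftSum 0 (a : T.Mat) n m = (a : T.Mat) n m →
      ∃ h : shiftSum 0 (a : T.Mat) n m ∈ K m n, π.toHom a = π n m ⟨_, h⟩ := by
    intro m n a ha hmn hsum
    have ea : a = matrixEmb K n m ⟨(a : T.Mat) n m, a.2.1 n m⟩ := by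
      ext s t
      change (a : T.Mat) s t = (Pi.single n (Pi.single m ((a : T.Mat) n m)) : T.Mat) s t
      by_cases h : s = n ∧ t = m
      · obtain ⟨rfl, rfl⟩ := h
        rw [single_apply_same]
      · rw [single_apply_of_ne _ (by omega)]
        by_contra hne
        have := ha s t hne
        omega
    refine ⟨hsum ▸ a.2.1 n m, ?_⟩
    conv_lhs => rw [ea, toHom_matrixEmb]
    exact congrArg _ (Subtype.ext hsum.symm)
  intro m n
  induction n generalizing m with
  | zero => exact fun ha _ => edge ha (Or.inr rfl) (shiftSum_zero_row _ _)
  | succ n ih =>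
    rcases m with _ | m
    · exact fun ha _ => edge ha (Or.inl rfl) (shiftSum_zero_col _ _)
    intro a ha hs
    -- Removing the last entry leaves a matrix in M(m, n) with the same sums above row n + 1. By
    -- induction its image is the value of π at the sum x at (n, m). Since x is in J, coisometry
    -- replaces x by x ⊗ 1, and adding the removed entry gives the sum at (n + 1, m + 1).
    set e := matrixEmb K (n + 1) (m + 1) ⟨(a : T.Mat) (n + 1) (m + 1), a.2.1 _ _⟩ with he
    have hsub : ∀ s t, s < n + 1 → shiftSum 0 ((a - e : MatrixAlgebra K) : T.Mat) s t
        = shiftSum 0 (a : T.Mat) s t := by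
      intro s t hs
      have h := MatrixAlgebra.shiftSum_coe_add (a - e) e
      rw [sub_add_cancel] at h
      rw [h]
      change _ = _ + shiftSum 0 (e : T.Mat) s t
      rw [he, shiftSum_matrixEmb_of_lt _ _ _ t hs, add_zero]
    have hmem : a - e ∈ homogeneous K m n := by
      intro i j hne
      have h1 : (e : T.Mat) (n + 1) (m + 1) = (a : T.Mat) (n + 1) (m + 1) := single_apply_same _ _ _
      have h2 : (i, j) ≠ (n + 1, m + 1) := by
        intro h
        obtain ⟨rfl, rfl⟩ := Prod.mk.inj h
        exact hne (sub_eq_zero.2 h1.symm)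
      have h3 : (e : T.Mat) i j = 0 := single_apply_of_ne _ <| by
        by_contra hc
        rw [not_or, not_not, not_not] at hc
        exact h2 (Prod.ext hc.1 hc.2)
      have h4 : (a : T.Mat) i j ≠ 0 := fun h => hne <| by
        change (a : T.Mat) i j - (e : T.Mat) i j = 0
        rw [h, h3, sub_zero]
      have h5 := ha i j h4
      have h6 : i ≠ n + 1 := fun h => h2 (Prod.ext h (by dsimp only; omega))
      omega
    obtain ⟨h, hπe⟩ := ih hmem fun s t hsn hst => by
      rw [hsub s t (by omega)]
      exact hs s t (by omega) (by omega)
    have hJmem := hs n m (Nat.lt_succ_self n) (by omega)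
    have hKmem : T.tensor (shiftSum 0 (a : T.Mat) n m) ∈ K (m + 1) (n + 1) := (hJ m n hJmem).1
    have hsum := shiftSum_zero_succ_succ (a : T.Mat) n m
    have hfin : shiftSum 0 (a : T.Mat) (n + 1) (m + 1) ∈ K (m + 1) (n + 1) := by
      rw [hsum]
      exact Submodule.add_mem _ (a.2.1 _ _) hKmem
    refine ⟨hfin, ?_⟩
    have e1 : π.toHom a = π.toHom (a - e) + π.toHom e := by rw [← map_add, sub_add_cancel]
    have e2 : π n m ⟨_, h⟩ = π n m ⟨_, (hJ m n hJmem).2⟩ :=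
      congrArg _ (Subtype.ext (hsub n m (Nat.lt_succ_self n)))
    rw [e1, hπe, e2, hπ n m _ hJmem (hJ m n hJmem).2 hKmem, he, toHom_matrixEmb, ← map_add]
    refine congrArg _ (Subtype.ext ?_)
    change T.tensor (shiftSum 0 (a : T.Mat) n m) + (a : T.Mat) (n + 1) (m + 1) = _
    exact (add_comm _ _).trans hsum.symm

lemma RightTensorRep.norm_toHom_le (hJ : ∀ m n : ℕ, J m n ≤ tensorIdeal K m n)
    {π : RightTensorRep K B} (hπ : π.IsCoisometricOn J) (a : MatrixAlgebra K) :
    ‖π.toHom a‖ ≤ matNorm J (a : T.Mat) := by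
  refine norm_le_matNorm_of_null hJ π.toHom_mul π.toHom_star (fun m n a ha h => ?_) a
  obtain ⟨h1, h2⟩ := toHom_eq hJ hπ ha fun s t hs hst => by
    rw [← J.norm_mkQ_eq_zero]
    exact le_antisymm ((norm_mkQ_shiftSum_le_homNorm J _ hs (by omega) hst).trans h.le)
      (norm_nonneg _)
  have h3 : shiftSum 0 (a : T.Mat) n m = 0 :=
    norm_le_zero_iff.1 ((norm_shiftSum_le_homNorm J m n _).trans h.le)
  rw [h2, show (⟨_, h1⟩ : K m n) = 0 from Subtype.ext h3, map_zero]

/-- The universal property of the enveloping C*-algebra. -/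
theorem IsEnvelopingCStarAlgebra.existsUnique_lift {O : Type v} [NonUnitalCStarAlgebra O]
    {Φ : MatrixAlgebra K →ₗ[ℂ] O}
    (hΦ : IsEnvelopingCStarAlgebra (fun a : MatrixAlgebra K => matNorm J (a : T.Mat)) Φ)
    (hJ : ∀ m n : ℕ, J m n ≤ tensorIdeal K m n) (π : RightTensorRep K B)
    (hπ : π.IsCoisometricOn J) :
    ∃! ψ : O →⋆ₙₐ[ℂ] B, ∀ (n m : ℕ) (a : K m n), ψ (Φ (matrixEmb K n m a)) = π n m a := by
  obtain ⟨ψ, hψ⟩ := exists_starAlgHom_extension hΦ.map_mul hΦ.map_star hΦ.denseRange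
    π.toHom_mul π.toHom_star (hΦ.maximal (mapSeminorm π.toHom)
      (isCStarSeminorm_mapSeminorm _ π.toHom_mul π.toHom_star) fun a ha =>
        le_antisymm ((RightTensorRep.norm_toHom_le hJ hπ a).trans_eq ha) (norm_nonneg _))
  refine ⟨ψ, fun n m a => by rw [hψ, π.toHom_matrixEmb], fun ψ' hψ' => ?_⟩
  refine starAlgHom_eq_of_denseRange hΦ.denseRange fun a => ?_
  induction a using matrixAlgebra_induction with
  | h0 => simp only [map_zero]
  | hadd a b ha hb => simp only [map_add, ha, hb]
  | hemb n m a => rw [hψ', hψ, π.toHom_matrixEmb]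

lemma adjoin_topologicalClosure_eq_top {O : Type v} [NonUnitalCStarAlgebra O]
    {Φ : MatrixAlgebra K →ₗ[ℂ] O} (hd : DenseRange Φ) :
    (NonUnitalStarAlgebra.adjoin ℂ
      (⋃ (n : ℕ) (m : ℕ), Set.range (Φ ∘ₗ matrixEmb K n m))).topologicalClosure = ⊤ := by
  refine eq_top_iff.2 fun x _ => ?_
  have h : Set.range Φ ⊆ (NonUnitalStarAlgebra.adjoin ℂ
      (⋃ (n : ℕ) (m : ℕ), Set.range (Φ ∘ₗ matrixEmb K n m)) : Set O) := by
    rintro _ ⟨a, rfl⟩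
    induction a using matrixAlgebra_induction with
    | h0 => rw [map_zero]; exact zero_mem _
    | hadd a b ha hb => rw [map_add]; exact add_mem ha hb
    | hemb n m a =>
      exact NonUnitalStarAlgebra.subset_adjoin ℂ _
        (Set.mem_iUnion.2 ⟨n, Set.mem_iUnion.2 ⟨m, a, rfl⟩⟩)
  exact closure_mono h (hd x)

end Representations

end RightTensorCStarPrecategory

/-! ### Positivity -/

/-- Take w = z₋ and v = (z₋)^{3/2}; then w z w = −(z₋)³. The condition v = 0 forces the spectrum to
be non-negative, and b is then the square root of z. -/
lemma exists_cfc_negative_part {A : Type u} [NonUnitalCStarAlgebra A] (z : A)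
    (hz : IsSelfAdjoint z) :
    ∃ w v : A, IsSelfAdjoint w ∧ w * z * w + star v * v = 0 ∧
      (v = 0 → ∃ b : A, z = star b * b) := by
  let f : ℝ → ℝ := fun t => max (-t) 0
  let g : ℝ → ℝ := fun t => Real.sqrt (f t ^ 3)
  have hf : Continuous f := by fun_prop
  have hf0 : f 0 = 0 := by simp [f]
  have hg : Continuous g := by fun_prop
  have hg0 : g 0 = 0 := by simp [g, hf0]
  have hfn : ∀ t, 0 ≤ f t := fun t => le_max_right _ _
  refine ⟨cfcₙ f z, cfcₙ g z, cfcₙ_predicate f z, ?_, fun h0 => ?_⟩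
  · have h1 : cfcₙ f z * z * cfcₙ f z = cfcₙ (fun t => f t * t * f t) z := by
      rw [cfcₙ_mul (fun t => f t * t) f z (by fun_prop) (by simp) hf.continuousOn hf0,
        cfcₙ_mul f (fun t : ℝ => t) z hf.continuousOn hf0 continuous_id.continuousOn rfl,
        cfcₙ_id' ℝ z hz]
    have h2 : star (cfcₙ g z) * cfcₙ g z = cfcₙ (fun t => g t * g t) z := by
      rw [cfcₙ_mul g g z hg.continuousOn hg0 hg.continuousOn hg0,
        (show IsSelfAdjoint (cfcₙ g z) from cfcₙ_predicate g z).star_eq]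
    rw [h1, h2, ← cfcₙ_add (fun t => f t * t * f t) (fun t => g t * g t) z (by fun_prop)
      (by simp) (by fun_prop) (by simp [hg0])]
    rw [← cfcₙ_zero ℝ z]
    congr 1
    funext t
    simp only [g, Real.mul_self_sqrt (pow_nonneg (hfn t) 3)]
    simp only [f]
    rcases le_total 0 t with ht | ht
    · rw [max_eq_right (by linarith)]; simp
    · rw [max_eq_left (by linarith)]; simp; ring
  · rw [← cfcₙ_zero ℝ z] at h0
    have h1 : (quasispectrum ℝ z).EqOn g 0 :=
      (cfcₙ_eq_cfcₙ_iff_eqOn (ha := hz) (hf := hg.continuousOn) (hf0 := hg0)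
        (hg := continuous_const.continuousOn) (hg0 := rfl)).1 h0
    have h2 : ∀ t ∈ quasispectrum ℝ z, 0 ≤ t := by
      intro t ht
      have h3 := h1 ht
      by_contra hneg
      have h4 : 0 < f t := lt_max_of_lt_left (by linarith)
      exact (Real.sqrt_pos.2 (pow_pos h4 3)).ne' h3
    refine ⟨cfcₙ Real.sqrt z, ?_⟩
    rw [(show IsSelfAdjoint (cfcₙ Real.sqrt z) from cfcₙ_predicate _ z).star_eq,
      ← cfcₙ_mul Real.sqrt Real.sqrt z (by fun_prop) (by simp) (by fun_prop) (by simp)]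
    conv_lhs => rw [← cfcₙ_id' ℝ z hz]
    exact cfcₙ_congr fun t ht => (Real.mul_self_sqrt (h2 t ht)).symm

namespace RightTensorCStarPrecategory

open CStarPrecategory Mat

variable {T : RightTensorCStarPrecategory.{u}} {K J : T.CStarIdeal}
  {S : RightTensorCStarPrecategory.{u}} {Q : ∀ m n : ℕ, homogeneous K m n →ₗ[ℂ] S.Hom m n}

lemma IsHomogeneousQuotient.norm_sq_le (hQ : IsHomogeneousQuotient K J S Q) (hT : T.IsPositive)
    {m n : ℕ} (y : S.Hom m n) (v : S.Hom m m) :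
    ‖y‖ ^ 2 ≤ ‖S.comp (S.adj y) y + S.comp (S.adj v) v‖ := by
  obtain ⟨a, rfl⟩ := hQ.surjective m n y
  obtain ⟨b, rfl⟩ := hQ.surjective m m v
  have h := homNorm_sq_le_of_isPositive J hT a.2 b.2
  rw [← hQ.map_star m n a ⟨_, hQ.star_mem m n a⟩ rfl,
    ← hQ.map_star m m b ⟨_, hQ.star_mem m m b⟩ rfl,
    ← hQ.map_mul m n m _ _ ⟨_, hQ.mul_mem m n m ⟨_, hQ.star_mem m n a⟩ a⟩ rfl,
    ← hQ.map_mul m m m _ _ ⟨_, hQ.mul_mem m m m ⟨_, hQ.star_mem m m b⟩ b⟩ rfl,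
    ← map_add, hQ.norm_map, hQ.norm_map]
  exact h

/-- For z = x*x and y = xw with w the negative part of z, one has y*y + v*v = 0, so the norm
inequality gives y = 0. Then v = 0, and z has no negative part. -/
theorem IsHomogeneousQuotient.isPositive (hQ : IsHomogeneousQuotient K J S Q)
    (hT : T.IsPositive) : S.IsPositive := by
  intro m n x
  let _ := S.endAlgebra m
  obtain ⟨w, v, hw, hwv, hv⟩ := exists_cfc_negative_part (S.comp (S.adj x) x)
    (show S.adj (S.comp (S.adj x) x) = _ by rw [S.adj_comp, S.adj_adj])
  refine hv ?_
  have hw' : S.adj w = w := hw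
  have e1 : S.comp (S.adj (S.comp x w)) (S.comp x w) = w * S.comp (S.adj x) x * w := by
    rw [S.adj_comp, hw', ← S.comp_assoc, S.comp_assoc w]
    rfl
  have h1 := hQ.norm_sq_le hT (S.comp x w) v
  rw [e1] at h1
  have h2 : ‖S.comp x w‖ ^ 2 ≤ 0 := h1.trans_eq (norm_eq_zero.2 hwv)
  have h3 : S.comp x w = 0 := norm_eq_zero.1 (pow_eq_zero_iff two_ne_zero |>.1
    (le_antisymm h2 (sq_nonneg _)))
  rw [← e1, h3, S.comp_zero, zero_add] at hwv
  exact CStarRing.star_mul_self_eq_zero_iff v |>.1 hwv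

end RightTensorCStarPrecategory

namespace RightTensorCStarPrecategory

/-! ### C*-seminorms defined by left multiplication -/

/-- The sequence is log-convex, so its successive ratios are at least the first one ρ. It then grows
at least like ρ^n, which contradicts the bound C r^n if ρ > r. -/
lemma le_mul_of_sq_le_mul_of_le_pow {u : ℕ → ℝ} {r C : ℝ} (hr : 0 ≤ r) (hu : ∀ n, 0 ≤ u n)
    (hconv : ∀ n, u (n + 1) ^ 2 ≤ u n * u (n + 2)) (hC : ∀ n, u n ≤ C * r ^ n) :
    u 1 ≤ r * u 0 := by
  by_contra! hlt
  have h1 : 0 < u 1 := (mul_nonneg hr (hu 0)).trans_lt hlt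
  have h0 : 0 < u 0 := (hu 0).lt_of_ne' fun h => by
    have := hconv 0
    rw [h, zero_mul] at this
    exact absurd this (not_le.2 (pow_pos h1 2))
  set ρ := u 1 / u 0 with hρ
  have hρ0 : 0 < ρ := div_pos h1 h0
  have hrρ : r < ρ := (lt_div_iff₀ h0).2 hlt
  have step : ∀ n, 0 < u n ∧ ρ * u n ≤ u (n + 1) := by
    intro n
    induction n with
    | zero => exact ⟨h0, (div_mul_cancel₀ _ h0.ne').le⟩
    | succ n ih =>
      have h2 : 0 < u (n + 1) := (mul_pos hρ0 ih.1).trans_le ih.2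
      refine ⟨h2, le_of_mul_le_mul_left ?_ ih.1⟩
      calc u n * (ρ * u (n + 1)) = (ρ * u n) * u (n + 1) := by ring
        _ ≤ u (n + 1) * u (n + 1) := mul_le_mul_of_nonneg_right ih.2 h2.le
        _ = u (n + 1) ^ 2 := (sq _).symm
        _ ≤ _ := hconv n
  have hpow : ∀ n, ρ ^ n * u 0 ≤ u n := by
    intro n
    induction n with
    | zero => simp
    | succ n ih =>
      calc ρ ^ (n + 1) * u 0 = ρ * (ρ ^ n * u 0) := by ring
        _ ≤ ρ * u n := mul_le_mul_of_nonneg_left ih hρ0.le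
        _ ≤ _ := (step n).2
  have hlim : Tendsto (fun n => C * (r / ρ) ^ n) atTop (𝓝 0) := by
    have := (tendsto_pow_atTop_nhds_zero_of_lt_one (div_nonneg hr hρ0.le)
      ((div_lt_one hρ0).2 hrρ)).const_mul C
    rwa [mul_zero] at this
  refine h0.not_ge (ge_of_tendsto' hlim fun n => ?_)
  rw [div_pow, ← mul_div_assoc, le_div_iff₀ (pow_pos hρ0 n), mul_comm]
  exact (hpow n).trans (hC n)

section Form

variable {A : Type u} [NonUnitalRing A] [StarRing A] [Module ℂ A]

/-- For self-adjoint t, the sequence q(t^n x) is log-convex by the Cauchy–Schwarz hypothesis and is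
bounded by N(x) N(t)^n, which gives the bound with constant N(t). The general case follows from t =
a*a. -/
lemma apply_mul_le_of_form {N q : Seminorm ℂ A} (hNmul : ∀ a b, N (a * b) ≤ N a * N b)
    (hNstar : ∀ a, N (star a) = N a) (hqN : ∀ x, q x ≤ N x)
    (hq : ∀ a x, q (a * x) ^ 2 ≤ q x * q (star a * (a * x))) (a x : A) :
    q (a * x) ≤ N a * q x := by
  have key : ∀ t : A, star t = t → q (t * x) ≤ N t * q x := by
    intro t ht
    refine le_mul_of_sq_le_mul_of_le_pow (u := fun n => q ((fun y => t * y)^[n] x)) (C := N x)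
      (apply_nonneg _ _) (fun n => apply_nonneg _ _) (fun n => ?_) (fun n => ?_)
    · simp only [Function.iterate_succ_apply']
      refine (hq t _).trans_eq ?_
      rw [ht]
    · refine (hqN _).trans ?_
      induction n with
      | zero => simp
      | succ n ih =>
        rw [Function.iterate_succ_apply', pow_succ, mul_comm (N t ^ n), mul_left_comm]
        exact (hNmul _ _).trans (mul_le_mul_of_nonneg_left ih (apply_nonneg _ _))
  refine (abs_le_of_sq_le_sq' ?_ (mul_nonneg (apply_nonneg _ _) (apply_nonneg _ _))).2
  have h1 := key (star a * a) (by rw [star_mul, star_star])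
  have h2 : N (star a * a) ≤ N a * N a := (hNmul _ _).trans_eq (by rw [hNstar])
  rw [mul_assoc] at h1
  calc q (a * x) ^ 2 ≤ q x * q (star a * (a * x)) := hq a x
    _ ≤ q x * ((N a * N a) * q x) := by
      refine mul_le_mul_of_nonneg_left (h1.trans ?_) (apply_nonneg _ _)
      exact mul_le_mul_of_nonneg_right h2 (apply_nonneg _ _)
    _ = (N a * q x) ^ 2 := by ring

/-- The operator seminorm of the left multiplications is a C*-seminorm. -/
theorem exists_isCStarSeminorm_of_form [IsScalarTower ℂ A A] {N q : Seminorm ℂ A}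
    (hNmul : ∀ a b, N (a * b) ≤ N a * N b)
    (hNstar : ∀ a, N (star a) = N a) (hqN : ∀ x, q x ≤ N x)
    (hq : ∀ a x, q (a * x) ^ 2 ≤ q x * q (star a * (a * x))) :
    ∃ p : Seminorm ℂ A, IsCStarSeminorm p ∧ (∀ a, p a ≤ N a) ∧
      ∀ a x, q (a * x) ≤ p a * q x := by
  let F : A → Set ℝ := fun a => {C | 0 ≤ C ∧ ∀ x, q (a * x) ≤ C * q x}
  let f : A → ℝ := fun a => sInf (F a)
  have hmem : ∀ a, N a ∈ F a := fun a =>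
    ⟨apply_nonneg _ _, apply_mul_le_of_form hNmul hNstar hqN hq a⟩
  have hbdd : ∀ a, BddBelow (F a) := fun a => ⟨0, fun C hC => hC.1⟩
  have hle : ∀ a C, 0 ≤ C → (∀ x, q (a * x) ≤ C * q x) → f a ≤ C := fun a C h0 h =>
    csInf_le (hbdd a) ⟨h0, h⟩
  have hf0 : ∀ a, 0 ≤ f a := fun a => le_csInf ⟨_, hmem a⟩ fun C hC => hC.1
  have hf : ∀ a x, q (a * x) ≤ f a * q x := by
    intro a x
    rcases (apply_nonneg q x).eq_or_lt with h | h
    · have := (hmem a).2 x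
      rwa [← h, mul_zero] at this ⊢
    · rw [← div_le_iff₀ h]
      exact le_csInf ⟨_, hmem a⟩ fun C hC => (div_le_iff₀ h).2 (hC.2 x)
  have hmul : ∀ a b, f (a * b) ≤ f a * f b := fun a b =>
    hle _ _ (mul_nonneg (hf0 a) (hf0 b)) fun x => by
      rw [mul_assoc, mul_assoc]
      exact (hf a _).trans (mul_le_mul_of_nonneg_left (hf b x) (hf0 a))
  have hsq : ∀ a, f a ^ 2 ≤ f (star a * a) := by
    intro a
    have : f a ≤ Real.sqrt (f (star a * a)) := by
      refine hle _ _ (Real.sqrt_nonneg _) fun x => ?_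
      refine (abs_le_of_sq_le_sq' ?_ (mul_nonneg (Real.sqrt_nonneg _) (apply_nonneg _ _))).2
      rw [mul_pow, Real.sq_sqrt (hf0 _)]
      calc q (a * x) ^ 2 ≤ q x * q (star a * (a * x)) := hq a x
        _ ≤ q x * (f (star a * a) * q x) := by
          rw [← mul_assoc (star a)]
          exact mul_le_mul_of_nonneg_left (hf _ x) (apply_nonneg _ _)
        _ = f (star a * a) * q x ^ 2 := by ring
    calc f a ^ 2 ≤ Real.sqrt (f (star a * a)) ^ 2 := pow_le_pow_left₀ (hf0 a) this 2
      _ = _ := Real.sq_sqrt (hf0 _)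
  have hstar : ∀ a, f a ≤ f (star a) := by
    intro a
    rcases (hf0 a).eq_or_lt with h | h
    · rw [← h]; exact hf0 _
    · have h1 := (hsq a).trans (hmul _ _)
      rw [sq] at h1
      exact le_of_mul_le_mul_right h1 h
  refine ⟨Seminorm.ofSMulLE f ?_ ?_ ?_, ⟨hmul, fun a => ?_⟩, fun a => ?_, hf⟩
  · exact le_antisymm (hle 0 0 le_rfl fun x => by rw [zero_mul, map_zero, zero_mul]) (hf0 0)
  · refine fun a b => hle _ _ (add_nonneg (hf0 a) (hf0 b)) fun x => ?_
    rw [add_mul, add_mul]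
    exact (map_add_le_add q _ _).trans (add_le_add (hf a x) (hf b x))
  · refine fun c a => hle _ _ (mul_nonneg (norm_nonneg _) (hf0 a)) fun x => ?_
    rw [smul_mul_assoc, map_smul_eq_mul, mul_assoc]
    exact mul_le_mul_of_nonneg_left (hf a x) (norm_nonneg _)
  · refine le_antisymm ((hmul _ _).trans ?_) (hsq a)
    change f (star a) * f a ≤ f a ^ 2
    rw [sq]
    refine mul_le_mul_of_nonneg_right ?_ (hf0 a)
    have := hstar (star a)
    rwa [star_star] at this
  · exact hle a _ (hmem a).1 (hmem a).2

variable {D : Type v} [NonUnitalCStarAlgebra D] [PartialOrder D] [StarOrderedRing D]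
  [IsScalarTower ℂ A A] [SMulCommClass ℂ A A] [StarModule ℂ A]

/-- Cauchy–Schwarz for a D-valued form when A is not a D-module: the element c of `hmod` replaces
right multiplication by E(y*x). -/
lemma norm_form_sq_le {E : A →ₗ[ℂ] D} (hstar : ∀ x, E (star x) = star (E x))
    (hpos : ∀ x, 0 ≤ E (star x * x))
    (hmod : ∀ z, ∃ c, ∀ x, E (x * c) = E x * E z) (x y : A) :
    ‖E (star y * x)‖ ^ 2 ≤ ‖E (star y * y)‖ * ‖E (star x * x)‖ := by
  obtain ⟨c, hc⟩ := hmod (star y * x)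
  set e := E (star y * x) with he
  have hc' : ∀ z, E (star c * z) = star e * E z := by
    intro z
    rw [← star_star (star c * z), hstar, star_mul, star_star, hc, star_mul, hstar, star_star]
  have hxy : E (star x * y) = star e := by
    rw [he, ← hstar, star_mul, star_star]
  have key : ∀ t : ℝ, ‖E (star y * y)‖ < t → ‖e‖ ^ 2 ≤ t * ‖E (star x * x)‖ := by
    intro t ht
    have ht0 : 0 < t := (norm_nonneg _).trans_lt ht
    -- Expansion gives t² E(x*x) − 2t e*e + e* E(y*y) e ≥ 0. As E(y*y) is bounded by t, this leaves
    -- t e*e ≤ t² E(x*x). The strict inequality for t allows division by it, and t finally decreases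
    -- to ‖E(y*y)‖.
    have h1 := hpos ((t : ℂ) • x - y * c)
    have h2 : E (star ((t : ℂ) • x - y * c) * ((t : ℂ) • x - y * c))
        = t ^ 2 • E (star x * x) - (2 * t) • (star e * e) + star e * E (star y * y) * e := by
      have e1 : star ((t : ℂ) • x - y * c) * ((t : ℂ) • x - y * c)
          = ((t : ℂ) * t) • (star x * x) - (t : ℂ) • ((star x * y) * c)
            - (t : ℂ) • (star c * (star y * x)) + star c * ((star y * y) * c) := by
        rw [star_sub, star_smul, star_mul, RCLike.star_def, Complex.conj_ofReal]
        simp only [sub_mul, mul_sub, smul_mul_assoc, mul_smul_comm, mul_assoc, smul_sub, smul_smul]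
        abel
      rw [e1, map_add, map_sub, map_sub, map_smul, map_smul, map_smul, hc, hc', hc', hc, hxy, ← he,
        ← Complex.ofReal_mul, Complex.coe_smul, Complex.coe_smul, two_mul t, add_smul, sq,
        mul_assoc]
      abel
    rw [h2] at h1
    have h3 : star e * E (star y * y) * e ≤ t • (star e * e) := by
      refine (CStarAlgebra.star_left_conjugate_le_norm_smul (IsSelfAdjoint.of_nonneg (hpos y))).trans ?_
      exact smul_le_smul_of_nonneg_right ht.le (star_mul_self_nonneg e)
    have h4 : t • (star e * e) ≤ t ^ 2 • E (star x * x) := by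
      rw [two_mul t, add_smul] at h1
      have h5 := h1.trans (add_le_add_right h3 _)
      rw [← sub_nonneg]
      refine h5.trans_eq ?_
      abel
    have h6 := CStarAlgebra.norm_le_norm_of_nonneg_of_le
      (smul_nonneg ht0.le (star_mul_self_nonneg e)) h4
    rw [norm_smul, norm_smul, CStarRing.norm_star_mul_self, Real.norm_of_nonneg ht0.le,
      Real.norm_of_nonneg (sq_nonneg t), sq t, mul_assoc] at h6
    rw [sq]
    exact le_of_mul_le_mul_left h6 ht0
  refine ge_of_tendsto (x := 𝓝[>] ‖E (star y * y)‖)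
    (f := fun t => t * ‖E (star x * x)‖) ?_ (eventually_mem_nhdsWithin.mono key)
  exact (tendsto_id.mul_const _).mono_left nhdsWithin_le_nhds

/-- A positive `D`-valued conditional expectation on `A` defines a C*-seminorm. -/
theorem exists_isCStarSeminorm_of_expectation {N : Seminorm ℂ A}
    (hNmul : ∀ a b, N (a * b) ≤ N a * N b) (hNstar : ∀ a, N (star a) = N a)
    {E : A →ₗ[ℂ] D} (hE : ∀ x, ‖E x‖ ≤ N x) (hstar : ∀ x, E (star x) = star (E x))
    (hpos : ∀ x, 0 ≤ E (star x * x))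
    (hmod : ∀ z, ∃ c, ∀ x, E (x * c) = E x * E z) :
    ∃ p : Seminorm ℂ A, IsCStarSeminorm p ∧ (∀ a, p a ≤ N a) ∧
      ∀ a x, ‖E (star (a * x) * (a * x))‖ ≤ p a ^ 2 * ‖E (star x * x)‖ := by
  let f : A → ℝ := fun x => Real.sqrt ‖E (star x * x)‖
  have hf0 : ∀ x, 0 ≤ f x := fun x => Real.sqrt_nonneg _
  have hfsq : ∀ x, f x ^ 2 = ‖E (star x * x)‖ := fun x => Real.sq_sqrt (norm_nonneg _)
  have hcs : ∀ x y, ‖E (star y * x)‖ ≤ f y * f x := fun x y => by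
    refine (abs_le_of_sq_le_sq' ?_ (mul_nonneg (hf0 _) (hf0 _))).2
    rw [mul_pow, hfsq, hfsq]
    exact norm_form_sq_le hstar hpos hmod x y
  let q : Seminorm ℂ A := Seminorm.ofSMulLE f (by simp [f]) (fun x y => by
      refine (abs_le_of_sq_le_sq' ?_ (add_nonneg (hf0 _) (hf0 _))).2
      rw [hfsq, star_add, add_mul, mul_add, mul_add, map_add, map_add, map_add]
      refine (norm_add_le _ _).trans ?_
      have h1 := norm_add_le (E (star x * x)) (E (star x * y))
      have h2 := norm_add_le (E (star y * x)) (E (star y * y))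
      have h3 := hcs y x
      have h4 := hcs x y
      have h5 := hfsq x
      have h6 := hfsq y
      nlinarith) (fun c x => by
      refine (abs_le_of_sq_le_sq' (le_of_eq ?_) (mul_nonneg (norm_nonneg _) (hf0 _))).2
      rw [hfsq, mul_pow, hfsq, star_smul, smul_mul_smul_comm, map_smul, norm_smul, norm_mul,
        norm_star, sq])
  obtain ⟨p, hp, hpN, hpq⟩ := exists_isCStarSeminorm_of_form (q := q) hNmul hNstar
    (fun x => by
      refine (abs_le_of_sq_le_sq' ?_ (apply_nonneg _ _)).2
      change f x ^ 2 ≤ _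
      rw [hfsq, sq]
      refine (hE _).trans ((hNmul _ _).trans_eq ?_)
      rw [hNstar])
    (fun a x => by
      change f (a * x) ^ 2 ≤ f x * f _
      rw [hfsq, star_mul, mul_assoc]
      exact hcs _ _)
  refine ⟨p, hp, hpN, fun a x => ?_⟩
  have h := pow_le_pow_left₀ (apply_nonneg q _) (hpq a x) 2
  change f (a * x) ^ 2 ≤ (p a * f x) ^ 2 at h
  rwa [mul_pow, hfsq, hfsq] at h

end Form

end RightTensorCStarPrecategory

namespace RightTensorCStarPrecategory

open CStarPrecategory Mat

variable {T : RightTensorCStarPrecategory.{u}} {K J : T.CStarIdeal}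

/-! ### The grading of `M_T(K)` -/

section Grading

lemma degPart_degPart (k : ℤ) (a : MatrixAlgebra K) :
    degPart K k (degPart K k a) = degPart K k a := by
  obtain ⟨m, n, hk, ha⟩ := exists_mem_degPart a k
  exact degPart_of_mem ha hk

lemma degPart_degPart_of_ne {j k : ℤ} (h : j ≠ k) (a : MatrixAlgebra K) :
    degPart K j (degPart K k a) = 0 := by
  obtain ⟨m, n, hk, ha⟩ := exists_mem_degPart a k
  exact degPart_of_mem_of_ne ha (hk.trans_ne h.symm)

lemma degPart_star (k : ℤ) (a : MatrixAlgebra K) :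
    degPart K k (star a) = star (degPart K (-k) a) := by
  ext i j
  rw [degPart_apply, MatrixAlgebra.coe_star, MatrixAlgebra.coe_star]
  change (if _ then T.adj ((a : T.Mat) j i) else 0) = T.adj ((degPart K (-k) a : T.Mat) j i)
  rw [degPart_apply]
  split_ifs with h1 h2 h2
  · rfl
  · omega
  · omega
  · rw [T.adj_zero]

lemma exists_mem_degPart₂ (a b : MatrixAlgebra K) (j k : ℤ) :
    ∃ l m n : ℕ, (m : ℤ) - n = j ∧ (l : ℤ) - m = k ∧
      degPart K j a ∈ homogeneous K m n ∧ degPart K k b ∈ homogeneous K l m := by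
  obtain ⟨R, hR⟩ := exists_degPart_mem a
  obtain ⟨R', hR'⟩ := exists_degPart_mem b
  obtain ⟨n, hn⟩ : ∃ n, n = R + R' + j.natAbs + k.natAbs := ⟨_, rfl⟩
  obtain ⟨m, hm⟩ : ∃ m : ℕ, (m : ℤ) - n = j := ⟨(n + j).toNat, by omega⟩
  obtain ⟨l, hl⟩ : ∃ l : ℕ, (l : ℤ) - m = k := ⟨(m + k).toNat, by omega⟩
  refine ⟨l, m, n, hm, hl, ?_, ?_⟩
  · rw [← hm]
    exact hR m n (by omega)
  · rw [← hl]
    exact hR' l m (by omega)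

lemma degPart_mul_degPart (j k : ℤ) (a b : MatrixAlgebra K) :
    degPart K (j + k) (degPart K j a * degPart K k b) = degPart K j a * degPart K k b := by
  obtain ⟨l, m, n, hj, hk, ha, hb⟩ := exists_mem_degPart₂ a b j k
  exact degPart_of_mem (mul_mem_homogeneous ha hb) (by omega)

lemma degPart_mul_degPart_of_ne {i j k : ℤ} (h : i ≠ j + k) (a b : MatrixAlgebra K) :
    degPart K i (degPart K j a * degPart K k b) = 0 := by
  rw [← degPart_mul_degPart, degPart_degPart_of_ne h]

/-- The degree-zero part is a module map over the block diagonal matrices; this supplies the element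
c required of an expectation. -/
lemma degPart_zero_mul_right (a b : MatrixAlgebra K) :
    degPart K 0 (a * degPart K 0 b) = degPart K 0 a * degPart K 0 b := by
  obtain ⟨F, hF⟩ := exists_degPart_eq_zero a
  have hG : ∀ k ∉ insert 0 F, degPart K k a = 0 := fun k hk =>
    hF k fun h => hk (Finset.mem_insert_of_mem h)
  conv_lhs => rw [← sum_degPart hG, Finset.sum_mul, map_sum]
  rw [Finset.sum_eq_single_of_mem 0 (Finset.mem_insert_self 0 F)]
  · exact degPart_mul_degPart 0 0 a b
  · exact fun k _ hk => degPart_mul_degPart_of_ne (by omega) a b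

/-- The product of the adjoint of a component of degree j with one of degree k has degree k − j, so
only the diagonal terms survive. -/
lemma degPart_zero_star_mul_self {a : MatrixAlgebra K} {F : Finset ℤ}
    (hF : ∀ k ∉ F, degPart K k a = 0) :
    degPart K 0 (star a * a) = ∑ k ∈ F, star (degPart K k a) * degPart K k a := by
  conv_lhs => rw [← sum_degPart hF, star_sum, Finset.sum_mul, map_sum]
  refine Finset.sum_congr rfl fun k hk => ?_
  have e : ∀ j, star (degPart K j a) = degPart K (-j) (star a) := fun j => by
    rw [degPart_star, neg_neg]
  rw [Finset.mul_sum, map_sum, Finset.sum_eq_single_of_mem k hk, e]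
  · have := degPart_mul_degPart (-k) k (star a) a
    rwa [neg_add_cancel] at this
  · intro j _ hj
    rw [e]
    exact degPart_mul_degPart_of_ne (by omega) _ _

variable (K) in
/-- The subalgebra of the block diagonal matrices. -/
def degreeZero : NonUnitalStarSubalgebra ℂ (MatrixAlgebra K) where
  carrier := {a | degPart K 0 a = a}
  add_mem' {a b} ha hb := by
    rw [Set.mem_ofPred_eq] at ha hb ⊢
    rw [map_add, ha, hb]
  zero_mem' := map_zero _
  smul_mem' c a ha := by
    rw [Set.mem_ofPred_eq] at ha ⊢
    rw [map_smul, ha]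
  mul_mem' {a b} ha hb := by
    rw [Set.mem_ofPred_eq] at ha hb ⊢
    have := degPart_zero_mul_right a b
    rwa [ha, hb] at this
  star_mem' {a} ha := by
    rw [Set.mem_ofPred_eq] at ha ⊢
    rw [degPart_star, neg_zero, ha]

lemma degPart_mem_degreeZero (a : MatrixAlgebra K) : degPart K 0 a ∈ degreeZero K :=
  degPart_degPart 0 a

lemma exists_mem_homogeneous_of_mem_degreeZero {a : MatrixAlgebra K} (ha : a ∈ degreeZero K) :
    ∃ n : ℕ, a ∈ homogeneous K n n := by
  obtain ⟨m, n, hk, h⟩ := exists_mem_degPart a 0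
  obtain rfl : m = n := by omega
  exact ⟨m, (show degPart K 0 a = a from ha) ▸ h⟩

variable (K J) in
/-- The seminorm `degreeNorm J 0` on the block diagonal matrices. -/
def degreeZeroSeminorm : Seminorm ℂ (degreeZero K) :=
  Seminorm.ofSMulLE (fun a => degreeNorm J 0 ((a : MatrixAlgebra K) : T.Mat))
    (degreeNorm_zero J 0) (fun a b => degreeNorm_add_le J 0 (a : MatrixAlgebra K) b)
    (fun c a => degreeNorm_smul_le J 0 c (a : MatrixAlgebra K))

lemma isCStarSeminorm_degreeZeroSeminorm : IsCStarSeminorm (degreeZeroSeminorm K J) where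
  mul_le a b := by
    obtain ⟨n, ha⟩ := exists_mem_homogeneous_of_mem_degreeZero a.2
    exact degreeNorm_mul_le J ha (b : MatrixAlgebra K) (i := 0) (j := 0) (l := n)
      (sub_self _) (sub_self _)
  star_mul_self a := by
    obtain ⟨n, ha⟩ := exists_mem_homogeneous_of_mem_degreeZero a.2
    exact degreeNorm_star_mul_self J ha (sub_self _)

end Grading

/-! ### The norms of the homogeneous elements of the enveloping C*-algebra -/

section HomogeneousNorm

/-- Positivity of K_J lifted to matrices: modulo null elements a*a equals b*b with b block diagonal,
so its image in the completion of the degree-zero part is positive. -/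
lemma IsHomogeneousQuotient.exists_star_mul_self {S : RightTensorCStarPrecategory.{u}}
    {Q : ∀ m n : ℕ, homogeneous K m n →ₗ[ℂ] S.Hom m n} (hQ : IsHomogeneousQuotient K J S Q)
    (hT : T.IsPositive) {m n : ℕ} {a : MatrixAlgebra K}
    (ha : a ∈ homogeneous K m n) :
    ∃ b ∈ homogeneous K m m,
      degreeNorm J 0 ((star a * a - star b * b : MatrixAlgebra K) : T.Mat) = 0 := by
  obtain ⟨y, hy⟩ := hQ.isPositive hT m n (Q m n ⟨a, ha⟩)
  obtain ⟨b, rfl⟩ := hQ.surjective m m y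
  refine ⟨b, b.2, ?_⟩
  rw [← hQ.map_star m n _ ⟨_, star_mem_homogeneous ha⟩ rfl,
    ← hQ.map_star m m b ⟨_, hQ.star_mem m m b⟩ rfl,
    ← hQ.map_mul m n m _ _ ⟨_, mul_mem_homogeneous (star_mem_homogeneous ha) ha⟩ rfl,
    ← hQ.map_mul m m m _ _ ⟨_, hQ.mul_mem m m m ⟨_, hQ.star_mem m m b⟩ b⟩ rfl,
    ← sub_eq_zero, ← map_sub, ← norm_eq_zero, hQ.norm_map] at hy
  refine le_antisymm ?_ (degreeNorm_nonneg J 0 _)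
  refine (degreeNorm_le_homNorm J (m := m) (n := m) ?_ (sub_self _)).trans hy.le
  exact Submodule.sub_mem _ (mul_mem_homogeneous (star_mem_homogeneous ha) ha)
    (mul_mem_homogeneous (star_mem_homogeneous b.2) b.2)

/-- If `T` is positive, then there is a C*-seminorm that agrees with `‖·‖_J` on the homogeneous
elements. -/
theorem exists_isCStarSeminorm_eq_matNorm (hT : T.IsPositive)
    (hJ : ∀ m n : ℕ, J m n ≤ tensorIdeal K m n) :
    ∃ p : Seminorm ℂ (MatrixAlgebra K), IsCStarSeminorm p ∧
      (∀ a : MatrixAlgebra K, p a ≤ matNorm J (a : T.Mat)) ∧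
      ∀ m n, ∀ a ∈ homogeneous K m n, matNorm J (a : T.Mat) ≤ p a := by
  obtain ⟨D, _, Φ, hmul, hstar, -, hn⟩ :=
    exists_cstar_completion (isCStarSeminorm_degreeZeroSeminorm (K := K) (J := J))
  let _ := CStarAlgebra.spectralOrder D
  have _ := CStarAlgebra.spectralOrderedRing D
  -- The expectation takes values in the C*-completion of the block diagonal matrices, on which
  -- `degreeNorm J 0` is already a C*-seminorm.
  let E : MatrixAlgebra K →ₗ[ℂ] D :=
    { toFun := fun x => Φ ⟨degPart K 0 x, degPart_mem_degreeZero x⟩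
      map_add' := fun x y => by
        rw [← map_add]
        exact congrArg Φ (Subtype.ext (map_add (degPart K 0) x y))
      map_smul' := fun c x => by
        rw [RingHom.id_apply, ← map_smul]
        exact congrArg Φ (Subtype.ext (map_smul (degPart K 0) c x)) }
  have hE : ∀ x y, (h : degPart K 0 x = y) → ∀ hy : y ∈ degreeZero K, E x = Φ ⟨y, hy⟩ := by
    rintro x _ rfl hy
    rfl
  have hEn : ∀ x, ‖E x‖ = degreeNorm J 0 (x : T.Mat) := fun x =>
    (hn _).trans (degreeNorm_degPart J 0 x)
  obtain ⟨p, hp, hpN, hpE⟩ := exists_isCStarSeminorm_of_expectation (N := matSeminorm K J)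
    (E := E) (matSeminorm_mul_le J) (matSeminorm_star J)
    (fun x => (hEn x).trans_le (degreeNorm_le_matNorm J x 0))
    (fun x => by
      rw [hE (star x) (star (degPart K 0 x)) (by rw [degPart_star, neg_zero])
        (star_mem (degPart_mem_degreeZero x))]
      exact hstar ⟨_, degPart_mem_degreeZero x⟩)
    (fun x => by
      obtain ⟨F, hF⟩ := exists_degPart_eq_zero x
      have hdeg : ∀ k, star (degPart K k x) * degPart K k x ∈ degreeZero K := fun k => by
        have := degPart_mul_degPart (-k) k (star x) x
        rwa [neg_add_cancel, degPart_star, neg_neg] at this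
      have e1 : E (star x * x) = ∑ k ∈ F, E (star (degPart K k x) * degPart K k x) := by
        rw [← map_sum, ← degPart_zero_star_mul_self hF]
        exact (hE _ _ (degPart_degPart 0 _) (degPart_mem_degreeZero _)).symm
      rw [e1]
      refine Finset.sum_nonneg fun k _ => ?_
      obtain ⟨m, n, hk, ha⟩ := exists_mem_degPart x k
      obtain ⟨b, hb, hab⟩ := (isHomogeneousQuotient hJ).exists_star_mul_self hT ha
      have e2 : E (star (degPart K k x) * degPart K k x) = E (star b * b) := by
        rw [← sub_eq_zero, ← map_sub, ← norm_eq_zero, hEn]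
        exact hab
      have hb0 : b ∈ degreeZero K := degPart_of_mem hb (sub_self _)
      rw [e2, hE _ _ (mul_mem (star_mem hb0) hb0 : star b * b ∈ degreeZero K)
        (mul_mem (star_mem hb0) hb0)]
      have e3 : Φ ⟨star b * b, mul_mem (star_mem hb0) hb0⟩ = star (Φ ⟨b, hb0⟩) * Φ ⟨b, hb0⟩ := by
        rw [← hstar, ← hmul]
        rfl
      rw [e3]
      exact star_mul_self_nonneg _)
    (fun z => ⟨degPart K 0 z, fun x => by
      rw [hE _ _ (degPart_zero_mul_right x z)
        (mul_mem (degPart_mem_degreeZero x) (degPart_mem_degreeZero z))]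
      exact hmul ⟨_, degPart_mem_degreeZero x⟩ ⟨_, degPart_mem_degreeZero z⟩⟩)
  refine ⟨p, hp, hpN, fun m n a ha => ?_⟩
  -- Testing left multiplication by a on the vector a*, the left side is ‖a‖_J⁴ and the right side
  -- is p(a)² ‖a‖_J².
  have h := hpE a (star a)
  have h1 := degreeNorm_star_mul_self J
    (mul_mem_homogeneous ha (star_mem_homogeneous ha)) (sub_self _)
  have h2 := degreeNorm_star_mul_self J (star_mem_homogeneous ha) (k := (n : ℤ) - m) rfl
  rw [star_star] at h2
  have h3 : degreeNorm J ((n : ℤ) - m) ((star a : MatrixAlgebra K) : T.Mat)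
      = matNorm J (a : T.Mat) := by
    rw [degreeNorm_star, neg_sub, matNorm_of_mem J ha rfl]
  rw [hEn, hEn, h1, star_star, h2, h3] at h
  rcases (apply_nonneg (matSeminorm K J) a).eq_or_lt with h0 | h0
  · rw [matSeminorm_apply] at h0
    rw [← h0]
    exact apply_nonneg _ _
  · rw [matSeminorm_apply] at h0
    have h4 : matNorm J (a : T.Mat) ^ 2 ≤ p a ^ 2 := by
      rw [sq (matNorm J (a : T.Mat) ^ 2)] at h
      exact le_of_mul_le_mul_right h (pow_pos h0 2)
    exact (abs_le_of_sq_le_sq' h4 (apply_nonneg _ _)).2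

/-- The norm of O is the largest admissible C*-seminorm, so it dominates the one built from the
expectation. -/
theorem IsEnvelopingCStarAlgebra.norm_eq_matNorm {O : Type v} [NonUnitalCStarAlgebra O]
    {Φ : MatrixAlgebra K →ₗ[ℂ] O}
    (hΦ : IsEnvelopingCStarAlgebra (fun a : MatrixAlgebra K => matNorm J (a : T.Mat)) Φ)
    (hle : ∀ a, ‖Φ a‖ ≤ matNorm J (a : T.Mat)) (hT : T.IsPositive)
    (hJ : ∀ m n : ℕ, J m n ≤ tensorIdeal K m n) {m n : ℕ} {a : MatrixAlgebra K}
    (ha : a ∈ homogeneous K m n) : ‖Φ a‖ = matNorm J (a : T.Mat) := by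
  obtain ⟨p, hp, hpN, hpa⟩ := exists_isCStarSeminorm_eq_matNorm hT hJ
  refine (hle a).antisymm ((hpa m n a ha).trans (hΦ.maximal p hp (fun b hb => ?_) a))
  exact le_antisymm ((hpN b).trans_eq hb) (apply_nonneg _ _)

end HomogeneousNorm

end RightTensorCStarPrecategory

namespace RightTensorCStarPrecategory

/-! ### Gauge invariant C*-seminorms on graded `*`-algebras -/

section Graded

/-- If y < x, then (y/x)^n decays faster than any linear factor grows, so along n = 2^m the right
side divided by x^n would tend to 0. -/
lemma le_of_pow_le_linear_mul_pow {x y c : ℝ} (hx : 0 ≤ x) (hy : 0 ≤ y)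
    (h : ∀ m : ℕ, x ^ 2 ^ m ≤ (c * (2 ^ m : ℕ) + 1) * y ^ 2 ^ m) : x ≤ y := by
  by_contra! hlt
  have hx0 : 0 < x := hy.trans_lt hlt
  have hr : |y / x| < 1 := by
    rw [abs_of_nonneg (div_nonneg hy hx)]
    exact (div_lt_one hx0).2 hlt
  have h1 : Tendsto (fun n : ℕ => c * ((n : ℝ) ^ 1 * (y / x) ^ n) + (n : ℝ) ^ 0 * (y / x) ^ n)
      atTop (𝓝 (c * 0 + 0)) :=
    ((tendsto_pow_const_mul_const_pow_of_abs_lt_one 1 hr).const_mul c).add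
      (tendsto_pow_const_mul_const_pow_of_abs_lt_one 0 hr)
  have h2 := h1.comp (tendsto_pow_atTop_atTop_of_one_lt (r := 2) one_lt_two)
  rw [mul_zero, add_zero] at h2
  refine absurd (ge_of_tendsto' h2 fun m => ?_) (not_le.2 (zero_lt_one' ℝ))
  have h3 : c * (((2 ^ m : ℕ) : ℝ) ^ 1 * (y / x) ^ 2 ^ m) + ((2 ^ m : ℕ) : ℝ) ^ 0 * (y / x) ^ 2 ^ m
      = (c * (2 ^ m : ℕ) + 1) * y ^ 2 ^ m / x ^ 2 ^ m := by
    rw [div_pow]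
    ring
  change 1 ≤ c * (((2 ^ m : ℕ) : ℝ) ^ 1 * (y / x) ^ 2 ^ m)
    + ((2 ^ m : ℕ) : ℝ) ^ 0 * (y / x) ^ 2 ^ m
  rw [h3, le_div_iff₀ (pow_pos hx0 _), one_mul]
  exact h m

lemma sum_range_zpow_pow_eq_zero {N : ℕ} {ζ : ℂ} (hζ : IsPrimitiveRoot ζ N) {d : ℤ}
    (hd : ¬ (N : ℤ) ∣ d) : ∑ j ∈ Finset.range N, (ζ ^ d) ^ j = 0 := by
  have h1 : ζ ^ d ≠ 1 := fun h => hd ((hζ.zpow_eq_one_iff_dvd d).1 h)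
  have h2 : (ζ ^ d) ^ N = 1 := by
    rw [← zpow_natCast, ← zpow_mul, mul_comm, zpow_mul, zpow_natCast, hζ.pow_eq_one, one_zpow]
  have h3 := geom_sum_mul (ζ ^ d) N
  rw [h2, sub_self] at h3
  exact (mul_eq_zero.1 h3).resolve_right (sub_ne_zero.2 h1)

/-- Averaging over roots of unity bounds a homogeneous component by the whole sum. -/
lemma Seminorm.apply_component_le {V : Type u} [AddCommGroup V] [Module ℂ V] (p : Seminorm ℂ V)
    (f : ℤ → V) (d : ℕ)
    (hinv : ∀ z : Circle, p (∑ k ∈ Finset.Icc (-(d : ℤ)) d, (z : ℂ) ^ k • f k)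
      ≤ p (∑ k ∈ Finset.Icc (-(d : ℤ)) d, f k))
    {k : ℤ} (hk : k ∈ Finset.Icc (-(d : ℤ)) d) :
    p (f k) ≤ p (∑ k ∈ Finset.Icc (-(d : ℤ)) d, f k) := by
  set F := Finset.Icc (-(d : ℤ)) d
  set x := ∑ k ∈ F, f k
  -- Two degrees in [−d, d] differ by at most 2d < N, so distinct ones are separated by the N-th
  -- roots of unity.
  set N : ℕ := 2 * d + 1
  have hN : (N : ℂ) ≠ 0 := Nat.cast_ne_zero.2 (by omega)
  obtain ⟨ζ, hζ⟩ : ∃ ζ : ℂ, IsPrimitiveRoot ζ N := ⟨_, Complex.isPrimitiveRoot_exp N (by omega)⟩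
  have hζ1 : ‖ζ‖ = 1 := hζ.norm'_eq_one (by omega)
  let z : Circle := ⟨ζ, mem_sphere_zero_iff_norm.2 hζ1⟩
  have hz : ∀ j : ℕ, ((z ^ j : Circle) : ℂ) = ζ ^ j := fun j => Circle.coe_pow z j
  have e1 : ∑ j ∈ Finset.range N, (ζ ^ j) ^ (-k) • ∑ l ∈ F, (ζ ^ j) ^ l • f l
      = (N : ℂ) • f k := by
    simp only [Finset.smul_sum, smul_smul]
    rw [Finset.sum_comm]
    have e2 : ∀ l, ∑ j ∈ Finset.range N, ((ζ ^ j) ^ (-k) * (ζ ^ j) ^ l) • f l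
        = (∑ j ∈ Finset.range N, (ζ ^ (l - k)) ^ j) • f l := by
      intro l
      rw [Finset.sum_smul]
      refine Finset.sum_congr rfl fun j _ => ?_
      congr 1
      have h0 : ζ ≠ 0 := hζ.ne_zero (by omega)
      rw [← zpow_add₀ (pow_ne_zero _ h0), ← zpow_natCast, ← zpow_natCast, ← zpow_mul, ← zpow_mul]
      congr 1
      ring
    simp only [e2]
    rw [Finset.sum_eq_single_of_mem k hk]
    · simp
    · intro l hl hlk
      rw [sum_range_zpow_pow_eq_zero hζ, zero_smul]
      rw [Finset.mem_Icc] at hl hk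
      rintro ⟨c, hc⟩
      have hc0 : c ≠ 0 := by
        rintro rfl
        omega
      have : |l - k| = N * |c| := by rw [hc, abs_mul, Nat.abs_cast]
      have h1 : 1 ≤ |c| := Int.one_le_abs hc0
      have h2 : |l - k| ≤ 2 * d := by
        rw [abs_le]
        omega
      have h3 : (N : ℤ) = 2 * d + 1 := by push_cast [N]; rfl
      nlinarith
  have e3 : (N : ℝ) * p (f k) ≤ N * p x := by
    have : (N : ℝ) * p (f k) = p ((N : ℂ) • f k) := by
      rw [map_smul_eq_mul, Complex.norm_natCast]
    rw [this, ← e1]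
    refine (Finset.le_sum_of_subadditive p (map_zero p).le (map_add_le_add p) _ _).trans ?_
    refine (Finset.sum_le_card_nsmul _ _ (p x) fun j _ => ?_).trans_eq (by simp)
    rw [map_smul_eq_mul, norm_zpow, norm_pow, hζ1, one_pow, one_zpow, one_mul]
    have := hinv (z ^ j)
    rwa [hz] at this
  exact le_of_mul_le_mul_left e3 (Nat.cast_pos.2 (by omega))

variable {A : Type u} [NonUnitalRing A] [StarRing A] [Module ℂ A]

/-- If a gauge invariant C*-seminorm `p` dominates the C*-seminorm `q` on the homogeneous elements,
then it dominates `q`. -/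
theorem IsCStarSeminorm.le_of_graded {𝒜 : ℤ → Submodule ℂ A}
    (hmul : ∀ j k, ∀ a ∈ 𝒜 j, ∀ b ∈ 𝒜 k, a * b ∈ 𝒜 (j + k))
    (hstar : ∀ k, ∀ a ∈ 𝒜 k, star a ∈ 𝒜 (-k))
    {p q : Seminorm ℂ A} (hp : IsCStarSeminorm p) (hq : IsCStarSeminorm q)
    (hinv : ∀ (F : Finset ℤ) (f : ℤ → A) (z : Circle), (∀ k, f k ∈ 𝒜 k) →
      p (∑ k ∈ F, (z : ℂ) ^ k • f k) ≤ p (∑ k ∈ F, f k))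
    (hle : ∀ k, ∀ a ∈ 𝒜 k, q a ≤ p a) {x : A} (hx : x ∈ ⨆ k, 𝒜 k) : q x ≤ p x := by
  let 𝒢 : ℕ → Submodule ℂ A := fun d => ⨆ k ∈ Finset.Icc (-(d : ℤ)) d, 𝒜 k
  have hincl : ∀ {d : ℕ} {k : ℤ}, k ∈ Finset.Icc (-(d : ℤ)) d → 𝒜 k ≤ 𝒢 d := fun {d k} hk =>
    le_iSup₂ (f := fun k (_ : k ∈ Finset.Icc (-(d : ℤ)) d) => 𝒜 k) k hk
  have hsum : ∀ {d : ℕ} {y : A}, y ∈ 𝒢 d → ∃ f : ℤ → A, (∀ k, f k ∈ 𝒜 k) ∧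
      ∑ k ∈ Finset.Icc (-(d : ℤ)) d, f k = y := fun {d y} hy => by
    obtain ⟨f, hf⟩ := (Submodule.mem_iSup_finset_iff_exists_sum _ _).1 hy
    exact ⟨fun k => f k, fun k => (f k).2, hf⟩
  have hGmul : ∀ {d e : ℕ} {y z : A}, y ∈ 𝒢 d → z ∈ 𝒢 e → y * z ∈ 𝒢 (d + e) := by
    intro d e y z hy hz
    obtain ⟨f, hf, rfl⟩ := hsum hy
    obtain ⟨g, hg, rfl⟩ := hsum hz
    rw [Finset.sum_mul_sum]
    refine Submodule.sum_mem _ fun i hi => Submodule.sum_mem _ fun j hj => ?_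
    refine hincl ?_ (hmul i j _ (hf i) _ (hg j))
    rw [Finset.mem_Icc] at hi hj ⊢
    push_cast
    omega
  have hGstar : ∀ {d : ℕ} {y : A}, y ∈ 𝒢 d → star y ∈ 𝒢 d := by
    intro d y hy
    obtain ⟨f, hf, rfl⟩ := hsum hy
    rw [star_sum]
    refine Submodule.sum_mem _ fun i hi => hincl ?_ (hstar i _ (hf i))
    rw [Finset.mem_Icc] at hi ⊢
    omega
  have hGle : ∀ {d : ℕ} {y : A}, y ∈ 𝒢 d → q y ≤ (2 * d + 1) * p y := by
    intro d y hy
    obtain ⟨f, hf, rfl⟩ := hsum hy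
    refine (Finset.le_sum_of_subadditive q (map_zero q).le (map_add_le_add q) _ _).trans ?_
    refine (Finset.sum_le_card_nsmul _ _ _ fun k hk => (hle k _ (hf k)).trans
      (Seminorm.apply_component_le p f d (fun z => hinv _ f z hf) hk)).trans_eq ?_
    rw [Int.card_Icc, nsmul_eq_mul]
    congr 1
    have : ((d : ℤ) + 1 - -(d : ℤ)).toNat = 2 * d + 1 := by omega
    rw [this]
    push_cast
    ring
  -- For self-adjoint y a C*-seminorm satisfies r(y^{2^m}) = r(y)^{2^m}, while the degree of y^{2^m}
  -- grows only linearly in the exponent. So the factor 2d + 1 of `hGle` disappears in the limit.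
  have hself : ∀ {d : ℕ} {y : A}, y ∈ 𝒢 d → star y = y → q y ≤ p y := by
    intro d y hy hs
    let s : ℕ → A := fun m => (fun a => a * a)^[m] y
    have hs1 : ∀ m, s (m + 1) = s m * s m := fun m => Function.iterate_succ_apply' _ _ _
    have hss : ∀ m, star (s m) = s m := by
      intro m
      induction m with
      | zero => exact hs
      | succ m ih => rw [hs1, star_mul, ih]
    have hsG : ∀ m, s m ∈ 𝒢 (2 ^ m * d) := by
      intro m
      induction m with
      | zero => rwa [pow_zero, one_mul]
      | succ m ih =>
        rw [hs1, pow_succ, mul_two, add_mul]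
        exact hGmul ih ih
    have hpow : ∀ {r : Seminorm ℂ A}, IsCStarSeminorm r → ∀ m, r (s m) = r y ^ 2 ^ m := by
      intro r hr m
      induction m with
      | zero => simp [s]
      | succ m ih =>
        have := hr.star_mul_self (s m)
        rw [hss, ← hs1, ih, ← pow_mul, ← pow_succ] at this
        exact this
    refine le_of_pow_le_linear_mul_pow (c := 2 * d) (apply_nonneg _ _) (apply_nonneg _ _)
      fun m => ?_
    rw [← hpow hp, ← hpow hq]
    refine (hGle (hsG m)).trans_eq ?_
    push_cast
    ring
  obtain ⟨d, hd⟩ : ∃ d, x ∈ 𝒢 d := by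
    refine Submodule.iSup_induction 𝒜 (motive := fun x => ∃ d, x ∈ 𝒢 d) hx (fun k a ha => ?_)
      ⟨0, Submodule.zero_mem _⟩ ?_
    · exact ⟨k.natAbs, hincl (Finset.mem_Icc.2 (by omega)) ha⟩
    · have mono : ∀ {d e : ℕ}, d ≤ e → 𝒢 d ≤ 𝒢 e := fun {d e} hde =>
        iSup₂_le fun k hk => hincl <| by
          rw [Finset.mem_Icc] at hk ⊢
          omega
      rintro a b ⟨d, ha⟩ ⟨e, hb⟩
      exact ⟨max d e, Submodule.add_mem _ (mono (le_max_left d e) ha) (mono (le_max_right d e) hb)⟩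
  have h1 := hself (hGmul (hGstar hd) hd) (by rw [star_mul, star_star])
  rw [hp.star_mul_self, hq.star_mul_self] at h1
  exact (abs_le_of_sq_le_sq' h1 (apply_nonneg _ _)).2

end Graded

end RightTensorCStarPrecategory

namespace RightTensorCStarPrecategory

open CStarPrecategory Mat

variable {T : RightTensorCStarPrecategory.{u}} {K J : T.CStarIdeal}

/-! ### The circle action -/

section Gauge

variable (K) in
/-- The gauge action of the circle on `M_T(K)`. -/
def gaugeMat (z : Circle) : MatrixAlgebra K →ₗ[ℂ] MatrixAlgebra K where
  toFun a := ⟨fun i j => (z : ℂ) ^ ((j : ℤ) - i) • (a : T.Mat) i j,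
    fun i j => Submodule.smul_mem _ _ (a.2.1 i j),
    a.2.2.subset fun p hp h => hp (by simp only [h, smul_zero])⟩
  map_add' a b := by
    ext i j
    exact smul_add _ _ _
  map_smul' c a := by
    ext i j
    exact smul_comm _ _ _

lemma gaugeMat_degPart (z : Circle) (k : ℤ) (a : MatrixAlgebra K) :
    gaugeMat K z (degPart K k a) = (z : ℂ) ^ k • degPart K k a := by
  ext i j
  change (z : ℂ) ^ ((j : ℤ) - i) • (degPart K k a : T.Mat) i j
    = (z : ℂ) ^ k • (degPart K k a : T.Mat) i j
  rw [degPart_apply]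
  split_ifs with h
  · rw [h]
  · rw [smul_zero, smul_zero]

lemma degPart_induction {P : MatrixAlgebra K → Prop}
    (hadd : ∀ a b, P a → P b → P (a + b)) (hdeg : ∀ k a, P (degPart K k a))
    (a : MatrixAlgebra K) : P a := by
  obtain ⟨F, hF⟩ := exists_degPart_eq_zero a
  rw [← sum_degPart hF]
  refine Finset.sum_induction _ P hadd ?_ fun k _ => hdeg k a
  simpa using hdeg 0 0

lemma gaugeMat_mul (z : Circle) (a b : MatrixAlgebra K) :
    gaugeMat K z (a * b) = gaugeMat K z a * gaugeMat K z b := by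
  induction a using degPart_induction with
  | hadd a a' ha ha' => rw [add_mul, map_add, map_add, add_mul, ha, ha']
  | hdeg j a =>
    induction b using degPart_induction with
    | hadd b b' hb hb' => rw [mul_add, map_add, map_add, mul_add, hb, hb']
    | hdeg k b =>
      rw [← degPart_mul_degPart, gaugeMat_degPart, gaugeMat_degPart, gaugeMat_degPart,
        degPart_mul_degPart, smul_mul_smul_comm, zpow_add₀ (Circle.coe_ne_zero z)]

lemma gaugeMat_star (z : Circle) (a : MatrixAlgebra K) :
    gaugeMat K z (star a) = star (gaugeMat K z a) := by
  induction a using degPart_induction with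
  | hadd a a' ha ha' => rw [star_add, map_add, map_add, star_add, ha, ha']
  | hdeg k a =>
    have e : star (degPart K k a) = degPart K (-k) (star a) := by rw [degPart_star, neg_neg]
    rw [gaugeMat_degPart, star_smul, e, gaugeMat_degPart, star_zpow₀, RCLike.star_def,
      ← Circle.coe_inv_eq_conj, Circle.coe_inv, inv_zpow, zpow_neg]

lemma gaugeMat_gaugeMat_inv (z : Circle) (a : MatrixAlgebra K) :
    gaugeMat K z (gaugeMat K z⁻¹ a) = a := by
  induction a using degPart_induction with
  | hadd a a' ha ha' => rw [map_add, map_add, ha, ha']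
  | hdeg k a =>
    rw [gaugeMat_degPart, map_smul, gaugeMat_degPart, smul_smul, Circle.coe_inv, inv_zpow,
      inv_mul_cancel₀ (zpow_ne_zero _ (Circle.coe_ne_zero z)), one_smul]

variable {O : Type v} [NonUnitalCStarAlgebra O] {Φ : MatrixAlgebra K →ₗ[ℂ] O}

/-- Since ‖·‖_J is the sum of the norms of the diagonals, the diagonals of a null matrix are null;
the gauge action only rescales them. -/
lemma IsEnvelopingCStarAlgebra.map_gaugeMat_eq_zero
    (hΦ : IsEnvelopingCStarAlgebra (fun a : MatrixAlgebra K => matNorm J (a : T.Mat)) Φ)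
    (z : Circle) {a : MatrixAlgebra K} (ha : matNorm J (a : T.Mat) = 0) :
    Φ (gaugeMat K z a) = 0 := by
  obtain ⟨F, hF⟩ := exists_degPart_eq_zero a
  rw [← sum_degPart hF, map_sum, map_sum]
  refine Finset.sum_eq_zero fun k _ => ?_
  obtain ⟨m, n, hk, hm⟩ := exists_mem_degPart a k
  have h1 := degreeNorm_le_matNorm J a k
  rw [ha, ← degreeNorm_degPart, ← matNorm_of_mem J hm hk] at h1
  rw [gaugeMat_degPart, map_smul, hΦ.map_null _ (h1.antisymm (apply_nonneg (matSeminorm K J) _)),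
    smul_zero]

/-- The seminorm a ↦ ‖Φ(z·a)‖ is again an admissible C*-seminorm, so by maximality it is bounded by
‖Φ(a)‖ and the action extends to O. The inverse comes from z⁻¹. -/
lemma IsEnvelopingCStarAlgebra.exists_gauge
    (hΦ : IsEnvelopingCStarAlgebra (fun a : MatrixAlgebra K => matNorm J (a : T.Mat)) Φ) :
    ∃ γ : Circle → (O ≃⋆ₐ[ℂ] O), ∀ z a, γ z (Φ a) = Φ (gaugeMat K z a) := by
  have hmul : ∀ z a b, (Φ ∘ₗ gaugeMat K z) (a * b)
      = (Φ ∘ₗ gaugeMat K z) a * (Φ ∘ₗ gaugeMat K z) b := fun z a b => by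
    rw [LinearMap.comp_apply, gaugeMat_mul, hΦ.map_mul]
    rfl
  have hstar : ∀ z a, (Φ ∘ₗ gaugeMat K z) (star a) = star ((Φ ∘ₗ gaugeMat K z) a) :=
    fun z a => by
      rw [LinearMap.comp_apply, gaugeMat_star, hΦ.map_star]
      rfl
  have h : ∀ z, ∃ ψ : O →⋆ₙₐ[ℂ] O, ∀ a, ψ (Φ a) = (Φ ∘ₗ gaugeMat K z) a := fun z =>
    exists_starAlgHom_extension hΦ.map_mul hΦ.map_star hΦ.denseRange (hmul z) (hstar z)
      (hΦ.maximal _ (isCStarSeminorm_mapSeminorm _ (hmul z) (hstar z)) fun a ha => by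
        rw [mapSeminorm_apply, LinearMap.comp_apply, hΦ.map_gaugeMat_eq_zero z ha, norm_zero])
  choose ψ hψ using h
  have hinv : ∀ z, (ψ z).comp (ψ z⁻¹) = NonUnitalStarAlgHom.id ℂ O := fun z =>
    starAlgHom_eq_of_denseRange hΦ.denseRange fun a => by
      rw [NonUnitalStarAlgHom.comp_apply, hψ, LinearMap.comp_apply, hψ, LinearMap.comp_apply,
        gaugeMat_gaugeMat_inv]
      rfl
  refine ⟨fun z => StarAlgEquiv.ofNonUnitalStarAlgHom (ψ z) (ψ z⁻¹) ?_ (hinv z), fun z a =>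
    hψ z a⟩
  have := hinv z⁻¹
  rwa [inv_inv] at this

end Gauge

/-! ### The graded subalgebra of the enveloping C*-algebra -/

section Limit

variable {S : RightTensorCStarPrecategory.{u}}
  {Q : ∀ m n : ℕ, homogeneous K m n →ₗ[ℂ] S.Hom m n}
  {O : Type v} [NonUnitalCStarAlgebra O] {Φ : MatrixAlgebra K →ₗ[ℂ] O}
  {ι : ∀ m n : ℕ, S.Hom m n →ₗ[ℂ] O}

lemma IsHomogeneousQuotient.norm_tensorPow (hQ : IsHomogeneousQuotient K J S Q) {m n : ℕ}
    (a : homogeneous K m n) (k : ℕ) :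
    ‖S.tensorPow k (Q m n a)‖ = homNorm J (m + k) (n + k) ((a : MatrixAlgebra K) : T.Mat) := by
  have h : ∀ k, S.tensorPow k (Q m n a)
      = Q (m + k) (n + k) ⟨a, homogeneous_le_add K m n k a.2⟩ := by
    intro k
    induction k with
    | zero => rfl
    | succ k ih =>
      change S.tensor (S.tensorPow k (Q m n a)) = _
      rw [ih]
      exact (hQ.map_tensor _ _ _ _ rfl).symm
  rw [h, hQ.norm_map]

/-- Every diagonal of a matrix lies in some M(m, n), so O^(k) is the closure of the image of the
degree-k matrices; the grading of M_T(K) thus passes to O. -/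
lemma IsHomogeneousQuotient.limitSpace_eq (hQ : IsHomogeneousQuotient K J S Q)
    (hι : ∀ (m n : ℕ) (a : homogeneous K m n), ι m n (Q m n a) = Φ a) (k : ℤ) :
    limitSpace S ι k = (LinearMap.range (Φ ∘ₗ degPart K k)).topologicalClosure := by
  unfold limitSpace
  congr 1
  refine le_antisymm (iSup_le ?_) ?_
  · rintro ⟨⟨m, n⟩, hk⟩ _ ⟨x, rfl⟩
    obtain ⟨a, rfl⟩ := hQ.surjective m n x
    refine ⟨a, ?_⟩
    rw [LinearMap.comp_apply, degPart_of_mem a.2 hk, hι]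
  · rintro _ ⟨a, rfl⟩
    obtain ⟨m, n, hk, h⟩ := exists_mem_degPart a k
    exact Submodule.mem_iSup_of_mem ⟨(m, n), hk⟩ ⟨Q m n ⟨_, h⟩, hι m n ⟨_, h⟩⟩

lemma map_degPart_mem_limitSpace
    (hW : ∀ k, limitSpace S ι k = (LinearMap.range (Φ ∘ₗ degPart K k)).topologicalClosure)
    (k : ℤ) (a : MatrixAlgebra K) : Φ (degPart K k a) ∈ limitSpace S ι k := by
  rw [hW]
  exact Submodule.le_topologicalClosure _ ⟨a, rfl⟩

lemma isClosed_limitSpace (k : ℤ) : IsClosed (limitSpace S ι k : Set O) :=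
  Submodule.isClosed_topologicalClosure _

lemma limitSpace_mul_mem
    (hW : ∀ k, limitSpace S ι k = (LinearMap.range (Φ ∘ₗ degPart K k)).topologicalClosure)
    (hmul : ∀ a b, Φ (a * b) = Φ a * Φ b) {j k : ℤ} {x y : O} (hx : x ∈ limitSpace S ι j)
    (hy : y ∈ limitSpace S ι k) : x * y ∈ limitSpace S ι (j + k) := by
  rw [hW] at hx hy ⊢
  refine map_mem_closure₂ (f := fun x y : O => x * y) continuous_mul hx hy ?_
  rintro _ ⟨a, rfl⟩ _ ⟨b, rfl⟩
  refine ⟨degPart K j a * degPart K k b, ?_⟩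
  rw [LinearMap.comp_apply, degPart_mul_degPart, hmul]
  rfl

lemma limitSpace_star_mem
    (hW : ∀ k, limitSpace S ι k = (LinearMap.range (Φ ∘ₗ degPart K k)).topologicalClosure)
    (hstar : ∀ a, Φ (star a) = star (Φ a)) {k : ℤ} {x : O} (hx : x ∈ limitSpace S ι k) :
    star x ∈ limitSpace S ι (-k) := by
  rw [hW] at hx ⊢
  refine map_mem_closure continuous_star hx ?_
  rintro _ ⟨a, rfl⟩
  refine ⟨star a, ?_⟩
  rw [LinearMap.comp_apply, LinearMap.comp_apply, degPart_star, neg_neg, hstar]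

lemma gauge_apply_of_mem_limitSpace
    (hW : ∀ k, limitSpace S ι k = (LinearMap.range (Φ ∘ₗ degPart K k)).topologicalClosure)
    {γ : Circle → (O ≃⋆ₐ[ℂ] O)} (hγ : ∀ z a, γ z (Φ a) = Φ (gaugeMat K z a)) (z : Circle) (k : ℤ)
    {x : O} (hx : x ∈ limitSpace S ι k) : γ z x = (z : ℂ) ^ k • x := by
  have hc : Continuous (γ z) := AddMonoidHomClass.continuous_of_bound (γ z) 1 fun x => by
    rw [one_mul]; exact NonUnitalStarAlgHom.norm_apply_le (γ z) x
  rw [hW] at hx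
  refine closure_minimal (t := {x | γ z x = (z : ℂ) ^ k • x}) ?_
    (isClosed_eq hc (continuous_const_smul _)) hx
  rintro _ ⟨a, rfl⟩
  change γ z (Φ (degPart K k a)) = (z : ℂ) ^ k • Φ (degPart K k a)
  rw [hγ, gaugeMat_degPart, map_smul]

/-- A coincidence of two different powers of e^i would make π rational. -/
lemma injective_zpow_exp_I : Function.Injective fun k : ℤ => ((Circle.exp 1 : Circle) : ℂ) ^ k := by
  intro j k h
  dsimp only at h
  rw [Circle.coe_exp, Complex.ofReal_one, one_mul, ← Complex.exp_int_mul, ← Complex.exp_int_mul,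
    Complex.exp_eq_exp_iff_exists_int] at h
  obtain ⟨n, hn⟩ := h
  have h1 : (j : ℂ) = k + n * (2 * Real.pi) := by
    have := Complex.I_ne_zero
    refine mul_right_cancel₀ this (hn.trans ?_)
    ring
  have h2 : (j : ℝ) = k + n * (2 * Real.pi) := by exact_mod_cast h1
  have h3 : n = 0 := by
    by_contra hne
    refine irrational_pi ⟨((j - k : ℤ) : ℚ) / ((2 * n : ℤ) : ℚ), ?_⟩
    have : (n : ℝ) ≠ 0 := Int.cast_ne_zero.2 hne
    push_cast
    field_simp
    linarith
  rw [h3, Int.cast_zero, zero_mul, add_zero] at h2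
  exact_mod_cast h2

/-- The spaces O^(k) lie in eigenspaces of the single automorphism given by e^i, and its eigenvalues
e^{ik} are distinct. -/
lemma iSupIndep_limitSpace {γ : Circle → (O ≃⋆ₐ[ℂ] O)}
    (hγ : ∀ (z : Circle) (k : ℤ), ∀ x ∈ limitSpace S ι k, γ z x = (z : ℂ) ^ k • x) :
    iSupIndep (limitSpace S ι) := by
  let f : Module.End ℂ O :=
    { toFun := γ (Circle.exp 1)
      map_add' := map_add _
      map_smul' := map_smul _ }
  exact (f.eigenspaces_iSupIndep.comp injective_zpow_exp_I).mono fun k x hx =>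
    Module.End.mem_eigenspace_iff.2 (hγ _ k x hx)

lemma range_le_gradedSpace
    (hW : ∀ k, limitSpace S ι k = (LinearMap.range (Φ ∘ₗ degPart K k)).topologicalClosure) :
    LinearMap.range Φ ≤ gradedSpace S ι := by
  rintro _ ⟨a, rfl⟩
  obtain ⟨F, hF⟩ := exists_degPart_eq_zero a
  rw [← sum_degPart hF, map_sum]
  exact Submodule.sum_mem _ fun k _ =>
    Submodule.mem_iSup_of_mem k (map_degPart_mem_limitSpace hW k a)

variable (S ι) in
/-- The graded `*`-algebra `⨁ O^(k)`. -/
def gradedAlgebra (hmul : ∀ {j k : ℤ} {x y : O}, x ∈ limitSpace S ι j → y ∈ limitSpace S ι k →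
      x * y ∈ limitSpace S ι (j + k))
    (hstar : ∀ {k : ℤ} {x : O}, x ∈ limitSpace S ι k → star x ∈ limitSpace S ι (-k)) :
    NonUnitalStarSubalgebra ℂ O where
  __ := gradedSpace S ι
  mul_mem' {x y} hx hy := by
    refine Submodule.iSup_induction _ (motive := fun x => x * y ∈ gradedSpace S ι) hx
      (fun j x hx => ?_) (by rw [zero_mul]; exact zero_mem _)
      (fun x x' h h' => by rw [add_mul]; exact add_mem h h')
    refine Submodule.iSup_induction _ (motive := fun y => x * y ∈ gradedSpace S ι) hy
      (fun k y hy => ?_) (by rw [mul_zero]; exact zero_mem _)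
      (fun y y' h h' => by rw [mul_add]; exact add_mem h h')
    exact Submodule.mem_iSup_of_mem (j + k) (hmul hx hy)
  star_mem' {x} hx := by
    refine Submodule.iSup_induction _ (motive := fun x => star x ∈ gradedSpace S ι) hx
      (fun j x hx => ?_) (by rw [star_zero]; exact zero_mem _)
      (fun x x' h h' => by rw [star_add]; exact add_mem h h')
    exact Submodule.mem_iSup_of_mem (-j) (hstar hx)

/-- The C*-subalgebra `O^(0)`. -/
def limitSpaceZero (hmul : ∀ {j k : ℤ} {x y : O}, x ∈ limitSpace S ι j → y ∈ limitSpace S ι k →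
      x * y ∈ limitSpace S ι (j + k))
    (hstar : ∀ {k : ℤ} {x : O}, x ∈ limitSpace S ι k → star x ∈ limitSpace S ι (-k)) :
    NonUnitalStarSubalgebra ℂ O where
  __ := limitSpace S ι 0
  mul_mem' hx hy := hmul (j := 0) (k := 0) hx hy
  star_mem' {x} hx := by
    have h : star x ∈ limitSpace S ι (-0) := hstar hx
    rwa [neg_zero] at h

/-- The identity into the completion in p is an injective `*`-homomorphism of C*-algebras, hence
isometric. -/
lemma norm_eq_of_isCStarSeminorm {A : Type u} [NonUnitalCStarAlgebra A] {p : Seminorm ℂ A}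
    (hp : IsCStarSeminorm p) (h0 : ∀ a, p a = 0 → a = 0) (a : A) : p a = ‖a‖ := by
  obtain ⟨B, _, Ψ, hmul, hstar, -, hn⟩ := exists_cstar_completion hp
  let φ : A →⋆ₙₐ[ℂ] B :=
    { Ψ with
      map_zero' := map_zero Ψ
      map_mul' := hmul
      map_star' := hstar }
  rw [← hn]
  refine NonUnitalStarAlgHom.norm_map φ ((injective_iff_map_eq_zero φ).2 fun a ha => h0 a ?_) a
  rw [← hn, show Ψ a = 0 from ha, norm_zero]

/-- The gauge invariant C*-norm on `⨁ O^(k)` is unique. -/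
theorem gradedSpace_norm_unique
    (hmul : ∀ {j k : ℤ} {x y : O}, x ∈ limitSpace S ι j → y ∈ limitSpace S ι k →
      x * y ∈ limitSpace S ι (j + k))
    (hstar : ∀ {k : ℤ} {x : O}, x ∈ limitSpace S ι k → star x ∈ limitSpace S ι (-k))
    {γ : Circle → (O ≃⋆ₐ[ℂ] O)}
    (hγ : ∀ (z : Circle) (k : ℤ), ∀ x ∈ limitSpace S ι k, γ z x = (z : ℂ) ^ k • x)
    (p : Seminorm ℂ (gradedSpace S ι)) (hp0 : ∀ x, p x = 0 → x = 0)
    (hpmul : ∀ x y w : gradedSpace S ι, (w : O) = x * y → p w ≤ p x * p y)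
    (hpstar : ∀ x w : gradedSpace S ι, (w : O) = star (x : O) * x → p w = p x ^ 2)
    (hpγ : ∀ (z : Circle) (x w : gradedSpace S ι), (w : O) = γ z x → p w = p x)
    (x : gradedSpace S ι) : p x = ‖(x : O)‖ := by
  let A := gradedAlgebra S ι hmul hstar
  let e : A →ₗ[ℂ] gradedSpace S ι :=
    { toFun := fun a => ⟨a, a.2⟩
      map_add' := fun _ _ => rfl
      map_smul' := fun _ _ => rfl }
  let r : Seminorm ℂ A := p.comp e
  let s : Seminorm ℂ A := mapSeminorm
    { toFun := fun a : A => (a : O)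
      map_add' := fun _ _ => rfl
      map_smul' := fun _ _ => rfl }
  have hr : IsCStarSeminorm r := ⟨fun a b => hpmul _ _ _ rfl, fun a => hpstar _ _ rfl⟩
  have hs : IsCStarSeminorm s := isCStarSeminorm_mapSeminorm _ (fun _ _ => rfl) fun _ => rfl
  let 𝒜 : ℤ → Submodule ℂ A := fun k =>
    { carrier := {a | (a : O) ∈ limitSpace S ι k}
      add_mem' := fun ha hb => (limitSpace S ι k).add_mem ha hb
      zero_mem' := zero_mem (limitSpace S ι k)
      smul_mem' := fun c _ ha => (limitSpace S ι k).smul_mem c ha }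
  -- O^(0) is closed, hence a C*-algebra, and has only one C*-norm. Equality on O^(k) follows
  -- because a*a lies in O^(0), and the comparison of graded seminorms, applied in both directions,
  -- finishes the argument.
  have hzero : ∀ a ∈ 𝒜 0, r a = s a := by
    have hcl : IsClosed (limitSpaceZero hmul hstar : Set O) := isClosed_limitSpace 0
    let _ := NonUnitalStarSubalgebra.nonUnitalCStarAlgebra (limitSpaceZero hmul hstar)
      (h_closed := hcl)
    let i : limitSpaceZero hmul hstar →ₗ[ℂ] gradedSpace S ι :=
      { toFun := fun a => ⟨a, Submodule.mem_iSup_of_mem 0 a.2⟩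
        map_add' := fun _ _ => rfl
        map_smul' := fun _ _ => rfl }
    intro a ha
    refine norm_eq_of_isCStarSeminorm (p := p.comp i)
      ⟨fun a b => hpmul _ _ _ rfl, fun a => hpstar _ _ rfl⟩ (fun a h => ?_) ⟨a, ha⟩
    exact Subtype.ext (congrArg (fun x : gradedSpace S ι => (x : O)) (hp0 _ h))
  have hdeg : ∀ k, ∀ a ∈ 𝒜 k, r a = s a := by
    intro k a ha
    have h : star a * a ∈ 𝒜 (-k + k) := hmul (hstar ha) ha
    rw [neg_add_cancel] at h
    have h1 := hzero _ h
    rw [hr.star_mul_self, hs.star_mul_self] at h1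
    exact (pow_left_inj₀ (apply_nonneg _ _) (apply_nonneg _ _) two_ne_zero).1 h1
  have htop : ∀ a : A, a ∈ ⨆ k, 𝒜 k := by
    rintro ⟨a, ha⟩
    refine Submodule.iSup_induction' _
      (motive := fun a ha => (⟨a, ha⟩ : A) ∈ ⨆ k, 𝒜 k) (fun k x hx => ?_) ?_ ?_ ha
    · exact Submodule.mem_iSup_of_mem (p := 𝒜) k hx
    · exact zero_mem (⨆ k, 𝒜 k)
    · intro x y hx hy h h'
      exact add_mem h h'
  have hA1 : ∀ j k, ∀ a ∈ 𝒜 j, ∀ b ∈ 𝒜 k, a * b ∈ 𝒜 (j + k) := fun j k a ha b hb => hmul ha hb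
  have hA2 : ∀ k, ∀ a ∈ 𝒜 k, star a ∈ 𝒜 (-k) := fun k a ha => hstar ha
  have hγsum : ∀ (F : Finset ℤ) (f : ℤ → A) (z : Circle), (∀ k, f k ∈ 𝒜 k) →
      ((∑ k ∈ F, (z : ℂ) ^ k • f k : A) : O) = γ z ((∑ k ∈ F, f k : A) : O) := by
    intro F f z hf
    rw [AddSubmonoidClass.coe_finsetSum, AddSubmonoidClass.coe_finsetSum, map_sum]
    exact Finset.sum_congr rfl fun k _ => (hγ z k _ (hf k)).symm
  refine le_antisymm ?_ ?_
  · refine IsCStarSeminorm.le_of_graded (x := (⟨x, x.2⟩ : A)) hA1 hA2 hs hr (fun F f z hf => ?_)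
      (fun k a ha => (hdeg k a ha).le) (htop _)
    change ‖((∑ k ∈ F, (z : ℂ) ^ k • f k : A) : O)‖ ≤ ‖((∑ k ∈ F, f k : A) : O)‖
    rw [hγsum F f z hf]
    exact NonUnitalStarAlgHom.norm_apply_le (γ z) _
  · refine IsCStarSeminorm.le_of_graded (x := (⟨x, x.2⟩ : A)) hA1 hA2 hr hs (fun F f z hf => ?_)
      (fun k a ha => (hdeg k a ha).ge) (htop _)
    exact (hpγ z (e (∑ k ∈ F, f k)) (e (∑ k ∈ F, (z : ℂ) ^ k • f k)) (hγsum F f z hf)).le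

/-- The enveloping C*-algebra of `M_T(K) / ‖·‖_J` is obtained from the homogeneous quotients by the
Doplicher–Roberts method. -/
theorem IsHomogeneousQuotient.exists_isDoplicherRobertsLimit
    (hQ : IsHomogeneousQuotient K J S Q) (hJ : ∀ m n : ℕ, J m n ≤ tensorIdeal K m n)
    (hT : T.IsPositive)
    (hΦ : IsEnvelopingCStarAlgebra (fun a : MatrixAlgebra K => matNorm J (a : T.Mat)) Φ)
    (hle : ∀ a, ‖Φ a‖ ≤ matNorm J (a : T.Mat)) :
    ∃ ι : ∀ m n : ℕ, S.Hom m n →ₗ[ℂ] O,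
      (∀ (m n : ℕ) (a : homogeneous K m n), ι m n (Q m n a) = Φ a) ∧
      IsDoplicherRobertsLimit S ι := by
  obtain ⟨ι, hι⟩ := hQ.exists_factor (Ψ := Φ) fun m n a ha h =>
    norm_le_zero_iff.1 ((hle a).trans ((matNorm_le_homNorm J ha).trans h.le))
  have hW := hQ.limitSpace_eq hι
  obtain ⟨γ, hγ⟩ := hΦ.exists_gauge
  have hγW : ∀ (z : Circle) (k : ℤ), ∀ x ∈ limitSpace S ι k, γ z x = (z : ℂ) ^ k • x :=
    fun z k x hx => gauge_apply_of_mem_limitSpace hW hγ z k hx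
  refine ⟨ι, hι, hQ.factor_tensor hι, fun m n x => ?_, hQ.factor_comp hΦ.map_mul hι,
    hQ.factor_adj hΦ.map_star hι, iSupIndep_limitSpace hγW, ?_, γ, hγW,
    gradedSpace_norm_unique (limitSpace_mul_mem hW hΦ.map_mul)
      (limitSpace_star_mem hW hΦ.map_star) hγW⟩
  · obtain ⟨a, rfl⟩ := hQ.surjective m n x
    simp only [hQ.norm_tensorPow]
    rw [hι, hΦ.norm_eq_matNorm hle hT hJ a.2, matNorm_of_mem J a.2 rfl]
    exact tendsto_homNorm_add J _ rfl
  · refine eq_top_iff.2 fun x _ => ?_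
    exact closure_mono (range_le_gradedSpace hW) (hΦ.denseRange x)

end Limit

end RightTensorCStarPrecategory

end

/-! ### Assembly of the theorem. -/

theorem mainTheorem1 (T : RightTensorCStarPrecategory.{u}) (K J : T.CStarIdeal)
    (hJ : ∀ m n : ℕ, J m n ≤ tensorIdeal K m n) :
    IsStarAlgebraWithRep K ∧
    (∃ p : Seminorm ℂ (MatrixAlgebra K), (∀ a, p a = matNorm J (a : T.Mat)) ∧
      (∀ a b, p (a * b) ≤ p a * p b) ∧ (∀ a, p (star a) = p a)) ∧
    (∀ (a : MatrixAlgebra K) (k : ℤ),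
      Tendsto (fun r : ℕ => homNorm J (r + k).toNat r (a : T.Mat)) atTop
        (𝓝 (degreeNorm J k (a : T.Mat)))) ∧
    ∃ (S : RightTensorCStarPrecategory.{u})
      (Q : ∀ m n : ℕ, homogeneous K m n →ₗ[ℂ] S.Hom m n),
      IsHomogeneousQuotient K J S Q ∧
      ((∀ m n : ℕ, Function.Injective (S.tensor (m := m) (n := n))) ↔
        ∀ m n : ℕ, (J m n : Set (T.Hom m n)) ⊆ annihilator T.kerTensor m n) ∧
      ∃ (O : Type u) (_ : NonUnitalCStarAlgebra O) (i : RightTensorRep K O),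
        i.IsCoisometricOn J ∧
        (NonUnitalStarAlgebra.adjoin ℂ
          (⋃ (n : ℕ) (m : ℕ), Set.range (i n m))).topologicalClosure = ⊤ ∧
        (∀ (B : Type v) [NonUnitalCStarAlgebra B] (π : RightTensorRep K B),
          π.IsCoisometricOn J →
          ∃! ψ : O →⋆ₙₐ[ℂ] B, ∀ (n m : ℕ) (a : K m n), ψ (i n m a) = π n m a) ∧
        ∃ Φ : MatrixAlgebra K →ₗ[ℂ] O,
          (∀ (n m : ℕ) (a : K m n), Φ (matrixEmb K n m a) = i n m a) ∧
          (∀ a, ‖Φ a‖ ≤ matNorm J (a : T.Mat)) ∧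
          IsEnvelopingCStarAlgebra (fun a : MatrixAlgebra K => matNorm J (a : T.Mat)) Φ ∧
          (T.IsPositive → S.IsPositive ∧
            ∃ ι : ∀ m n : ℕ, S.Hom m n →ₗ[ℂ] O,
              (∀ (m n : ℕ) (a : homogeneous K m n), ι m n (Q m n a) = Φ a) ∧
              IsDoplicherRobertsLimit S ι) := by
  obtain ⟨O, hO, Φ, hle, hΦ⟩ := exists_envelope K J hJ
  have hQ := isHomogeneousQuotient hJ
  exact ⟨isStarAlgebraWithRep K,
    ⟨matSeminorm K J, fun _ => rfl, matSeminorm_mul_le J, matSeminorm_star J⟩,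
    tendsto_homNorm_degreeNorm J, quotCategory K hJ, quotMap K J, hQ,
    (hQ.tensor_injective_iff hJ).trans (subset_annihilator_iff J).symm, O, hO,
    RightTensorRep.ofHom Φ hΦ.map_mul hΦ.map_star,
    RightTensorRep.ofHom_isCoisometricOn Φ hΦ.map_mul hΦ.map_star hle,
    adjoin_topologicalClosure_eq_top hΦ.denseRange,
    fun B _ π hπ => hΦ.existsUnique_lift hJ π hπ, Φ, fun _ _ _ => rfl, hle, hΦ,
    fun hT => ⟨hQ.isPositive hT, hQ.exists_isDoplicherRobertsLimit hJ hT hΦ hle⟩⟩
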